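/- **Setting.** Let $f(\cdot;\xi):\mathbb R^d\to\mathbb R$ ($d\ge 1$) be random functions, $\xi\sim D$, with $f(\mathbf z;\xi)$ integrable for every $\mathbf z$, and $F(\mathbf z)=\mathrm E_\xi f(\mathbf z;\xi)$. Every $f(\cdot;\xi)$ is twice differentiable, with $L_1$-Lipschitz gradient and $L_2$-Lipschitz Hessian (spectral norm), $L_1,L_2>0$. Given independent samples $\mathcal S=\{\xi_1,\dots,\xi_m\}$ from $D$, put $g=F_{\mathcal S}=\frac1m\sum_{i=1}^m f(\cdot;\xi_i)$. Fix $\mathbf x\in\mathbb R^d$ and write $\hat g(\mathbf u)=g(\mathbf x+\mathbf u)-g(\mathbf x)-\nabla g(\mathbf x)^\top\mathbf u$. An IFO call returns the value and the gradient of one $f(\cdot;\xi_i)$ at one point; the procedures below access $g$ only by such calls. **NEON**, with parameters $\eta,t,\mathcal F,U,r$: draw $\mathbf u_0$ uniformly from the sphere of radius $r$, independently of $\mathcal S$; for $\tau=0,\dots,t$ set $\mathbf u_{\tau+1}=\mathbf u_\tau-\eta\nabla\hat g(\mathbf u_\tau)$. Among the iterates $\mathbf u_0,\dots,\mathbf u_{t+1}$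 with $\|\mathbf u_\tau\|\le U$ return a minimizer of $\hat g$ (the first one) if its value is $\le-2.5\mathcal F$; otherwise return $0$. **NEON$^+$**, with parameters $\eta,\zeta,t,\mathcal F,U,r$: draw $\mathbf y_0=\mathbf u_0$ in the same way. For $\tau=0,\dots,t$: if $\hat g(\mathbf y_\tau)-\hat g(\mathbf u_\tau)-\nabla\hat g(\mathbf u_\tau)^\top(\mathbf y_\tau-\mathbf u_\tau)<-\frac\gamma2\|\mathbf y_\tau-\mathbf u_\tau\|^2$, stop and return the first $\mathbf y_j$ ($j\le\tau$) with $\|\mathbf y_j-\mathbf u_j\|\ge\zeta\sqrt{6\eta\mathcal F}$ if there is one, and $\mathbf y_\tau-\mathbf u_\tau$ otherwise; else set $\mathbf y_{\tau+1}=\mathbf u_\tau-\eta\nabla\hat g(\mathbf u_\tau)$ and $\mathbf u_{\tau+1}=\mathbf y_{\tau+1}+\zeta(\mathbf y_{\tau+1}-\mathbf y_\tau)$. If the loop ends, return among $\mathbf y_0,\dots,\mathbf y_{t+1}$ with $\|\mathbf y_\tau\|\le U$ a minimizer of $\hat g$ (the first one) if its value is $\le-2\mathcal F$, and $0$ otherwise.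 **Parameters.** Let $0<\gamma\le L_1$, $\delta\in(0,1)$, $\hat c\ge 43$, $\ell=\log\frac{3dL_1}{2\gamma\delta}$, and $$\mathcal F=\frac{\eta\gamma^3L_1}{L_2^2\,\ell^3},\qquad r=\frac{\sqrt\eta\,\gamma^2}{\sqrt{L_1}\,L_2\,\ell^2},\qquad s=c=\frac{1}{(12\hat c)^2\,\ell},\qquad M=\frac{16L_1^2\log(6d/\delta)}{s^2\gamma^2}.$$ For NEON take $\eta=a/L_1$, $t=\big\lceil\hat c\,\ell/(\eta\gamma)\big\rceil$, $U=4\hat c(\sqrt{\eta L_1}\mathcal F/L_2)^{1/3}$. For NEON$^+$ take $\eta=a/(L_1\ell)$, $t=\big\lceil\hat c\,\ell/\sqrt{\eta\gamma}\big\rceil$, $U=12\hat c(\sqrt{\eta L_1}\mathcal F/L_2)^{1/3}$, $\zeta=1-\sqrt{\eta\gamma}$. **Lemma.** There is an absolute constant $C>0$, and for every $\hat c\ge 43$ there are $c_{\max}>0$ and $\delta_0\in(0,1)$ depending only on $\hat c$, such that for every constant $a\in(0,c_{\max}]$ there is $K>0$, depending only on $\hat c$ and $a$, for which the following holds in the above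 setting, for NEON and for NEON$^+$, whenever $\delta\le\delta_0$ and $m\ge M$ (probabilities are over $\mathcal S$ and $\mathbf u_0$). 1. If $\lambda_{\min}(\nabla^2F(\mathbf x))\le-\gamma$, then with probability at least $1-\delta$ the procedure returns a vector $\mathbf u\ne0$ with $$\frac{\mathbf u^\top\nabla^2F(\mathbf x)\mathbf u}{\|\mathbf u\|^2}\le-c\gamma .$$ 2. With probability at least $1-C\delta$: if the procedure returns $0$, then $\lambda_{\min}(\nabla^2F(\mathbf x))\ge-2\gamma$. 3. If $m=\lceil M\rceil$, then for all samples and all $\mathbf u_0$ the procedure terminates after at most $K\,\ell^4(L_1/\gamma)^3=\widetilde O(\gamma^{-3})$ IFO calls for NEON, and at most $K\,\ell^{9/2}(L_1/\gamma)^{5/2}=\widetilde O(\gamma^{-2.5})$ IFO calls for NEON$^+$. -/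

import Mathlib

open MeasureTheory

noncomputable section

/-- The Euclidean space `ℝ^d`. -/
abbrev Vec (d : ℕ) : Type := EuclideanSpace ℝ (Fin d)

/-- The Hessian of `g` at `x`, as a linear operator. -/
def hessian {d : ℕ} (g : Vec d → ℝ) (x : Vec d) : Vec d →L[ℝ] Vec d :=
  fderiv ℝ (gradient g) x

/-- The smallest (real) eigenvalue of a linear operator. -/
def lambdaMin {d : ℕ} (A : Vec d →L[ℝ] Vec d) : ℝ :=
  sInf {μ : ℝ | Module.End.HasEigenvalue (A : Vec d →ₗ[ℝ] Vec d) μ}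

/-- `g` is twice differentiable with `L₁`-Lipschitz gradient and `L₂`-Lipschitz Hessian
(in the spectral norm). -/
def SmoothFun {d : ℕ} (L₁ L₂ : ℝ) (g : Vec d → ℝ) : Prop :=
  Differentiable ℝ g ∧ Differentiable ℝ (gradient g) ∧
    (∀ y z, ‖gradient g y - gradient g z‖ ≤ L₁ * ‖y - z‖) ∧
    (∀ y z, ‖hessian g y - hessian g z‖ ≤ L₂ * ‖y - z‖)

/-! ### Programs with access to an incremental first-order oracle -/

/-- A deterministic program that can access `m` component functions on `ℝ^d` only through
first-order queries: a query names a component and a point, and the program continues with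
the value and the gradient of that component at that point. -/
inductive IFOProg (m d : ℕ) (α : Type) : Type where
  | done : α → IFOProg m d α
  | query : Fin m → Vec d → (ℝ × Vec d → IFOProg m d α) → IFOProg m d α

namespace IFOProg

variable {m d : ℕ} {α β : Type}

/-- Sequential composition. -/
def andThen : IFOProg m d α → (α → IFOProg m d β) → IFOProg m d β
  | done a, k => k a
  | query i z c, k => query i z (fun q => andThen (c q) k)

/-- Run a program against an oracle: the result, and the number of oracle calls made. -/
def run (o : Fin m → Vec d → ℝ × Vec d) : IFOProg m d α → α × ℕ
  | done a => (a, 0)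
  | query i z c => ((run o (c (o i z))).1, (run o (c (o i z))).2 + 1)

/-- Query the listed components at `z` and add up the answers. -/
def sumQuery (z : Vec d) : List (Fin m) → IFOProg m d (ℝ × Vec d)
  | [] => done (0, 0)
  | i :: l => query i z (fun q => andThen (sumQuery z l) (fun q' => done (q + q')))

/-- The value and the gradient at `z` of the average of the `m` components. -/
def avgQuery (z : Vec d) : IFOProg m d (ℝ × Vec d) :=
  andThen (sumQuery z (List.finRange m)) (fun q => done ((m : ℝ)⁻¹ • q))

end IFOProg

open IFOProg

/-- The oracle of the sampled components `f(·; ξ_1), …, f(·; ξ_m)`. -/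
def ifo {m d : ℕ} {Ξ : Type*} (f : Vec d → Ξ → ℝ) (ξ : Fin m → Ξ) (i : Fin m) (z : Vec d) :
    ℝ × Vec d :=
  (f z (ξ i), gradient (fun w => f w (ξ i)) z)

/-! ### The two procedures

Below `g` is the average of the `m` components, `p = (g x, ∇g x)`,
and `ĝ(u) = g (x + u) - g x - ⟪∇g x, u⟫`. -/

/-- `ĝ(u)`, given `p = (g x, ∇g x)` and the value `v = g (x + u)`. -/
def gHat {d : ℕ} (p : ℝ × Vec d) (u : Vec d) (v : ℝ) : ℝ :=
  v - p.1 - inner ℝ p.2 u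

/-- Given a list of pairs `(u, ĝ(u))`, take the (first) pair with the smallest `ĝ(u)` among those
with `‖u‖ ≤ U`; return its `u` if `ĝ(u) ≤ -θ`, and `0` otherwise. -/
def selectMin {d : ℕ} (U θ : ℝ) (h : List (Vec d × ℝ)) : Vec d :=
  match (h.filter (fun q => decide (‖q.1‖ ≤ U))).argmin Prod.snd with
  | some q => if q.2 ≤ -θ then q.1 else 0
  | none => 0

/-- `n` gradient steps from `u`, returning the list of all iterates (the last one included)
together with the values of `ĝ`. -/
def neonLoop {m d : ℕ} (x : Vec d) (p : ℝ × Vec d) (η : ℝ) :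
    ℕ → Vec d → IFOProg m d (List (Vec d × ℝ))
  | 0, u => andThen (avgQuery (x + u)) (fun q => done [(u, gHat p u q.1)])
  | n + 1, u =>
      andThen (avgQuery (x + u)) (fun q =>
        andThen (neonLoop x p η n (u - η • (q.2 - p.2))) (fun l =>
          done ((u, gHat p u q.1) :: l)))

/-- NEON, started from the noise vector `u₀`, with steps `τ = 0, …, t`. -/
def neon {m d : ℕ} (x : Vec d) (η : ℝ) (t : ℕ) (Fthr U : ℝ) (u₀ : Vec d) :
    IFOProg m d (Vec d) :=
  andThen (avgQuery x) (fun p =>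
    andThen (neonLoop x p η (t + 1) u₀) (fun l => done (selectMin U (5 / 2 * Fthr) l)))

/-- NCFind on the pairs `(y_0, u_0), …, (y_τ, u_τ)`, where `(y, u) = (y_τ, u_τ)`: the first `y_j`
with `‖y_j - u_j‖ ≥ ζ √(6 η F)` if there is one, and `y_τ - u_τ` otherwise. -/
def ncFind {d : ℕ} (ζ η Fthr : ℝ) (h : List (Vec d × Vec d)) (y u : Vec d) : Vec d :=
  match h.find? (fun q => decide (ζ * √(6 * η * Fthr) ≤ ‖q.1 - q.2‖)) with
  | some q => q.1
  | none => y - u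

/-- The loop of NEON⁺ with `n` further steps from `(y, u)`; `h` and `v` hold the earlier pairs
`(y_k, u_k)` and the earlier `(y_k, ĝ(y_k))`. -/
def neonPlusLoop {m d : ℕ} (x : Vec d) (p : ℝ × Vec d) (η γ Fthr U ζ : ℝ) :
    ℕ → Vec d → Vec d → List (Vec d × Vec d) → List (Vec d × ℝ) → IFOProg m d (Vec d)
  | 0, y, _, _, v =>
      andThen (avgQuery (x + y)) (fun qy =>
        done (selectMin U (2 * Fthr) (v ++ [(y, gHat p y qy.1)])))
  | n + 1, y, u, h, v =>
      andThen (avgQuery (x + y)) (fun qy =>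
        andThen (avgQuery (x + u)) (fun qu =>
          if gHat p y qy.1 - gHat p u qu.1 - inner ℝ (qu.2 - p.2) (y - u)
              < -(γ / 2) * ‖y - u‖ ^ 2 then
            done (ncFind ζ η Fthr (h ++ [(y, u)]) y u)
          else
            neonPlusLoop x p η γ Fthr U ζ n
              (u - η • (qu.2 - p.2))
              (u - η • (qu.2 - p.2) + ζ • (u - η • (qu.2 - p.2) - y))
              (h ++ [(y, u)]) (v ++ [(y, gHat p y qy.1)])))

/-- NEON⁺, started from the noise vector `u₀`, with steps `τ = 0, …, t`. -/
def neonPlus {m d : ℕ} (x : Vec d) (η γ : ℝ) (t : ℕ) (Fthr U ζ : ℝ) (u₀ : Vec d) :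
    IFOProg m d (Vec d) :=
  andThen (avgQuery x) (fun p => neonPlusLoop x p η γ Fthr U ζ (t + 1) u₀ u₀ [] [])

/-! ### Parameters -/

/-- The logarithmic factor `log (3 d L₁ / (2 γ δ))`. -/
def logFactor (d : ℕ) (L₁ γ δ : ℝ) : ℝ := Real.log (3 * d * L₁ / (2 * γ * δ))

/-- The function-decrease parameter `η γ³ L₁ L₂⁻² ℓ⁻³`. -/
def decreaseParam (η L₁ L₂ γ ℓ : ℝ) : ℝ := η * γ ^ 3 * L₁ / (L₂ ^ 2 * ℓ ^ 3)

/-- The noise radius `√η γ² L₁^(-1/2) L₂⁻¹ ℓ⁻²`. -/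
def noiseRadius (η L₁ L₂ γ ℓ : ℝ) : ℝ := √η * γ ^ 2 / (√L₁ * L₂ * ℓ ^ 2)

/-- The base `(√(η L₁) F / L₂)^(1/3)` of the search radius. -/
def searchScale (η L₁ L₂ γ ℓ : ℝ) : ℝ :=
  (√(η * L₁) * decreaseParam η L₁ L₂ γ ℓ / L₂) ^ (1 / 3 : ℝ)

/-- The constant `(12 ĉ)⁻² ℓ⁻¹`. -/
def ncConst (chat ℓ : ℝ) : ℝ := 1 / ((12 * chat) ^ 2 * ℓ)

/-- The mini-batch size `16 L₁² log (6 d / δ) / (s² γ²)`. -/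
def batchSize (d : ℕ) (L₁ γ δ s : ℝ) : ℝ :=
  16 * L₁ ^ 2 * Real.log (6 * d / δ) / (s ^ 2 * γ ^ 2)

/-- NEON with its parameters, run on the mini-batch `ξ` from the noise `u₀`:
returned vector and number of oracle calls. -/
def neonRun {m d : ℕ} {Ξ : Type*} (f : Vec d → Ξ → ℝ) (x : Vec d) (chat η L₁ L₂ γ ℓ : ℝ)
    (ξ : Fin m → Ξ) (u₀ : Vec d) : Vec d × ℕ :=
  (neon x η ⌈chat * ℓ / (η * γ)⌉₊ (decreaseParam η L₁ L₂ γ ℓ)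
    (4 * chat * searchScale η L₁ L₂ γ ℓ) u₀).run (ifo f ξ)

/-- NEON⁺ with its parameters, run on the mini-batch `ξ` from the noise `u₀`:
returned vector and number of oracle calls. -/
def neonPlusRun {m d : ℕ} {Ξ : Type*} (f : Vec d → Ξ → ℝ) (x : Vec d) (chat η L₁ L₂ γ ℓ : ℝ)
    (ξ : Fin m → Ξ) (u₀ : Vec d) : Vec d × ℕ :=
  (neonPlus x η γ ⌈chat * ℓ / √(η * γ)⌉₊ (decreaseParam η L₁ L₂ γ ℓ)
    (12 * chat * searchScale η L₁ L₂ γ ℓ) (1 - √(η * γ)) u₀).run (ifo f ξ)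

/-- The uniform distribution on the sphere of radius `r` centred at the origin of `ℝ^d`. -/
def sphereUniform (d : ℕ) (r : ℝ) : Measure (Vec d) :=
  (((volume : Measure (Vec d)).toSphere Set.univ)⁻¹ • (volume : Measure (Vec d)).toSphere).map
    (fun v : Metric.sphere (0 : Vec d) 1 => r • (v : Vec d))

/-- The joint law of `m` independent samples from `D` and an independent uniform noise vector
on the sphere of radius `r`. -/
def runLaw {Ξ : Type*} [MeasurableSpace Ξ] (D : Measure Ξ) (m d : ℕ) (r : ℝ) :
    Measure ((Fin m → Ξ) × Vec d) :=
  (Measure.pi (fun _ : Fin m => D)).prod (sphereUniform d r)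

/-- `u` is a nonzero vector with `uᵀ A u / ‖u‖² ≤ -κ`. -/
def IsNC {d : ℕ} (A : Vec d →L[ℝ] Vec d) (κ : ℝ) (u : Vec d) : Prop :=
  u ≠ 0 ∧ inner ℝ u (A u) / ‖u‖ ^ 2 ≤ -κ

end

open IFOProg

noncomputable section

/-! Failure confines the iterates to a ball, and confinement is improbable in the presence of
negative curvature.

Let `h` be ĝ and `H` the Hessian at `x` of the sampled average. A point of the search ball with
sufficiently negative `h` is a direction of negative curvature of `H`, by a second-order Taylor
expansion. A run of NEON⁺ stopped by its test also produces such a direction, either from the failed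
convexity test itself or from a large momentum, which has been paid for by a decrease of `h`. A
failing run therefore meets neither event. An energy (`h` for gradient descent, `2ηh` plus the
squared last displacement for the accelerated method) then bounds the path and keeps every iterate
in the ball: `LocalModel.gd_failure`, `LocalModel.agd_failure`.

Let `e` be a lowest eigenvector of `H`. If two confined runs start from points whose difference
leans towards `e`, their difference obeys the linearized recursion up to small relative errors, so
its component along `e` grows exponentially: `power_growth`, `momentum_growth`. After `t + 1` steps
the growth exceeds `exp (3ℓ)`, which contradicts confinement unless the initial separation was below
`r / (2dn)`. The origin is a fixed point of both methods and serves as one more confined point. A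
set of starting points on the sphere with this property has probability at most `3 / n`
(`sphereUniform_le`): many translates along `e` of the cone over it are disjoint and fit into a
slightly larger ball.

All this concerns `H`. That `H` is close to the true Hessian, up to probability `δ / 6`, is an
operator-norm concentration bound (`measure_norm_average_sub_le`), proved by a recursion for the
trace moments of the centered sum, in which one sample is exchanged with a fresh one. With `n = ⌈9 /
δ⌉` the failure probability is at most `δ / 6 + δ / 3`.

The certificate follows by a dichotomy: if the lowest eigenvalue is at most `-γ`, returning zero is
a failure, and otherwise the certificate is correct. The cost is counted by running the programs.
`Scaling` gathers the relations between the parameters on which the numerical estimates rest. -/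

lemma fderiv_eq_toDual_gradient {d : ℕ} (g : Vec d → ℝ) (z : Vec d) :
    fderiv ℝ g z = InnerProductSpace.toDual ℝ (Vec d) (gradient g z) := by
  simp [gradient]

/-! ### Taylor estimates and the local model of ĝ -/

namespace SmoothFun

variable {d : ℕ} {L₁ L₂ : ℝ} {g : Vec d → ℝ}

/-- The mean value inequality on a ball around `u` gives the constant `L₁` instead of the sharp `L₁
/ 2`; the step sizes are small enough to absorb this. -/
lemma taylor_one (hg : SmoothFun L₁ L₂ g) (hL₁ : 0 ≤ L₁) (u v : Vec d) :
    |g v - g u - inner ℝ (gradient g u) (v - u)| ≤ L₁ * ‖v - u‖ ^ 2 := by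
  obtain ⟨h1, -, h3, -⟩ := hg
  have key := Convex.norm_image_sub_le_of_norm_fderiv_le' (𝕜 := ℝ) (f := g)
    (s := Metric.closedBall u ‖v - u‖) (C := L₁ * ‖v - u‖) (x := u) (y := v)
    (φ := InnerProductSpace.toDual ℝ (Vec d) (gradient g u)) (fun z _ => h1 z)
    (fun z hz => by
      rw [fderiv_eq_toDual_gradient, ← map_sub, LinearIsometryEquiv.norm_map]
      refine (h3 z u).trans (mul_le_mul_of_nonneg_left ?_ hL₁)
      simpa [dist_eq_norm] using hz)
    (convex_closedBall _ _) (by simp) (by simp [dist_eq_norm])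
  rw [Real.norm_eq_abs, InnerProductSpace.toDual_apply_apply] at key
  calc _ ≤ _ := key
    _ = _ := by ring

lemma taylor_gradient (hg : SmoothFun L₁ L₂ g) (hL₂ : 0 ≤ L₂) (x : Vec d) {u v : Vec d} {R : ℝ}
    (hu : ‖u - x‖ ≤ R) (hv : ‖v - x‖ ≤ R) :
    ‖gradient g v - gradient g u - hessian g x (v - u)‖ ≤ L₂ * R * ‖v - u‖ := by
  obtain ⟨-, h2, -, h4⟩ := hg
  exact Convex.norm_image_sub_le_of_norm_fderiv_le' (𝕜 := ℝ) (f := gradient g)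
    (s := Metric.closedBall x R) (C := L₂ * R) (φ := hessian g x) (fun z _ => h2 z)
    (fun z hz => (h4 z x).trans (mul_le_mul_of_nonneg_left (by simpa [dist_eq_norm] using hz) hL₂))
    (convex_closedBall _ _) (by simpa [dist_eq_norm] using hu) (by simpa [dist_eq_norm] using hv)

/-- Symmetry of second derivatives needs only differentiability of the gradient at the point, so no
continuity of the Hessian enters. It is what makes orthonormal eigenbases available. -/
lemma hessian_symm (hg : SmoothFun L₁ L₂ g) (x v w : Vec d) :
    inner ℝ (hessian g x v) w = inner ℝ v (hessian g x w) := by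
  obtain ⟨h1, h2, -, -⟩ := hg
  have hd : ∀ y, HasFDerivAt g (InnerProductSpace.toDual ℝ (Vec d) (gradient g y)) y := fun y => by
    rw [← fderiv_eq_toDual_gradient]; exact (h1 y).hasFDerivAt
  let J : Vec d →L[ℝ] (Vec d →L[ℝ] ℝ) := LinearMap.toContinuousLinearMap
    { toFun := fun v => InnerProductSpace.toDual ℝ (Vec d) v
      map_add' := fun v w => map_add _ v w
      map_smul' := fun c v => by simp }
  have hd2 : HasFDerivAt (fun y => InnerProductSpace.toDual ℝ (Vec d) (gradient g y))
      (J.comp (hessian g x)) x :=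
    J.hasFDerivAt.comp x (h2 x).hasFDerivAt
  have := second_derivative_symmetric hd hd2 v w
  change inner ℝ (hessian g x v) w = inner ℝ (hessian g x w) v at this
  rw [this, real_inner_comm]

lemma norm_hessian_le (hg : SmoothFun L₁ L₂ g) (hL₁ : 0 ≤ L₁) (x : Vec d) :
    ‖hessian g x‖ ≤ L₁ := by
  obtain ⟨-, -, h3, -⟩ := hg
  have : LipschitzWith ⟨L₁, hL₁⟩ (gradient g) := LipschitzWith.of_dist_le_mul fun y z => by
    rw [dist_eq_norm, dist_eq_norm]
    exact h3 y z
  exact norm_fderiv_le_of_lipschitz ℝ this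

lemma taylor_two (hg : SmoothFun L₁ L₂ g) (hL₂ : 0 ≤ L₂) (x : Vec d) {u v : Vec d} {R : ℝ}
    (hu : ‖u - x‖ ≤ R) (hv : ‖v - x‖ ≤ R) :
    |g v - g u - inner ℝ (gradient g u) (v - u) - 1 / 2 * inner ℝ (v - u) (hessian g x (v - u))|
      ≤ 2 * (L₂ * R) * ‖v - u‖ ^ 2 := by
  have hsym := hg.hessian_symm x
  set H := hessian g x
  let q : Vec d → ℝ := fun z => g z - 1 / 2 * inner ℝ (z - u) (H (z - u))
  have hR : 0 ≤ R := (norm_nonneg _).trans hu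
  have hq : ∀ z, HasFDerivAt q
      (InnerProductSpace.toDual ℝ (Vec d) (gradient g z - H (z - u))) z := by
    intro z
    have h1 : HasFDerivAt g (InnerProductSpace.toDual ℝ (Vec d) (gradient g z)) z := by
      rw [← fderiv_eq_toDual_gradient]; exact (hg.1 z).hasFDerivAt
    have h2 : HasFDerivAt (fun z : Vec d => z - u) (ContinuousLinearMap.id ℝ (Vec d)) z :=
      (hasFDerivAt_id z).sub_const u
    have h3 : HasFDerivAt (fun z : Vec d => H (z - u)) (H.comp (ContinuousLinearMap.id ℝ _)) z :=
      H.hasFDerivAt.comp z h2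
    have h4 := h1.sub ((h2.inner ℝ h3).const_mul (1 / 2 : ℝ))
    refine h4.congr_fderiv ?_
    ext w
    simp only [map_sub, InnerProductSpace.toDual_apply_apply, sub_apply,
      smul_apply, ContinuousLinearMap.comp_apply, fderivInnerCLM_apply,
      ContinuousLinearMap.prod_apply, ContinuousLinearMap.id_apply, smul_eq_mul]
    have e1 := hsym (z - u) w
    have e2 := real_inner_comm (H (z - u)) w
    simp only [map_sub, inner_sub_left, inner_sub_right] at e1 e2 ⊢
    linarith
  -- The derivative of `q` differs from that at `u` by `∇g z - ∇g u - H (z - u)`. The first ball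
  -- makes `taylor_gradient` applicable, the second bounds `‖z - u‖` by `‖v - u‖`.
  have key := Convex.norm_image_sub_le_of_norm_hasFDerivWithin_le' (𝕜 := ℝ) (f := q)
    (s := Metric.closedBall x R ∩ Metric.closedBall u ‖v - u‖) (C := 2 * (L₂ * R) * ‖v - u‖)
    (x := u) (y := v)
    (φ := InnerProductSpace.toDual ℝ (Vec d) (gradient g u)) (fun z _ => (hq z).hasFDerivWithinAt)
    (fun z hz => by
      rw [← map_sub, LinearIsometryEquiv.norm_map]
      have hz1 : ‖z - x‖ ≤ R := by simpa [dist_eq_norm] using hz.1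
      have hz2 : ‖z - u‖ ≤ ‖v - u‖ := by simpa [dist_eq_norm] using hz.2
      have := hg.taylor_gradient hL₂ x hu hz1
      calc _ = ‖gradient g z - gradient g u - H (z - u)‖ := by congr 1; abel
        _ ≤ L₂ * R * ‖z - u‖ := this
        _ ≤ L₂ * R * ‖v - u‖ := mul_le_mul_of_nonneg_left hz2 (by positivity)
        _ ≤ _ := by nlinarith [mul_nonneg (mul_nonneg hL₂ hR) (norm_nonneg (v - u))])
    ((convex_closedBall _ _).inter (convex_closedBall _ _))
    ⟨by simpa [dist_eq_norm] using hu, by simp⟩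
    ⟨by simpa [dist_eq_norm] using hv, by simp [dist_eq_norm]⟩
  rw [Real.norm_eq_abs, InnerProductSpace.toDual_apply_apply] at key
  calc _ = |q v - q u - inner ℝ (gradient g u) (v - u)| := by
        congr 1; simp only [q, sub_self, map_zero, inner_zero_left]; ring
    _ ≤ _ := key
    _ = _ := by ring

lemma sum_smul {m : ℕ} (f : Fin m → Vec d → ℝ) (hm : 0 < m)
    (hf : ∀ i, SmoothFun L₁ L₂ (f i)) :
    SmoothFun L₁ L₂ (fun z => (m : ℝ)⁻¹ * ∑ i, f i z) ∧
      (∀ z, gradient (fun z => (m : ℝ)⁻¹ * ∑ i, f i z) z = (m : ℝ)⁻¹ • ∑ i, gradient (f i) z) ∧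
      (∀ z, hessian (fun z => (m : ℝ)⁻¹ * ∑ i, f i z) z = (m : ℝ)⁻¹ • ∑ i, hessian (f i) z) := by
  have hm' : (0 : ℝ) < m := by exact_mod_cast hm
  have hgrad : ∀ z, HasGradientAt (fun z => (m : ℝ)⁻¹ * ∑ i, f i z)
      ((m : ℝ)⁻¹ • ∑ i, gradient (f i) z) z := by
    intro z
    rw [hasGradientAt_iff_hasFDerivAt]
    have h1 : ∀ i ∈ Finset.univ, HasFDerivAt (f i)
        (InnerProductSpace.toDual ℝ (Vec d) (gradient (f i) z)) z := fun i _ => by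
      rw [← fderiv_eq_toDual_gradient]; exact ((hf i).1 z).hasFDerivAt
    have h2 := (HasFDerivAt.fun_sum h1).const_mul (m : ℝ)⁻¹
    refine h2.congr_fderiv ?_
    simp
  have hg : (gradient fun z => (m : ℝ)⁻¹ * ∑ i, f i z)
      = fun z => (m : ℝ)⁻¹ • ∑ i, gradient (f i) z := funext fun z => (hgrad z).gradient
  have hhess : ∀ z, HasFDerivAt (gradient fun z => (m : ℝ)⁻¹ * ∑ i, f i z)
      ((m : ℝ)⁻¹ • ∑ i, hessian (f i) z) z := by
    intro z
    rw [hg]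
    exact (HasFDerivAt.fun_sum fun i _ => ((hf i).2.1 z).hasFDerivAt).const_smul (m : ℝ)⁻¹
  have hh : ∀ z, hessian (fun z => (m : ℝ)⁻¹ * ∑ i, f i z) z = (m : ℝ)⁻¹ • ∑ i, hessian (f i) z :=
    fun z => (hhess z).fderiv
  have avg : ∀ {W : Type} [NormedAddCommGroup W] [NormedSpace ℝ W] (p q : Fin m → W) (C : ℝ),
      (∀ i, ‖p i - q i‖ ≤ C) → ‖(m : ℝ)⁻¹ • ∑ i, p i - (m : ℝ)⁻¹ • ∑ i, q i‖ ≤ C := by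
    intro W _ _ p q C h
    rw [← smul_sub, ← Finset.sum_sub_distrib, norm_smul, norm_inv, Real.norm_natCast,
      inv_mul_le_iff₀ hm']
    calc _ ≤ ∑ i, ‖p i - q i‖ := norm_sum_le _ _
      _ ≤ ∑ _i : Fin m, C := Finset.sum_le_sum fun i _ => h i
      _ = _ := by simp
  refine ⟨⟨fun z => (hgrad z).differentiableAt, fun z => (hhess z).differentiableAt, ?_, ?_⟩,
    fun z => (hgrad z).gradient, hh⟩
  · intro y z
    rw [hg]
    exact avg _ _ _ fun i => (hf i).2.2.1 y z
  · intro y z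
    rw [hh, hh]
    exact avg _ _ _ fun i => (hf i).2.2.2 y z

end SmoothFun

/-- `h` vanishes to first order at `0` and has gradient `G`, which is `L₁`-Lipschitz and is
approximated by the symmetric operator `H` on balls around `0`. -/
structure LocalModel {d : ℕ} (L₁ L₂ : ℝ) (h : Vec d → ℝ) (G : Vec d → Vec d)
    (H : Vec d →L[ℝ] Vec d) : Prop where
  h_zero : h 0 = 0
  G_zero : G 0 = 0
  symm : ∀ v w, inner ℝ (H v) w = inner ℝ v (H w)
  norm_le : ‖H‖ ≤ L₁
  lip : ∀ u v, ‖G v - G u‖ ≤ L₁ * ‖v - u‖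
  taylor : ∀ u v, |h v - h u - inner ℝ (G u) (v - u)| ≤ L₁ * ‖v - u‖ ^ 2
  lip₂ : ∀ {u v : Vec d} {R : ℝ}, ‖u‖ ≤ R → ‖v‖ ≤ R →
    ‖G v - G u - H (v - u)‖ ≤ L₂ * R * ‖v - u‖
  taylor₂ : ∀ {u v : Vec d} {R : ℝ}, ‖u‖ ≤ R → ‖v‖ ≤ R →
    |h v - h u - inner ℝ (G u) (v - u) - 1 / 2 * inner ℝ (v - u) (H (v - u))|
      ≤ 2 * (L₂ * R) * ‖v - u‖ ^ 2

lemma SmoothFun.localModel {d : ℕ} {L₁ L₂ : ℝ} {g : Vec d → ℝ} (hg : SmoothFun L₁ L₂ g)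
    (hL₁ : 0 ≤ L₁) (hL₂ : 0 ≤ L₂) (x : Vec d) :
    LocalModel L₁ L₂ (fun u => gHat (g x, gradient g x) u (g (x + u)))
      (fun u => gradient g (x + u) - gradient g x) (hessian g x) where
  h_zero := by simp [gHat]
  G_zero := by simp
  symm := hg.hessian_symm x
  norm_le := hg.norm_hessian_le hL₁ x
  lip u v := by simpa using hg.2.2.1 (x + v) (x + u)
  taylor u v := by
    have := hg.taylor_one hL₁ (x + u) (x + v)
    simp only [add_sub_add_left_eq_sub] at this
    convert this using 2
    simp only [gHat, inner_sub_left, inner_sub_right]; ring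
  lip₂ {u v R} hu hv := by
    have := hg.taylor_gradient hL₂ x (u := x + u) (v := x + v) (R := R) (by simpa) (by simpa)
    simpa using this
  taylor₂ {u v R} hu hv := by
    have := hg.taylor_two hL₂ x (u := x + u) (v := x + v) (R := R) (by simpa) (by simpa)
    simp only [add_sub_add_left_eq_sub] at this
    convert this using 2
    simp only [gHat, inner_sub_left, inner_sub_right]; ring

/-! ### Execution of the programs -/

namespace IFOProg

variable {m d : ℕ} {α β : Type} (o : Fin m → Vec d → ℝ × Vec d)

lemma run_andThen (p : IFOProg m d α) (k : α → IFOProg m d β) :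
    (andThen p k).run o = (((k (p.run o).1).run o).1, (p.run o).2 + ((k (p.run o).1).run o).2) := by
  induction p with
  | done a => simp [andThen, run]
  | query i z c ih => simp [andThen, run, ih]; omega

lemma run_sumQuery (z : Vec d) (l : List (Fin m)) :
    (sumQuery z l).run o = ((l.map fun i => o i z).sum, l.length) := by
  induction l with
  | nil => simp [sumQuery, run]
  | cons i l ih => simp [sumQuery, run, run_andThen, ih]

lemma run_avgQuery (z : Vec d) :
    (avgQuery z).run o = ((m : ℝ)⁻¹ • ∑ i, o i z, m) := by
  simp [avgQuery, run_andThen, run_sumQuery, run, Fin.sum_univ_def]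

end IFOProg

/-- One gradient step. -/
def gdStep {d : ℕ} (η : ℝ) (G : Vec d → Vec d) (u : Vec d) : Vec d := u - η • G u

/-- One accelerated step on a pair `(y, u)`. -/
def agdStep {d : ℕ} (η ζ : ℝ) (G : Vec d → Vec d) (q : Vec d × Vec d) : Vec d × Vec d :=
  (q.2 - η • G q.2, q.2 - η • G q.2 + ζ • (q.2 - η • G q.2 - q.1))

section programs

variable {m d : ℕ} (o : Fin m → Vec d → ℝ × Vec d) (x : Vec d)

/-- The averaged answer of the oracle. -/
def avgAns (z : Vec d) : ℝ × Vec d := (m : ℝ)⁻¹ • ∑ i, o i z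

/-- After this the oracle disappears from the analysis: only iterates of a fixed map remain. -/
lemma run_neonLoop (p : ℝ × Vec d) (η : ℝ) (n : ℕ) (u : Vec d) :
    (neonLoop x p η n u).run o =
      ((List.range (n + 1)).map (fun k =>
        let w := (gdStep η fun z => (avgAns o (x + z)).2 - p.2)^[k] u
        (w, gHat p w (avgAns o (x + w)).1)), m * (n + 1)) := by
  induction n generalizing u with
  | zero => simp [neonLoop, run_andThen, run_avgQuery, run, avgAns]
  | succ n ih =>
    rw [neonLoop, run_andThen, run_avgQuery, run_andThen, ih, List.range_succ_eq_map (n := n + 1)]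
    simp only [run, List.map_cons, List.map_map, Function.iterate_zero, id_eq, Function.comp_def,
      Function.iterate_succ, Function.comp_apply]
    refine Prod.ext ?_ ?_
    · rfl
    · simp only; ring

/-- The cost is one averaged query at `x` and one at each of the `t + 2` iterates. -/
lemma run_neon (η : ℝ) (t : ℕ) (Fthr U : ℝ) (u₀ : Vec d) :
    (neon x η t Fthr U u₀).run o =
      (selectMin U (5 / 2 * Fthr) ((List.range (t + 2)).map (fun k =>
        let w := (gdStep η fun z => (avgAns o (x + z)).2 - (avgAns o x).2)^[k] u₀
        (w, gHat (avgAns o x) w (avgAns o (x + w)).1))), m * (t + 3)) := by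
  rw [neon, run_andThen, run_avgQuery, run_andThen, run_neonLoop]
  refine Prod.ext ?_ ?_
  · simp [run, avgAns]
  · simp only [run]; ring

lemma selectMin_spec {U θ : ℝ} {l : List (Vec d × ℝ)}
    (h : ∃ q ∈ l, ‖q.1‖ ≤ U ∧ q.2 ≤ -θ) :
    ∃ q ∈ l, ‖q.1‖ ≤ U ∧ q.2 ≤ -θ ∧ selectMin U θ l = q.1 := by
  obtain ⟨q, hq, hqU, hqθ⟩ := h
  have hmem : q ∈ l.filter (fun q => decide (‖q.1‖ ≤ U)) := by simp [hq, hqU]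
  unfold selectMin
  cases hc : (l.filter (fun q => decide (‖q.1‖ ≤ U))).argmin Prod.snd with
  | none => rw [List.argmin_eq_none] at hc; simp [hc] at hmem
  | some q' =>
    have h1 := List.argmin_mem hc
    have h2 : q'.2 ≤ q.2 := List.le_of_mem_argmin hmem hc
    rw [List.mem_filter] at h1
    refine ⟨q', h1.1, by simpa using h1.2, h2.trans hqθ, ?_⟩
    simp [h2.trans hqθ]

lemma ncFind_spec (ζ η Fthr : ℝ) (P : ℕ → Vec d × Vec d) (n : ℕ) (y u : Vec d) :
    (∃ j < n, ζ * √(6 * η * Fthr) ≤ ‖(P j).1 - (P j).2‖ ∧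
      (∀ i < j, ‖(P i).1 - (P i).2‖ < ζ * √(6 * η * Fthr)) ∧
      ncFind ζ η Fthr ((List.range n).map P) y u = (P j).1) ∨
    ((∀ i < n, ‖(P i).1 - (P i).2‖ < ζ * √(6 * η * Fthr)) ∧
      ncFind ζ η Fthr ((List.range n).map P) y u = y - u) := by
  by_cases h : ∃ j < n, ζ * √(6 * η * Fthr) ≤ ‖(P j).1 - (P j).2‖
  · left
    classical
    have hs := Nat.find_spec h
    have hmin := fun i (hi : i < Nat.find h) => Nat.find_min h hi
    set j := Nat.find h
    have hlt : ∀ i < j, ‖(P i).1 - (P i).2‖ < ζ * √(6 * η * Fthr) := fun i hi => by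
      by_contra hc
      exact hmin i hi ⟨hi.trans hs.1, not_lt.1 hc⟩
    refine ⟨j, hs.1, hs.2, hlt, ?_⟩
    have : ((List.range n).map P).find? (fun q => decide (ζ * √(6 * η * Fthr) ≤ ‖q.1 - q.2‖))
        = some (P j) := by
      rw [List.find?_map, Option.map_eq_some_iff]
      refine ⟨j, ?_, rfl⟩
      rw [List.find?_range_eq_some]
      refine ⟨by simpa using hs.2, by simpa using hs.1, fun i hi => by simpa using hlt i hi⟩
    simp [ncFind, this]
  · right
    push Not at h
    refine ⟨h, ?_⟩
    have : ((List.range n).map P).find? (fun q => decide (ζ * √(6 * η * Fthr) ≤ ‖q.1 - q.2‖))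
        = none := by
      rw [List.find?_eq_none]
      simpa using h
    simp [ncFind, this]

/-- The stopping criterion of NEON⁺ at a pair `(y, u)`. -/
def Triggers (h : Vec d → ℝ) (G : Vec d → Vec d) (γ : ℝ) (q : Vec d × Vec d) : Prop :=
  h q.1 - h q.2 - inner ℝ (G q.2) (q.1 - q.2) < -(γ / 2) * ‖q.1 - q.2‖ ^ 2

/-- The accumulated lists are always prefixes of one trajectory, so the induction runs over the
current index `k`. A step costs two averaged queries and the final point one, and a triggered test
can only shorten the run. -/
lemma run_neonPlusLoop (p : ℝ × Vec d) (η γ Fthr U ζ : ℝ) (u₀ : Vec d) (n k : ℕ) :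
    let G : Vec d → Vec d := fun z => (avgAns o (x + z)).2 - p.2
    let h : Vec d → ℝ := fun z => gHat p z (avgAns o (x + z)).1
    let P : ℕ → Vec d × Vec d := fun j => (agdStep η ζ G)^[j] (u₀, u₀)
    let R := (neonPlusLoop x p η γ Fthr U ζ n (P k).1 (P k).2 ((List.range k).map P)
        ((List.range k).map fun j => ((P j).1, h (P j).1))).run o
    R.2 ≤ m * (2 * n + 1) ∧
    ((∃ τ, k ≤ τ ∧ τ < k + n ∧ (∀ j, k ≤ j → j < τ → ¬ Triggers h G γ (P j)) ∧
        Triggers h G γ (P τ) ∧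
        R.1 = ncFind ζ η Fthr ((List.range (τ + 1)).map P) (P τ).1 (P τ).2) ∨
      ((∀ j, k ≤ j → j < k + n → ¬ Triggers h G γ (P j)) ∧
        R.1 = selectMin U (2 * Fthr) ((List.range (k + n + 1)).map
          fun j => ((P j).1, h (P j).1)))) := by
  intro G h P
  induction n generalizing k with
  | zero =>
    intro R
    have hR : R = (selectMin U (2 * Fthr) ((List.range (k + 1)).map
          fun j => ((P j).1, h (P j).1)), m) := by
      simp [R, neonPlusLoop, run_andThen, run_avgQuery, run, List.range_succ, h, avgAns]
    refine ⟨by simp [hR], Or.inr ⟨fun j h1 h2 => by omega, by simp [hR]⟩⟩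
  | succ n ih =>
    intro R
    by_cases hT : Triggers h G γ (P k)
    · have hR : R = (ncFind ζ η Fthr ((List.range (k + 1)).map P) (P k).1 (P k).2, m + m) := by
        have hT' := hT
        simp only [Triggers, h, G, avgAns] at hT'
        simp only [R, neonPlusLoop, run_andThen, run_avgQuery]
        rw [if_pos hT']
        simp [run, List.range_succ]
      refine ⟨by rw [hR]; simp only; nlinarith, Or.inl ⟨k, le_rfl, by omega,
        fun j h1 h2 => by omega, hT, by rw [hR]⟩⟩
    · have hP : P (k + 1) = agdStep η ζ G (P k) := Function.iterate_succ_apply' _ _ _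
      obtain ⟨ih1, ih2⟩ := ih (k + 1)
      set R' := (neonPlusLoop x p η γ Fthr U ζ n (P (k + 1)).1 (P (k + 1)).2
        ((List.range (k + 1)).map P)
        ((List.range (k + 1)).map fun j => ((P j).1, h (P j).1))).run o with hR'
      have hR : R = (R'.1, m + (m + R'.2)) := by
        have hT' := hT
        simp only [Triggers, h, G, avgAns] at hT'
        simp only [R, neonPlusLoop, run_andThen, run_avgQuery]
        rw [if_neg hT', hR', hP]
        simp [agdStep, List.range_succ, h, G, avgAns]
      refine ⟨by rw [hR]; simp only; nlinarith, ?_⟩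
      rw [hR]
      rcases ih2 with ⟨τ, h1, h2, h3, h4, h5⟩ | ⟨h1, h2⟩
      · refine Or.inl ⟨τ, by omega, by omega, fun j hj hj' => ?_, h4, h5⟩
        rcases hj.eq_or_lt with rfl | hlt
        · exact hT
        · exact h3 j hlt hj'
      · refine Or.inr ⟨fun j hj hj' => ?_, ?_⟩
        · rcases hj.eq_or_lt with rfl | hlt
          · exact hT
          · exact h1 j hlt (by omega)
        · rw [show k + (n + 1) + 1 = k + 1 + n + 1 by ring]; exact h2

lemma run_neonPlus (η γ : ℝ) (t : ℕ) (Fthr U ζ : ℝ) (u₀ : Vec d) :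
    let G : Vec d → Vec d := fun z => (avgAns o (x + z)).2 - (avgAns o x).2
    let h : Vec d → ℝ := fun z => gHat (avgAns o x) z (avgAns o (x + z)).1
    let P : ℕ → Vec d × Vec d := fun j => (agdStep η ζ G)^[j] (u₀, u₀)
    let R := (neonPlus x η γ t Fthr U ζ u₀).run o
    R.2 ≤ m * (2 * t + 4) ∧
    ((∃ τ ≤ t, (∀ j < τ, ¬ Triggers h G γ (P j)) ∧ Triggers h G γ (P τ) ∧
        R.1 = ncFind ζ η Fthr ((List.range (τ + 1)).map P) (P τ).1 (P τ).2) ∨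
      ((∀ j ≤ t, ¬ Triggers h G γ (P j)) ∧
        R.1 = selectMin U (2 * Fthr) ((List.range (t + 2)).map
          fun j => ((P j).1, h (P j).1)))) := by
  intro G h P R
  obtain ⟨h1, h2⟩ := run_neonPlusLoop o x (avgAns o x) η γ Fthr U ζ u₀ (t + 1) 0
  set R' := (neonPlusLoop x (avgAns o x) η γ Fthr U ζ (t + 1) u₀ u₀ [] []).run o with hR'
  have hR : R = (R'.1, m + R'.2) := by
    simp only [R, neonPlus, run_andThen, run_avgQuery]
    rfl
  rw [hR]
  change R'.2 ≤ _ at h1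
  refine ⟨by simp only; nlinarith, ?_⟩
  rcases h2 with ⟨τ, h1, h2, h3, h4, h5⟩ | ⟨h1, h2⟩
  · exact Or.inl ⟨τ, by omega, fun j hj => h3 j (by omega) hj, h4, h5⟩
  · refine Or.inr ⟨fun j hj => h1 j (by omega) (by omega), ?_⟩
    rw [show 0 + (t + 1) + 1 = t + 2 by ring] at h2
    exact h2

end programs

/-! ### Gradient descent: growth and confinement -/

/-- Telescoping and Cauchy–Schwarz; the sum of squared steps is what the energy estimates control.
-/
lemma norm_sub_sq_le_sum {E : Type*} [NormedAddCommGroup E] (u : ℕ → E) (n : ℕ) :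
    ‖u n - u 0‖ ^ 2 ≤ n * ∑ j ∈ Finset.range n, ‖u (j + 1) - u j‖ ^ 2 := by
  have h1 : ‖u n - u 0‖ ≤ ∑ j ∈ Finset.range n, ‖u (j + 1) - u j‖ := by
    rw [← Finset.sum_range_sub]; exact norm_sum_le _ _
  have h2 := sq_sum_le_card_mul_sum_sq (s := Finset.range n) (f := fun j => ‖u (j + 1) - u j‖)
  rw [Finset.card_range] at h2
  exact (pow_le_pow_left₀ (norm_nonneg _) h1 2).trans h2

section linear

variable {E : Type*} [NormedAddCommGroup E] [InnerProductSpace ℝ E]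

/-- An operator that is diagonal in an orthonormal basis is bounded by its diagonal entries. -/
lemma norm_apply_le_of_diagonal {ι : Type*} [Fintype ι] (b : OrthonormalBasis ι ℝ E)
    (T : E →L[ℝ] E) (c : ι → ℝ) (hT : ∀ i, T (b i) = c i • b i) {C : ℝ} (hC : 0 ≤ C)
    (hc : ∀ i, |c i| ≤ C) (x : E) : ‖T x‖ ≤ C * ‖x‖ := by
  have hrep : T x = ∑ i, (c i * inner ℝ (b i) x) • b i := by
    conv_lhs => rw [← b.sum_repr' x]
    rw [map_sum]
    exact Finset.sum_congr rfl fun i _ => by rw [map_smul, hT, smul_smul, mul_comm]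
  have hcoef : ∀ i, inner ℝ (b i) (T x) = c i * inner ℝ (b i) x := fun i => by
    classical
    rw [hrep, inner_sum, Finset.sum_eq_single i]
    · simp [inner_smul_right]
    · intro j _ hj
      simp [inner_smul_right, b.inner_eq_ite, hj.symm]
    · simp
  refine le_of_sq_le_sq ?_ (by positivity)
  rw [← b.sum_sq_inner_right (T x), mul_pow, ← b.sum_sq_inner_right x, Finset.mul_sum]
  refine Finset.sum_le_sum fun i _ => ?_
  rw [hcoef, mul_pow]
  exact mul_le_mul_of_nonneg_right (sq_le_sq' (abs_le.1 (hc i)).1 (abs_le.1 (hc i)).2)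
    (sq_nonneg _)

/-- Growth of the dominant component of a perturbed power iteration. -/
lemma power_growth (B : E →L[ℝ] E) (e : E) {μ β : ℝ} {V : ℕ → E} {N : ℕ}
    (hsymm : ∀ v w, inner ℝ (B v) w = inner ℝ v (B w)) (hB : ∀ x, ‖B x‖ ≤ μ * ‖x‖)
    (he : ‖e‖ = 1) (hBe : B e = μ • e) (hμ : 1 ≤ μ) (hβ : 0 ≤ β)
    (hV : ∀ k < N, ‖V (k + 1) - B (V k)‖ ≤ β * ‖V k‖) (hN : N * β ≤ 1 / 16)
    (h0 : ‖V 0‖ ≤ 2 * inner ℝ e (V 0)) :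
    μ ^ N * (inner ℝ e (V 0) / 2) ≤ inner ℝ e (V N) := by
  have h1 : ∀ n ≤ N, ‖V n‖ ≤ (μ * (1 + β)) ^ n * ‖V 0‖ := by
    intro n
    induction n with
    | zero => simp
    | succ n ih =>
      intro hn
      have ih := ih (by omega)
      calc ‖V (n + 1)‖ = ‖(V (n + 1) - B (V n)) + B (V n)‖ := by congr 1; abel
        _ ≤ β * ‖V n‖ + μ * ‖V n‖ := (norm_add_le _ _).trans (add_le_add (hV n (by omega)) (hB _))
        _ ≤ (μ * (1 + β)) * ‖V n‖ := by
          nlinarith [mul_nonneg (mul_nonneg (sub_nonneg.2 hμ) hβ) (norm_nonneg (V n))]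
        _ ≤ (μ * (1 + β)) * ((μ * (1 + β)) ^ n * ‖V 0‖) :=
          mul_le_mul_of_nonneg_left ih (by positivity)
        _ = _ := by ring
  -- Since `N * β ≤ 1 / 16`, the accumulated factor `(1 + β) ^ n` is at most `exp (1 / 16) ≤ 2`.
  have h2 : ∀ n ≤ N, ‖V n‖ ≤ 2 * μ ^ n * ‖V 0‖ := by
    intro n hn
    have hb : (1 + β) ^ n ≤ 2 := by
      have : (1 + β) ^ n ≤ Real.exp (1 / 16) := by
        calc (1 + β) ^ n ≤ Real.exp β ^ n :=
              pow_le_pow_left₀ (by positivity) (by linarith [Real.add_one_le_exp β]) n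
          _ = Real.exp (n * β) := (Real.exp_nat_mul _ _).symm
          _ ≤ _ := Real.exp_le_exp.2 ((mul_le_mul_of_nonneg_right (by exact_mod_cast hn) hβ).trans hN)
      have h3 : Real.exp (1 / 16) ≤ 2 := by
        rw [← Real.le_log_iff_exp_le (by norm_num)]
        linarith [Real.log_two_gt_d9]
      linarith
    calc _ ≤ _ := h1 n hn
      _ = (1 + β) ^ n * (μ ^ n * ‖V 0‖) := by rw [mul_pow]; ring
      _ ≤ 2 * (μ ^ n * ‖V 0‖) := mul_le_mul_of_nonneg_right hb (by positivity)
      _ = _ := by ring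
  -- Each step loses at most `2β‖V 0‖` relative to `μ ^ n`. After `N` steps the loss is at most `‖V
  -- 0‖ / 8`, a quarter of the initial component along `e`.
  have h3 : ∀ n ≤ N, μ ^ n * (inner ℝ e (V 0) - 2 * n * β * ‖V 0‖) ≤ inner ℝ e (V n) := by
    intro n
    induction n with
    | zero => simp
    | succ n ih =>
      intro hn
      have ih := ih (by omega)
      have e1 : inner ℝ e (V (n + 1)) = inner ℝ e (V (n + 1) - B (V n)) + μ * inner ℝ e (V n) := by
        rw [inner_sub_right, ← hsymm, hBe, inner_smul_left]; simp
      have e2 : -(β * (2 * μ ^ n * ‖V 0‖)) ≤ inner ℝ e (V (n + 1) - B (V n)) := by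
        have := abs_real_inner_le_norm e (V (n + 1) - B (V n))
        rw [he, one_mul] at this
        have h4 := (hV n (by omega)).trans (mul_le_mul_of_nonneg_left (h2 n (by omega)) hβ)
        linarith [(abs_le.1 (this.trans h4)).1]
      have e3 : μ ^ n * (2 * β * ‖V 0‖) ≤ μ ^ (n + 1) * (2 * β * ‖V 0‖) :=
        mul_le_mul_of_nonneg_right (pow_le_pow_right₀ hμ (by omega)) (by positivity)
      rw [e1]
      push_cast
      have e4 := mul_le_mul_of_nonneg_left ih (by linarith : (0 : ℝ) ≤ μ)
      rw [pow_succ] at e3 ⊢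
      nlinarith
  refine le_trans (mul_le_mul_of_nonneg_left ?_ (by positivity)) (h3 N le_rfl)
  have h0' : 0 ≤ ‖V 0‖ := norm_nonneg _
  nlinarith [mul_le_mul_of_nonneg_right hN h0']

end linear

section gd

variable {d : ℕ} {L₁ L₂ η : ℝ} {h : Vec d → ℝ} {G : Vec d → Vec d} {H : Vec d →L[ℝ] Vec d}

lemma LocalModel.abs_eigenvalue_le (M : LocalModel L₁ L₂ h G H)
    {b : OrthonormalBasis (Fin d) ℝ (Vec d)} {lam : Fin d → ℝ}
    (hb : ∀ i, H (b i) = lam i • b i) (i : Fin d) : |lam i| ≤ L₁ := by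
  have := (H.le_opNorm (b i)).trans (mul_le_mul_of_nonneg_right M.norm_le (norm_nonneg _))
  rw [hb, norm_smul] at this
  simpa using this

/-- The linear part of a gradient step. -/
def gdLin (η : ℝ) (H : Vec d →L[ℝ] Vec d) : Vec d →L[ℝ] Vec d :=
  ContinuousLinearMap.id ℝ (Vec d) - η • H

lemma gdLin_apply (v : Vec d) : gdLin η H v = v - η • H v := by simp [gdLin]

lemma gdLin_eigen {b : OrthonormalBasis (Fin d) ℝ (Vec d)} {lam : Fin d → ℝ}
    (hb : ∀ i, H (b i) = lam i • b i) (i : Fin d) :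
    gdLin η H (b i) = (1 - η * lam i) • b i := by
  rw [gdLin_apply, hb, sub_smul, one_smul, smul_smul]

lemma LocalModel.gdLin_symm (M : LocalModel L₁ L₂ h G H) (v w : Vec d) :
    inner ℝ (gdLin η H v) w = inner ℝ v (gdLin η H w) := by
  simp only [gdLin_apply, inner_sub_left, inner_sub_right, inner_smul_left, inner_smul_right,
    M.symm]
  simp

/-- The difference of two trajectories is a power iteration with `I - ηH`, perturbed by the
variation of the Hessian over the ball. Its norm cannot exceed `2R` as long as both trajectories
stay there. -/
lemma LocalModel.gd_separation (M : LocalModel L₁ L₂ h G H)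
    {b : OrthonormalBasis (Fin d) ℝ (Vec d)} {lam : Fin d → ℝ} {i₀ : Fin d}
    (hb : ∀ i, H (b i) = lam i • b i) (hmin : ∀ i, lam i₀ ≤ lam i) (hneg : lam i₀ ≤ 0)
    (hη : 0 ≤ η) (hηL : η * L₁ ≤ 1 / 4) (hL₂ : 0 ≤ L₂) {N : ℕ} {R : ℝ} {u w : Vec d}
    (hN : N * (η * (L₂ * R)) ≤ 1 / 16)
    (hu : ∀ k ≤ N, ‖(gdStep η G)^[k] u‖ ≤ R) (hw : ∀ k ≤ N, ‖(gdStep η G)^[k] w‖ ≤ R)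
    (h0 : ‖w - u‖ ≤ 2 * inner ℝ (b i₀) (w - u)) :
    (1 + η * (-lam i₀)) ^ N * (inner ℝ (b i₀) (w - u) / 2) ≤ 2 * R := by
  have hR : 0 ≤ R := (norm_nonneg _).trans (hu 0 (by omega))
  have key := power_growth (gdLin η H) (b i₀) (μ := 1 + η * (-lam i₀)) (β := η * (L₂ * R))
    (V := fun k => (gdStep η G)^[k] w - (gdStep η G)^[k] u) (N := N) M.gdLin_symm ?_ (by simp) ?_
    ?_ (by positivity) ?_ hN h0
  · refine key.trans ((real_inner_le_norm _ _).trans ?_)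
    rw [OrthonormalBasis.norm_eq_one, one_mul]
    exact (norm_sub_le _ _).trans (by linarith [hu N le_rfl, hw N le_rfl])
  -- As `η L₁ ≤ 1 / 4`, all factors `1 - η λᵢ` are nonnegative, and the largest belongs to the
  -- lowest eigenvalue.
  · refine norm_apply_le_of_diagonal b _ _ (gdLin_eigen hb) (by nlinarith) fun i => ?_
    have h1 := abs_le.1 (M.abs_eigenvalue_le hb i)
    have h2 := hmin i
    rw [abs_le]
    constructor <;> nlinarith
  · rw [gdLin_eigen hb]; congr 1; ring
  · nlinarith
  · intro k hk
    have h2 := M.lip₂ (hu k hk.le) (hw k hk.le)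
    rw [Function.iterate_succ_apply', Function.iterate_succ_apply', gdLin_apply]
    set a := (gdStep η G)^[k] w
    set c := (gdStep η G)^[k] u
    have e : gdStep η G a - gdStep η G c - (a - c - η • H (a - c))
        = -(η • (G a - G c - H (a - c))) := by
      simp only [gdStep, smul_sub]; abel
    rw [e, norm_neg, norm_smul, Real.norm_of_nonneg hη, mul_assoc]
    exact mul_le_mul_of_nonneg_left h2 hη

/-- The Taylor error `L₁ η² ‖G u‖²` uses up at most a quarter of the decrease `η ‖G u‖²`. -/
lemma LocalModel.gd_descent (M : LocalModel L₁ L₂ h G H) (hη : 0 ≤ η) (hηL : η * L₁ ≤ 1 / 4)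
    (u : Vec d) : ‖gdStep η G u - u‖ ^ 2 ≤ 2 * η * (h u - h (gdStep η G u)) := by
  have h1 := (abs_le.1 (M.taylor u (gdStep η G u))).2
  have e : gdStep η G u - u = -(η • G u) := by simp [gdStep]
  rw [e, inner_neg_right, inner_smul_right, real_inner_self_eq_norm_sq, norm_neg, norm_smul,
    mul_pow, Real.norm_of_nonneg hη] at h1
  rw [e, norm_neg, norm_smul, mul_pow, Real.norm_of_nonneg hη]
  have h2 : 0 ≤ η * ‖G u‖ ^ 2 := by positivity
  have h3 := mul_le_mul_of_nonneg_right hηL h2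
  nlinarith

lemma LocalModel.norm_G_le (M : LocalModel L₁ L₂ h G H) (u : Vec d) : ‖G u‖ ≤ L₁ * ‖u‖ := by
  simpa [M.G_zero] using M.lip 0 u

lemma LocalModel.h_le (M : LocalModel L₁ L₂ h G H) (u : Vec d) : h u ≤ L₁ * ‖u‖ ^ 2 := by
  have := (abs_le.1 (M.taylor 0 u)).2
  simpa [M.G_zero, M.h_zero] using this

/-- Gradient descent that finds no point of low value in the ball of radius `U` stays there. -/
lemma LocalModel.gd_trapped (M : LocalModel L₁ L₂ h G H) (hη : 0 ≤ η) (hηL : η * L₁ ≤ 1 / 4)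
    {U θ : ℝ} {N : ℕ} {u : Vec d} (hu : ‖u‖ ≤ U / 8)
    (hstuck : ∀ k ≤ N, ¬ (‖(gdStep η G)^[k] u‖ ≤ U ∧ h ((gdStep η G)^[k] u) ≤ -θ))
    (hθ : 0 ≤ θ) (hL₁ : 0 ≤ L₁) (hN : 2 * η * N * (L₁ * ‖u‖ ^ 2 + θ) ≤ (U / 8) ^ 2) :
    ∀ k ≤ N, ‖(gdStep η G)^[k] u‖ ≤ U := by
  have hU : 0 ≤ U := by linarith [norm_nonneg u]
  intro k
  induction k with
  | zero => intro _; simp only [Function.iterate_zero, id_eq]; linarith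
  | succ k ih =>
    intro hk
    have ih := ih (by omega)
    -- Absence of low values is known only inside the ball. The sharper bound `U / 4` is therefore
    -- derived at step `k`, and one gradient step, of factor at most `5 / 4`, leads to step `k + 1`.
    have hval : -θ < h ((gdStep η G)^[k] u) := by
      by_contra hc
      exact hstuck k (by omega) ⟨ih, not_lt.1 hc⟩
    have h1 := norm_sub_sq_le_sum (fun j => (gdStep η G)^[j] u) k
    have h2 : ∑ j ∈ Finset.range k, ‖(gdStep η G)^[j + 1] u - (gdStep η G)^[j] u‖ ^ 2
        ≤ 2 * η * (L₁ * ‖u‖ ^ 2 + θ) := by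
      calc _ ≤ ∑ j ∈ Finset.range k, (2 * η * (h ((gdStep η G)^[j] u)
              - h ((gdStep η G)^[j + 1] u))) := by
            refine Finset.sum_le_sum fun j _ => ?_
            rw [Function.iterate_succ_apply']
            exact M.gd_descent hη hηL _
        _ = 2 * η * (h u - h ((gdStep η G)^[k] u)) := by
            rw [← Finset.mul_sum, Finset.sum_range_sub']; simp
        _ ≤ _ := mul_le_mul_of_nonneg_left (by linarith [M.h_le u]) (by positivity)
    have h3 : ‖(gdStep η G)^[k] u - u‖ ≤ U / 8 := by
      refine le_of_sq_le_sq ?_ (by positivity)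
      simp only [Function.iterate_zero, id_eq] at h1
      have hkN : (k : ℝ) ≤ N := by exact_mod_cast (by omega : k ≤ N)
      calc _ ≤ _ := h1
        _ ≤ k * (2 * η * (L₁ * ‖u‖ ^ 2 + θ)) := mul_le_mul_of_nonneg_left h2 (by positivity)
        _ ≤ N * (2 * η * (L₁ * ‖u‖ ^ 2 + θ)) :=
            mul_le_mul_of_nonneg_right hkN (by positivity)
        _ ≤ _ := by linarith
    have h4 : ‖(gdStep η G)^[k] u‖ ≤ U / 4 := by
      calc _ = ‖((gdStep η G)^[k] u - u) + u‖ := by simp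
        _ ≤ _ := (norm_add_le _ _).trans (by linarith)
    rw [Function.iterate_succ_apply']
    set a := (gdStep η G)^[k] u
    calc ‖gdStep η G a‖ ≤ ‖a‖ + ‖η • G a‖ := norm_sub_le _ _
      _ ≤ ‖a‖ + η * (L₁ * ‖a‖) := by
        rw [norm_smul, Real.norm_of_nonneg hη]
        linarith [mul_le_mul_of_nonneg_left (M.norm_G_le a) hη]
      _ ≤ U := by nlinarith [norm_nonneg a]

/-- A point of low value near the origin is a direction of negative curvature. -/
lemma LocalModel.inner_hessian_le (M : LocalModel L₁ L₂ h G H) {u : Vec d} {κ : ℝ}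
    (hu : h u ≤ -κ * ‖u‖ ^ 2) :
    inner ℝ u (H u) ≤ (-(2 * κ) + 4 * (L₂ * ‖u‖)) * ‖u‖ ^ 2 := by
  have := (abs_le.1 (M.taylor₂ (u := 0) (v := u) (R := ‖u‖) (by simp) le_rfl)).1
  simp only [M.h_zero, M.G_zero, sub_zero, inner_zero_left] at this
  linarith

end gd

/-! ### The momentum recursion in one eigendirection -/

/-- Solution of `c (n + 2) = B ((1 + ζ) c (n + 1) - ζ c n)`. -/
def momSeq {R : Type*} [Ring R] [Module ℝ R] (ζ : ℝ) (B c₀ c₁ : R) : ℕ → R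
  | 0 => c₀
  | 1 => c₁
  | n + 2 => B * ((1 + ζ) • momSeq ζ B c₀ c₁ (n + 1) - ζ • momSeq ζ B c₀ c₁ n)

section scalar

variable {ζ q : ℝ}

/-- In directions of nonnegative curvature (`q ≤ 1`) momentum dissipates this quadratic energy. -/
lemma momSeq_energy (hζ : 0 ≤ ζ) (hζ1 : ζ ≤ 1) (hq : 0 ≤ q) (hq1 : q ≤ 1) (c₀ c₁ : ℝ) (n : ℕ) :
    (1 - q) * momSeq ζ q c₀ c₁ (n + 1) ^ 2
      + (momSeq ζ q c₀ c₁ (n + 1) - momSeq ζ q c₀ c₁ n) ^ 2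
      ≤ (1 - q) * c₁ ^ 2 + (c₁ - c₀) ^ 2 := by
  induction n with
  | zero => simp [momSeq]
  | succ n ih =>
    refine le_trans ?_ ih
    simp only [momSeq, smul_eq_mul]
    set a := momSeq ζ q c₀ c₁ (n + 1)
    set a' := momSeq ζ q c₀ c₁ n
    have h1 : 0 ≤ (1 - q) * (1 - q) * q * ((1 + ζ) * a - ζ * a') ^ 2 := by
      have : 0 ≤ 1 - q := by linarith
      positivity
    have h2 : 0 ≤ ζ ^ 2 * (1 - q) * (a - a') ^ 2 := by
      have : 0 ≤ 1 - q := by linarith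
      positivity
    have h3 : 0 ≤ (1 - ζ ^ 2) * (a - a') ^ 2 := by
      have : 0 ≤ 1 - ζ ^ 2 := by nlinarith
      positivity
    nlinarith

lemma abs_momSeq_one_one_le_of_le_one (hζ : 0 ≤ ζ) (hζ1 : ζ ≤ 1) (hq : 0 ≤ q) (hq1 : q ≤ 1)
    (n : ℕ) : |momSeq ζ q 1 1 n| ≤ 1 := by
  -- At `q = 1` the energy no longer sees the position, but it starts at zero, so the sequence is
  -- constant.
  rcases hq1.eq_or_lt with rfl | hlt
  · have : momSeq ζ (1 : ℝ) 1 1 n = 1 := by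
      induction n with
      | zero => rfl
      | succ n ih =>
        have := momSeq_energy hζ hζ1 zero_le_one le_rfl 1 1 n
        rw [ih] at this
        nlinarith [sq_nonneg (momSeq ζ (1 : ℝ) 1 1 (n + 1) - 1)]
    rw [this, abs_one]
  · cases n with
    | zero => simp [momSeq]
    | succ n =>
      have := momSeq_energy hζ hζ1 hq hq1 1 1 n
      rw [← sq_le_one_iff_abs_le_one]
      have h1 : 0 < 1 - q := by linarith
      have h2 := sq_nonneg (momSeq ζ q 1 1 (n + 1) - momSeq ζ q 1 1 n)
      by_contra hc
      push Not at hc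
      nlinarith [mul_lt_mul_of_pos_left hc h1]

/-- The initial energy is at most `2`, so the increments stay bounded and the growth is linear. -/
lemma abs_momSeq_zero_one_le_of_le_one (hζ : 0 ≤ ζ) (hζ1 : ζ ≤ 1) (hq : 0 ≤ q) (hq1 : q ≤ 1)
    (n : ℕ) : |momSeq ζ q 0 1 n| ≤ 2 * n := by
  induction n with
  | zero => simp [momSeq]
  | succ n ih =>
    have := momSeq_energy hζ hζ1 hq hq1 0 1 n
    have h1 : |momSeq ζ q 0 1 (n + 1) - momSeq ζ q 0 1 n| ≤ 2 := by
      rw [← Real.sqrt_sq_eq_abs, Real.sqrt_le_left (by norm_num)]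
      have h2 : 0 ≤ (1 - q) * momSeq ζ q 0 1 (n + 1) ^ 2 :=
        mul_nonneg (by linarith) (sq_nonneg _)
      linarith
    push_cast
    calc _ = |(momSeq ζ q 0 1 (n + 1) - momSeq ζ q 0 1 n) + momSeq ζ q 0 1 n| := by
          congr 1; ring
      _ ≤ _ := (abs_add_le _ _).trans (by linarith)

variable {q₀ μ ν : ℝ}

/-- The ratio of consecutive terms stays in `[1, μ]`: the recursion with `q` is dominated by that
with `q₀`, whose characteristic roots are `μ` and `ν`, and the bound `μ` on the ratio reproduces
itself. -/
lemma momSeq_one_one_le (hζ : 0 ≤ ζ) (hq : 1 ≤ q) (hqq : q ≤ q₀) (hμ : 1 ≤ μ)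
    (hsum : μ + ν = q₀ * (1 + ζ)) (hprod : μ * ν = q₀ * ζ) (n : ℕ) :
    0 < momSeq ζ q 1 1 n ∧ momSeq ζ q 1 1 n ≤ momSeq ζ q 1 1 (n + 1) ∧
      momSeq ζ q 1 1 (n + 1) ≤ μ * momSeq ζ q 1 1 n := by
  induction n with
  | zero => simpa [momSeq] using hμ
  | succ n ih =>
    obtain ⟨h1, h2, h3⟩ := ih
    simp only [momSeq, smul_eq_mul]
    set a := momSeq ζ q 1 1 (n + 1)
    set a' := momSeq ζ q 1 1 n
    have h4 : a ≤ (1 + ζ) * a - ζ * a' := by nlinarith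
    have ha : 0 < a := h1.trans_le h2
    refine ⟨ha, by nlinarith, ?_⟩
    have h5 : q * ((1 + ζ) * a - ζ * a') ≤ q₀ * ((1 + ζ) * a - ζ * a') :=
      mul_le_mul_of_nonneg_right hqq (by linarith)
    have h6 : q₀ * ((1 + ζ) * a - ζ * a') = (μ + ν) * a - μ * ν * a' := by
      rw [hsum, hprod]; ring
    have hν : 0 ≤ ν := by
      by_contra hc
      have : 0 ≤ μ * ν := by rw [hprod]; exact mul_nonneg (by linarith) hζ
      nlinarith
    nlinarith [mul_le_mul_of_nonneg_left h3 hν]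

/-- Removing the root `ν` leaves a first-order inequality with factor `μ`; a second summation gives
the bound with `μ - ν`. -/
lemma momSeq_zero_one_le (hζ : 0 ≤ ζ) (hq : 1 ≤ q) (hqq : q ≤ q₀) (hμ : 1 ≤ μ) (hν : 0 ≤ ν)
    (hνμ : ν < μ) (hsum : μ + ν = q₀ * (1 + ζ)) (hprod : μ * ν = q₀ * ζ) (n : ℕ) :
    0 ≤ momSeq ζ q 0 1 n ∧ momSeq ζ q 0 1 n ≤ momSeq ζ q 0 1 (n + 1) ∧
      momSeq ζ q 0 1 (n + 1) - ν * momSeq ζ q 0 1 n ≤ μ ^ n ∧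
      (μ - ν) * momSeq ζ q 0 1 n ≤ μ ^ n := by
  induction n with
  | zero => simp [momSeq]
  | succ n ih =>
    obtain ⟨h1, h2, h3, h7⟩ := ih
    simp only [momSeq, smul_eq_mul]
    set a := momSeq ζ q 0 1 (n + 1)
    set a' := momSeq ζ q 0 1 n
    have h4 : a ≤ (1 + ζ) * a - ζ * a' := by nlinarith
    have ha : 0 ≤ a := h1.trans h2
    have h5 : q * ((1 + ζ) * a - ζ * a') ≤ q₀ * ((1 + ζ) * a - ζ * a') :=
      mul_le_mul_of_nonneg_right hqq (by linarith)
    have h6 : q₀ * ((1 + ζ) * a - ζ * a') = (μ + ν) * a - μ * ν * a' := by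
      rw [hsum, hprod]; ring
    refine ⟨ha, by nlinarith, ?_, ?_⟩
    · rw [pow_succ]
      nlinarith [mul_le_mul_of_nonneg_left h3 (by linarith : 0 ≤ μ)]
    · rw [pow_succ]
      nlinarith [mul_le_mul_of_nonneg_left h3 (by linarith : 0 ≤ μ - ν),
        mul_le_mul_of_nonneg_left h7 hν]

lemma abs_momSeq_one_one_le (hζ : 0 ≤ ζ) (hζ1 : ζ ≤ 1) (hq : 0 ≤ q) (hqq : q ≤ q₀) (hμ : 1 ≤ μ)
    (hsum : μ + ν = q₀ * (1 + ζ)) (hprod : μ * ν = q₀ * ζ) (n : ℕ) :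
    |momSeq ζ q 1 1 n| ≤ μ ^ n := by
  rcases le_total q 1 with h | h
  · exact (abs_momSeq_one_one_le_of_le_one hζ hζ1 hq h n).trans (one_le_pow₀ hμ)
  · rw [abs_of_pos (momSeq_one_one_le hζ h hqq hμ hsum hprod n).1]
    induction n with
    | zero => simp [momSeq]
    | succ n ih =>
      rw [pow_succ']
      exact (momSeq_one_one_le hζ h hqq hμ hsum hprod n).2.2.trans
        (mul_le_mul_of_nonneg_left ih (by linarith))

/-- For `q ≤ 1`, Bernoulli's inequality turns the linear bound into an exponential one. For `q ≥ 1`,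
`μ - ν ≥ μ - 1`. -/
lemma abs_momSeq_zero_one_le (hζ : 0 ≤ ζ) (hζ1 : ζ ≤ 1) (hq : 0 ≤ q) (hqq : q ≤ q₀) (hμ : 1 < μ)
    (hν : 0 ≤ ν) (hν1 : ν ≤ 1)
    (hsum : μ + ν = q₀ * (1 + ζ)) (hprod : μ * ν = q₀ * ζ) (n : ℕ) :
    |momSeq ζ q 0 1 n| ≤ 2 / (μ - 1) * μ ^ n := by
  have hx : 0 < μ - 1 := by linarith
  have hb : 1 + n * (μ - 1) ≤ μ ^ n := by
    have := one_add_mul_le_pow (by linarith : (-2 : ℝ) ≤ μ - 1) n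
    simpa using this
  rw [div_mul_eq_mul_div, le_div_iff₀ hx]
  rcases le_total q 1 with h | h
  · have := abs_momSeq_zero_one_le_of_le_one hζ hζ1 hq h n
    nlinarith
  · obtain ⟨h1, -, -, h4⟩ :=
      momSeq_zero_one_le hζ h hqq hμ.le hν (by linarith) hsum hprod n
    rw [abs_of_nonneg h1]
    nlinarith [pow_pos (by linarith : 0 < μ) n]

/-- The characteristic roots of the momentum recursion in a direction of negative curvature. -/
lemma exists_momentum_roots {θ σ : ℝ} (hθ : 0 < θ) (hθ1 : θ ≤ 1) (hσ : 0 < σ) (hσ1 : σ ≤ 1 / 16)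
    (hθσ : θ ^ 2 ≤ 5 / 4 * σ) :
    ∃ μ ν : ℝ, μ + ν = (1 + σ) * (1 + (1 - θ)) ∧ μ * ν = (1 + σ) * (1 - θ) ∧
      √σ / 2 ≤ μ - 1 ∧ √σ / 2 ≤ 1 - ν ∧ 0 ≤ ν ∧ μ - ν ≤ 8 * (1 - ν) := by
  set s := √σ with hs
  have hs2 : s ^ 2 = σ := Real.sq_sqrt hσ.le
  have hs0 : 0 < s := Real.sqrt_pos.2 hσ
  have hs1 : s ≤ 1 / 4 := by nlinarith
  set b := θ - (2 - θ) * σ with hb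
  have hθs : θ ≤ 9 / 8 * s := by nlinarith
  have hb1 : b ≤ 9 / 8 * s := by nlinarith
  have hb2 : -s ≤ b := by nlinarith
  set D := √(b ^ 2 + 4 * σ) with hD
  have hD2 : D ^ 2 = b ^ 2 + 4 * σ := Real.sq_sqrt (by positivity)
  have hD0 : 0 ≤ D := Real.sqrt_nonneg _
  have hD3 : b + s ≤ D := Real.le_sqrt_of_sq_le (by nlinarith)
  have hD4 : s - b ≤ D := Real.le_sqrt_of_sq_le (by nlinarith)
  have hD5 : D ≤ 3 * s := by
    rw [hD, Real.sqrt_le_left (by positivity)]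
    nlinarith
  -- The characteristic polynomial takes the value `-σ` at `1`, so `(μ - 1)(1 - ν) = σ`. The
  -- hypothesis on `θ` makes `b` of order `√σ`, hence both factors comparable to `√σ`.
  refine ⟨1 + (D - b) / 2, 1 - (D + b) / 2, ?_, ?_, ?_, ?_, ?_, ?_⟩
  · rw [hb]; ring
  · have : (1 + (D - b) / 2) * (1 - (D + b) / 2) = 1 - b - (D ^ 2 - b ^ 2) / 4 := by ring
    rw [this, hD2, hb]; ring
  all_goals linarith

end scalar

/-! ### The perturbed momentum recursion for operators -/

section vector

variable {E : Type*} [NormedAddCommGroup E] [InnerProductSpace ℝ E]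

/-- Operator and scalar sequences share one definition, so the scalar bounds become operator bounds
in an eigenbasis. -/
lemma momSeq_apply_eigen {ζ q : ℝ} {B : E →L[ℝ] E} {v : E} (hv : B v = q • v) {c₀ c₁ : ℝ}
    (n : ℕ) : momSeq ζ B (c₀ • (1 : E →L[ℝ] E)) (c₁ • 1) n v = momSeq ζ q c₀ c₁ n • v := by
  suffices h : momSeq ζ B (c₀ • (1 : E →L[ℝ] E)) (c₁ • 1) n v = momSeq ζ q c₀ c₁ n • v ∧
      momSeq ζ B (c₀ • (1 : E →L[ℝ] E)) (c₁ • 1) (n + 1) v = momSeq ζ q c₀ c₁ (n + 1) • v from h.1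
  induction n with
  | zero => simp [momSeq]
  | succ n ih =>
    refine ⟨ih.2, ?_⟩
    simp only [momSeq, mul_apply_eq_comp, sub_apply, smul_apply, ih.1, ih.2,
      map_smul, hv, smul_eq_mul, smul_smul, ← sub_smul]
    congr 1; ring

/-- Variation of constants for the momentum recursion. -/
lemma momentum_duhamel (B : E →L[ℝ] E) (ζ : ℝ) (V f : ℕ → E) (h01 : V 1 = V 0)
    (hV : ∀ k, V (k + 2) = B ((1 + ζ) • V (k + 1) - ζ • V k) + f k) (n : ℕ) :
    V n = momSeq ζ B ((1 : ℝ) • (1 : E →L[ℝ] E)) ((1 : ℝ) • 1) n (V 0)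
      + ∑ k ∈ Finset.range n, momSeq ζ B ((0 : ℝ) • (1 : E →L[ℝ] E)) ((1 : ℝ) • 1) (n - 1 - k)
        (f k) := by
  set A := momSeq ζ B ((1 : ℝ) • (1 : E →L[ℝ] E)) ((1 : ℝ) • 1) with hA
  set K := momSeq ζ B ((0 : ℝ) • (1 : E →L[ℝ] E)) ((1 : ℝ) • 1) with hK
  have hK0 : K 0 = 0 := by simp [hK, momSeq]
  have hK1 : K 1 = 1 := by simp [hK, momSeq]
  have hrecA : ∀ n, A (n + 2) = B * ((1 + ζ) • A (n + 1) - ζ • A n) := fun n => rfl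
  have hrecK : ∀ n, K (n + 2) = B * ((1 + ζ) • K (n + 1) - ζ • K n) := fun n => rfl
  -- The recursion has order two, so two consecutive indices are carried. The disturbance `f k`
  -- first enters at index `k + 2`, where its kernel is `K 1 = 1`.
  suffices h : V n = A n (V 0) + ∑ k ∈ Finset.range n, K (n - 1 - k) (f k) ∧
      V (n + 1) = A (n + 1) (V 0) + ∑ k ∈ Finset.range (n + 1), K (n - k) (f k) from h.1
  induction n with
  | zero => simp [hA, hK0, momSeq, h01]
  | succ n ih =>
    obtain ⟨ih1, ih2⟩ := ih
    refine ⟨by simpa using ih2, ?_⟩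
    rw [Finset.sum_range_succ, Nat.sub_self, hK0] at ih2
    rw [hV, ih1, ih2, hrecA, Finset.sum_range_succ, Finset.sum_range_succ, Nat.sub_self, hK0,
      Nat.add_sub_cancel_left, hK1]
    have e : ∑ k ∈ Finset.range n, K (n + 1 - k) (f k)
        = B ((1 + ζ) • ∑ k ∈ Finset.range n, K (n - k) (f k)
          - ζ • ∑ k ∈ Finset.range n, K (n - 1 - k) (f k)) := by
      rw [Finset.smul_sum, Finset.smul_sum, ← Finset.sum_sub_distrib, map_sum]
      refine Finset.sum_congr rfl fun k hk => ?_
      have hk := Finset.mem_range.1 hk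
      rw [show n + 1 - k = (n - 1 - k) + 2 by omega, hrecK, show n - 1 - k + 1 = n - k by omega]
      simp
    rw [e]
    simp only [mul_apply_eq_comp, sub_apply, smul_apply, map_sub, map_smul, map_add,
      smul_add, zero_apply, add_zero, one_apply_eq_self]
    abel

/-- Growth of the dominant component of a perturbed momentum iteration. -/
lemma momentum_growth {ι : Type*} [Fintype ι] (b : OrthonormalBasis ι ℝ E) (B : E →L[ℝ] E)
    (q : ι → ℝ) (i₀ : ι) {q₀ ζ μ ν β : ℝ} {V : ℕ → E} {N : ℕ}
    (hB : ∀ i, B (b i) = q i • b i) (hsymm : ∀ v w, inner ℝ (B v) w = inner ℝ v (B w))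
    (hq : ∀ i, 0 ≤ q i) (hqq : ∀ i, q i ≤ q₀) (hq₀ : q i₀ = q₀)
    (hζ : 0 ≤ ζ) (hζ1 : ζ ≤ 1) (hμ : 1 < μ) (hν : 0 ≤ ν) (hν1 : ν < 1)
    (hsum : μ + ν = q₀ * (1 + ζ)) (hprod : μ * ν = q₀ * ζ) (hμν : μ - ν ≤ 8 * (1 - ν))
    (hβ : 0 ≤ β) (h01 : V 1 = V 0)
    (hV : ∀ k < N, ‖V (k + 2) - B ((1 + ζ) • V (k + 1) - ζ • V k)‖
      ≤ β * ‖(1 + ζ) • V (k + 1) - ζ • V k‖)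
    (hN : 12 * N * β ≤ μ - 1) (hN' : 24 * N * β ≤ 1 - ν)
    (h0 : ‖V 0‖ ≤ 2 * inner ℝ (b i₀) (V 0)) :
    μ ^ (N + 1) * (inner ℝ (b i₀) (V 0) / 16) ≤ inner ℝ (b i₀) (V (N + 1)) := by
  set f : ℕ → E := fun k => V (k + 2) - B ((1 + ζ) • V (k + 1) - ζ • V k) with hf
  have hrec : ∀ k, V (k + 2) = B ((1 + ζ) • V (k + 1) - ζ • V k) + f k := fun k => by
    simp only [hf]; abel
  have hduh := momentum_duhamel B ζ V f h01 hrec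
  have hμ0 : 0 < μ := by linarith
  have hx : 0 < μ - 1 := by linarith
  have hfk : ∀ k < N, ‖V (k + 1)‖ ≤ 2 * μ ^ (k + 1) * ‖V 0‖ → ‖V k‖ ≤ 2 * μ ^ k * ‖V 0‖ →
      ‖f k‖ ≤ 6 * β * μ ^ (k + 1) * ‖V 0‖ := by
    intro k hk h1 h2
    have h3 : ‖(1 + ζ) • V (k + 1) - ζ • V k‖ ≤ 2 * ‖V (k + 1)‖ + 1 * ‖V k‖ := by
      refine (norm_sub_le _ _).trans (add_le_add ?_ ?_)
      · rw [norm_smul, Real.norm_of_nonneg (by linarith)]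
        exact mul_le_mul_of_nonneg_right (by linarith) (norm_nonneg _)
      · rw [norm_smul, Real.norm_of_nonneg hζ]
        exact mul_le_mul_of_nonneg_right hζ1 (norm_nonneg _)
    have h4 : μ ^ k * ‖V 0‖ ≤ μ ^ (k + 1) * ‖V 0‖ :=
      mul_le_mul_of_nonneg_right (pow_le_pow_right₀ hμ.le (by omega)) (norm_nonneg _)
    calc ‖f k‖ ≤ _ := hV k hk
      _ ≤ β * (6 * (μ ^ (k + 1) * ‖V 0‖)) := mul_le_mul_of_nonneg_left (by linarith) hβ
      _ = _ := by ring
  have hbound : ∀ n ≤ N + 1, ‖V n‖ ≤ 2 * μ ^ n * ‖V 0‖ := by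
    intro n
    induction n using Nat.strong_induction_on with
    | _ n ih =>
    intro hn
    have hA : ‖momSeq ζ B ((1 : ℝ) • (1 : E →L[ℝ] E)) ((1 : ℝ) • 1) n (V 0)‖ ≤ μ ^ n * ‖V 0‖ :=
      norm_apply_le_of_diagonal b _ (fun i => momSeq ζ (q i) 1 1 n)
        (fun i => momSeq_apply_eigen (hB i) n) (by positivity)
        (fun i => abs_momSeq_one_one_le hζ hζ1 (hq i) (hqq i) hμ.le hsum hprod n) _
    have hK : ∀ j, ∀ v, ‖momSeq ζ B ((0 : ℝ) • (1 : E →L[ℝ] E)) ((1 : ℝ) • 1) j v‖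
        ≤ 2 / (μ - 1) * μ ^ j * ‖v‖ := fun j v =>
      norm_apply_le_of_diagonal b _ (fun i => momSeq ζ (q i) 0 1 j)
        (fun i => momSeq_apply_eigen (hB i) j) (by positivity)
        (fun i => abs_momSeq_zero_one_le hζ hζ1 (hq i) (hqq i) hμ hν hν1.le hsum hprod j) _
    cases n with
    | zero => simp only [pow_zero]; linarith [norm_nonneg (V 0)]
    | succ n =>
      -- The last kernel is zero, so `V (n + 1)` involves only the `f k` with `k < n`, which the
      -- induction hypothesis already bounds.
      rw [hduh (n + 1), Finset.sum_range_succ, Nat.add_sub_cancel, Nat.sub_self]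
      simp only [momSeq, zero_smul, zero_apply, add_zero]
      have hS : ‖∑ k ∈ Finset.range n, momSeq ζ B ((0 : ℝ) • (1 : E →L[ℝ] E)) ((1 : ℝ) • 1)
          (n - k) (f k)‖ ≤ μ ^ (n + 1) * ‖V 0‖ := by
        calc _ ≤ ∑ k ∈ Finset.range n, (2 / (μ - 1) * (6 * β * (μ ^ (n + 1) * ‖V 0‖))) := by
              refine (norm_sum_le _ _).trans (Finset.sum_le_sum fun k hk => ?_)
              have hk := Finset.mem_range.1 hk
              have h1 := hfk k (by omega) (ih (k + 1) (by omega) (by omega))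
                (ih k (by omega) (by omega))
              calc _ ≤ _ := hK _ _
                _ ≤ 2 / (μ - 1) * μ ^ (n - k) * (6 * β * μ ^ (k + 1) * ‖V 0‖) :=
                  mul_le_mul_of_nonneg_left h1 (by positivity)
                _ = 2 / (μ - 1) * (6 * β * ((μ ^ (n - k) * μ ^ (k + 1)) * ‖V 0‖)) := by ring
                _ = _ := by rw [← pow_add, show n - k + (k + 1) = n + 1 by omega]
          _ = (12 * n * β / (μ - 1)) * (μ ^ (n + 1) * ‖V 0‖) := by
              rw [Finset.sum_const, Finset.card_range, nsmul_eq_mul]; ring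
          _ ≤ 1 * (μ ^ (n + 1) * ‖V 0‖) := by
              refine mul_le_mul_of_nonneg_right ?_ (by positivity)
              rw [div_le_one hx]
              have : (n : ℝ) ≤ N := by exact_mod_cast (by omega : n ≤ N)
              nlinarith
          _ = _ := one_mul _
      simp only [zero_smul] at hS
      refine (norm_add_le _ _).trans ?_
      linarith
  set ψ := inner ℝ (b i₀) (V 0) with hψ
  have hψ0 : 0 ≤ ψ := by linarith [norm_nonneg (V 0)]
  have hcoef : ∀ k, inner ℝ (b i₀) (V (k + 2))
      = (μ + ν) * inner ℝ (b i₀) (V (k + 1)) - μ * ν * inner ℝ (b i₀) (V k)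
        + inner ℝ (b i₀) (f k) := by
    intro k
    rw [hrec k, inner_add_right, ← hsymm, hB, inner_smul_left, inner_sub_right, inner_smul_right,
      inner_smul_right, hq₀, hsum, hprod]
    simp only [conj_trivial]; ring
  have hfe : ∀ k < N, -(12 * β * μ ^ (k + 1) * ψ) ≤ inner ℝ (b i₀) (f k) := by
    intro k hk
    have h1 := hfk k hk (hbound _ (by omega)) (hbound _ (by omega))
    have h2 := abs_real_inner_le_norm (b i₀) (f k)
    rw [OrthonormalBasis.norm_eq_one, one_mul] at h2
    have h3 := (abs_le.1 (h2.trans h1)).1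
    have h4 : 6 * β * μ ^ (k + 1) * ‖V 0‖ ≤ 6 * β * μ ^ (k + 1) * (2 * ψ) :=
      mul_le_mul_of_nonneg_left h0 (by positivity)
    linarith
  -- Subtracting `ν` times the previous coefficient factors the second-order recursion into one with
  -- the single multiplier `μ`.
  have hd : ∀ k ≤ N, μ ^ k * ((1 - ν) * ψ - 12 * k * β * ψ)
      ≤ inner ℝ (b i₀) (V (k + 1)) - ν * inner ℝ (b i₀) (V k) := by
    intro k
    induction k with
    | zero => intro _; rw [h01]; simp only [pow_zero, Nat.cast_zero]; linarith
    | succ k ih =>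
      intro hk
      have ih := mul_le_mul_of_nonneg_left (ih (by omega)) hμ0.le
      have h1 := hfe k (by omega)
      rw [hcoef]
      push_cast
      rw [pow_succ] at h1 ⊢
      linarith
  have hp : ∀ k ≤ N + 1, μ ^ k * (ψ / 16) ≤ inner ℝ (b i₀) (V k) := by
    intro k
    induction k with
    | zero => intro _; simp only [pow_zero]; linarith
    | succ k ih =>
      intro hk
      have ih := mul_le_mul_of_nonneg_left (ih (by omega)) hν
      have h1 := hd k (by omega)
      have hkN : (k : ℝ) ≤ N := by exact_mod_cast (by omega : k ≤ N)
      -- The perturbation takes at most half of `(1 - ν) ψ`, and `μ - ν ≤ 8 (1 - ν)`; together they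
      -- give the factor `16`.
      have h2 : (μ - ν) * (ψ / 16) ≤ (1 - ν) * ψ - 12 * k * β * ψ := by
        have h3 := mul_le_mul_of_nonneg_right hμν hψ0
        have h4 := mul_le_mul_of_nonneg_right hN' hψ0
        have h5 := mul_le_mul_of_nonneg_right hkN (mul_nonneg hβ hψ0)
        linarith
      have h6 := mul_le_mul_of_nonneg_left h2 (pow_nonneg hμ0.le k)
      rw [pow_succ]
      linarith
  exact hp _ le_rfl

end vector

/-! ### Accelerated descent: separation, energy, confinement, triggered runs -/

section agd

variable {d : ℕ} {L₁ L₂ η ζ : ℝ} {h : Vec d → ℝ} {G : Vec d → Vec d} {H : Vec d →L[ℝ] Vec d}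

/-- The last displacement `y_k - y_{k-1}` of the accelerated iteration from `(u, u)`. -/
def agdDiff (η ζ : ℝ) (G : Vec d → Vec d) (u : Vec d) : ℕ → Vec d
  | 0 => 0
  | k + 1 => ((agdStep η ζ G)^[k + 1] (u, u)).1 - ((agdStep η ζ G)^[k] (u, u)).1

lemma agd_fst_succ (u : Vec d) (k : ℕ) :
    ((agdStep η ζ G)^[k + 1] (u, u)).1 = ((agdStep η ζ G)^[k] (u, u)).2
      - η • G ((agdStep η ζ G)^[k] (u, u)).2 := by
  rw [Function.iterate_succ_apply']; rfl

lemma agd_snd (u : Vec d) (k : ℕ) :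
    ((agdStep η ζ G)^[k] (u, u)).2
      = ((agdStep η ζ G)^[k] (u, u)).1 + ζ • agdDiff η ζ G u k := by
  cases k with
  | zero => simp [agdDiff]
  | succ k => rw [agdDiff, Function.iterate_succ_apply']; rfl

lemma agd_zero (hG : G 0 = 0) (k : ℕ) : (agdStep η ζ G)^[k] (0, 0) = (0, 0) := by
  refine Function.iterate_fixed ?_ k
  simp [agdStep, hG]

lemma agd_norm_snd_le (hζ : 0 ≤ ζ) (hζ1 : ζ ≤ 1) {u : Vec d} {N : ℕ} {R : ℝ}
    (hu : ∀ k ≤ N, ‖((agdStep η ζ G)^[k] (u, u)).1‖ ≤ R) {k : ℕ} (hk : k ≤ N) :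
    ‖((agdStep η ζ G)^[k] (u, u)).2‖ ≤ 3 * R := by
  have hR : 0 ≤ R := (norm_nonneg _).trans (hu 0 (by omega))
  rw [agd_snd]
  have h1 : ‖agdDiff η ζ G u k‖ ≤ 2 * R := by
    cases k with
    | zero => simpa [agdDiff] using hR
    | succ k =>
      exact (norm_sub_le _ _).trans (by linarith [hu (k + 1) hk, hu k (by omega)])
  refine (norm_add_le _ _).trans ?_
  rw [norm_smul, Real.norm_of_nonneg hζ]
  nlinarith [hu k hk, norm_nonneg (agdDiff η ζ G u k)]

/-- The gradients are evaluated at the extrapolated points, which lie only in the ball of radius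
`3R`. The `144` is `24 * 3 * 2`: the constant of `momentum_growth`, this factor three, and the two
in `1 - ν ≥ √σ / 2`. -/
lemma LocalModel.agd_separation (M : LocalModel L₁ L₂ h G H)
    {b : OrthonormalBasis (Fin d) ℝ (Vec d)} {lam : Fin d → ℝ} {i₀ : Fin d} {θ σ : ℝ}
    (hb : ∀ i, H (b i) = lam i • b i) (hmin : ∀ i, lam i₀ ≤ lam i)
    (hη : 0 ≤ η) (hηL : η * L₁ ≤ 1 / 16) (hL₂ : 0 ≤ L₂)
    (hσ : σ = η * (-lam i₀)) (hσ0 : 0 < σ) (hθ : 0 < θ) (hθ1 : θ ≤ 1) (hθσ : θ ^ 2 ≤ 5 / 4 * σ)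
    (hζ : ζ = 1 - θ) {N : ℕ} {R : ℝ} {u w : Vec d}
    (hN : 144 * N * (η * (L₂ * R)) ≤ √σ)
    (hu : ∀ k ≤ N, ‖((agdStep η ζ G)^[k] (u, u)).1‖ ≤ R)
    (hw : ∀ k ≤ N, ‖((agdStep η ζ G)^[k] (w, w)).1‖ ≤ R)
    (h0 : ‖w - u‖ ≤ 2 * inner ℝ (b i₀) (w - u)) :
    (1 + √σ / 2) ^ N * (inner ℝ (b i₀) (w - u) / 16) ≤ 2 * R := by
  have hR : 0 ≤ R := (norm_nonneg _).trans (hu 0 (by omega))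
  have hψ : 0 ≤ inner ℝ (b i₀) (w - u) := by linarith [norm_nonneg (w - u)]
  have habs := fun i => abs_le.1 (M.abs_eigenvalue_le hb i)
  obtain ⟨μ, ν, hsum, hprod, hμ, hν1, hν, hμν⟩ := exists_momentum_roots hθ hθ1 hσ0
    (by nlinarith [habs i₀]) hθσ
  have hs : 0 < √σ := Real.sqrt_pos.2 hσ0
  rw [← hζ] at hsum hprod
  have hNβ : 0 ≤ N * (η * (L₂ * R)) := by positivity
  cases N with
  | zero =>
    simp only [pow_zero, one_mul]
    have h1 := real_inner_le_norm (b i₀) (w - u)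
    rw [OrthonormalBasis.norm_eq_one, one_mul] at h1
    have h2 := norm_sub_le w u
    have h3 := hu 0 le_rfl
    have h4 := hw 0 le_rfl
    simp only [Function.iterate_zero, id_eq] at h3 h4
    linarith
  | succ N =>
  -- The initial difference is repeated because the method starts with zero momentum, which is the
  -- condition `V 1 = V 0`.
  let V : ℕ → Vec d := fun k => match k with
    | 0 => w - u
    | k + 1 => ((agdStep η ζ G)^[k] (w, w)).1 - ((agdStep η ζ G)^[k] (u, u)).1
  have hVu : ∀ k, (1 + ζ) • V (k + 1) - ζ • V k
      = ((agdStep η ζ G)^[k] (w, w)).2 - ((agdStep η ζ G)^[k] (u, u)).2 := by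
    intro k
    rw [agd_snd, agd_snd]
    cases k with
    | zero => simp only [V, agdDiff, Function.iterate_zero, id_eq, smul_zero, add_zero]; module
    | succ k => simp only [V, agdDiff]; module
  have key := momentum_growth b (gdLin η H) (fun i => 1 - η * lam i) i₀ (q₀ := 1 + σ) (ζ := ζ)
    (μ := μ) (ν := ν) (β := η * (L₂ * (3 * R))) (V := V) (N := N + 1)
    (gdLin_eigen hb) M.gdLin_symm
    (fun i => by have := habs i; nlinarith) (fun i => by have := hmin i; rw [hσ]; nlinarith)
    (by rw [hσ]; ring) (by rw [hζ]; linarith) (by rw [hζ]; linarith) (by linarith) hν (by linarith)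
    hsum hprod hμν (by positivity) (by simp [V]) ?_ (by linarith) (by linarith) h0
  · calc _ ≤ μ ^ (N + 1 + 1) * (inner ℝ (b i₀) (w - u) / 16) := by
          refine mul_le_mul_of_nonneg_right ?_ (by positivity)
          exact (pow_le_pow_left₀ (by positivity) (by linarith) _).trans
            (pow_le_pow_right₀ (by linarith) (by omega))
      _ ≤ inner ℝ (b i₀) (V (N + 1 + 1)) := key
      _ ≤ ‖V (N + 1 + 1)‖ := by
          have h1 := real_inner_le_norm (b i₀) (V (N + 1 + 1))
          rwa [OrthonormalBasis.norm_eq_one, one_mul] at h1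
      _ ≤ _ := (norm_sub_le _ _).trans (by linarith [hu (N + 1) le_rfl, hw (N + 1) le_rfl])
  · intro k hk
    rw [hVu]
    have e : V (k + 2) = ((agdStep η ζ G)^[k + 1] (w, w)).1
        - ((agdStep η ζ G)^[k + 1] (u, u)).1 := rfl
    have hζ0 : 0 ≤ ζ := by rw [hζ]; linarith
    have hζ1 : ζ ≤ 1 := by rw [hζ]; linarith
    have h1 := agd_norm_snd_le hζ0 hζ1 hu hk.le
    have h2 := agd_norm_snd_le hζ0 hζ1 hw hk.le
    have h3 := M.lip₂ h1 h2
    rw [e, agd_fst_succ, agd_fst_succ, gdLin_apply]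
    set a := ((agdStep η ζ G)^[k] (w, w)).2
    set c := ((agdStep η ζ G)^[k] (u, u)).2
    have e : a - η • G a - (c - η • G c) - (a - c - η • H (a - c))
        = -(η • (G a - G c - H (a - c))) := by
      simp only [smul_sub]; abel
    rw [e, norm_neg, norm_smul, Real.norm_of_nonneg hη, mul_assoc]
    exact mul_le_mul_of_nonneg_left h3 hη

variable {γ θ : ℝ}

/-- A passed test is a weak convexity inequality between `y` and the extrapolated point. With the
descent inequality it lets the energy drop by `θ ‖D‖²`, the friction of the momentum. -/
lemma LocalModel.agd_energy_step (M : LocalModel L₁ L₂ h G H) (hη : 0 ≤ η)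
    (hηL : η * L₁ ≤ 1 / 2) (hθ : 0 ≤ θ) (hθ1 : θ ≤ 1) (hθγ : θ ^ 2 = η * γ) {y D : Vec d}
    (hT : ¬ Triggers h G γ (y, y + (1 - θ) • D)) :
    2 * η * h (y + (1 - θ) • D - η • G (y + (1 - θ) • D))
      + ‖y + (1 - θ) • D - η • G (y + (1 - θ) • D) - y‖ ^ 2
      ≤ 2 * η * h y + (1 - θ) * ‖D‖ ^ 2 := by
  simp only [Triggers, not_lt] at hT
  set u := y + (1 - θ) • D with hu
  have hyu : ‖y - u‖ ^ 2 = (1 - θ) ^ 2 * ‖D‖ ^ 2 := by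
    rw [hu, sub_add_cancel_left, norm_neg, norm_smul, mul_pow, Real.norm_eq_abs, sq_abs]
  have h1 := (abs_le.1 (M.taylor u (u - η • G u))).2
  rw [sub_sub_cancel_left, inner_neg_right, inner_smul_right, real_inner_self_eq_norm_sq, norm_neg,
    norm_smul, mul_pow, Real.norm_of_nonneg hη] at h1
  have h2 : ‖u - η • G u - y‖ ^ 2
      = ‖y - u‖ ^ 2 + 2 * η * inner ℝ (G u) (y - u) + η ^ 2 * ‖G u‖ ^ 2 := by
    rw [show u - η • G u - y = -((y - u) + η • G u) by abel, norm_neg, norm_add_sq_real,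
      inner_smul_right, norm_smul, mul_pow, Real.norm_of_nonneg hη, real_inner_comm]
    ring
  rw [h2]
  have h3 : 0 ≤ η ^ 2 * ‖G u‖ ^ 2 := by positivity
  have h4 := mul_le_mul_of_nonneg_right hηL h3
  -- This is where `θ² = ηγ` matters: the curvature allowance adds `θ²`, and `(1 + θ²)(1 - θ) ≤ 1`.
  have h5 : (1 + η * γ) * ‖y - u‖ ^ 2 ≤ (1 - θ) * ‖D‖ ^ 2 := by
    rw [hyu, ← hθγ, ← mul_assoc]
    refine mul_le_mul_of_nonneg_right ?_ (sq_nonneg _)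
    have : (1 + θ ^ 2) * (1 - θ) ≤ 1 := by nlinarith [mul_nonneg hθ (sq_nonneg (θ - 1 / 2))]
    nlinarith
  nlinarith [mul_le_mul_of_nonneg_left hT hη, mul_le_mul_of_nonneg_left h1 hη]

lemma LocalModel.agd_energy (M : LocalModel L₁ L₂ h G H) (hη : 0 ≤ η)
    (hηL : η * L₁ ≤ 1 / 2) (hθ : 0 ≤ θ) (hθ1 : θ ≤ 1) (hθγ : θ ^ 2 = η * γ) (hζ : ζ = 1 - θ)
    (u : Vec d) (n : ℕ) (hT : ∀ j < n, ¬ Triggers h G γ ((agdStep η ζ G)^[j] (u, u))) :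
    2 * η * h ((agdStep η ζ G)^[n] (u, u)).1 + ‖agdDiff η ζ G u n‖ ^ 2
      + θ * ∑ j ∈ Finset.range n, ‖agdDiff η ζ G u j‖ ^ 2 ≤ 2 * η * h u := by
  induction n with
  | zero => simp [agdDiff]
  | succ n ih =>
    have ih := ih fun j hj => hT j (by omega)
    have h1 : (agdStep η ζ G)^[n] (u, u) = (((agdStep η ζ G)^[n] (u, u)).1,
        ((agdStep η ζ G)^[n] (u, u)).1 + (1 - θ) • agdDiff η ζ G u n) := by
      rw [← hζ, ← agd_snd]
    have h2 := hT n (by omega)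
    rw [h1] at h2
    have h3 := M.agd_energy_step hη hηL hθ hθ1 hθγ h2
    rw [← hζ, ← agd_snd, ← agd_fst_succ] at h3
    change _ + ‖agdDiff η ζ G u (n + 1)‖ ^ 2 ≤ _ at h3
    rw [Finset.sum_range_succ]
    have h4 : ζ * ‖agdDiff η ζ G u n‖ ^ 2 = (1 - θ) * ‖agdDiff η ζ G u n‖ ^ 2 :=
      congrArg (· * ‖agdDiff η ζ G u n‖ ^ 2) hζ
    linarith

/-- Friction makes the squared displacements summable, and Cauchy–Schwarz turns this into a bound on
the distance travelled. -/
lemma LocalModel.agd_displacement (M : LocalModel L₁ L₂ h G H) (hη : 0 ≤ η)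
    (hηL : η * L₁ ≤ 1 / 2) (hθ : 0 ≤ θ) (hθ1 : θ ≤ 1) (hθγ : θ ^ 2 = η * γ) (hζ : ζ = 1 - θ)
    (u : Vec d) (n : ℕ) (hT : ∀ j < n, ¬ Triggers h G γ ((agdStep η ζ G)^[j] (u, u))) :
    θ * ‖((agdStep η ζ G)^[n] (u, u)).1 - u‖ ^ 2
      ≤ n * (2 * η * (h u - h ((agdStep η ζ G)^[n] (u, u)).1)) := by
  have h1 := norm_sub_sq_le_sum (fun j => ((agdStep η ζ G)^[j] (u, u)).1) n
  have h2 := M.agd_energy hη hηL hθ hθ1 hθγ hζ u n hT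
  -- The shifted sum also contains the last displacement. The energy carries it with coefficient
  -- one, which is at least `θ`.
  have h3 : ∑ j ∈ Finset.range n, ‖agdDiff η ζ G u (j + 1)‖ ^ 2
      = ∑ j ∈ Finset.range n, ‖agdDiff η ζ G u j‖ ^ 2 + ‖agdDiff η ζ G u n‖ ^ 2 := by
    have h4 := Finset.sum_range_succ (fun j => ‖agdDiff η ζ G u j‖ ^ 2) n
    have h5 := Finset.sum_range_succ' (fun j => ‖agdDiff η ζ G u j‖ ^ 2) n
    rw [← h4, h5]
    simp [agdDiff]
  change ‖_ - u‖ ^ 2 ≤ n * ∑ j ∈ Finset.range n, ‖agdDiff η ζ G u (j + 1)‖ ^ 2 at h1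
  rw [h3] at h1
  have h6 := mul_le_mul_of_nonneg_left h1 hθ
  refine h6.trans ?_
  have h7 := mul_le_mul_of_nonneg_right hθ1 (sq_nonneg ‖agdDiff η ζ G u n‖)
  have h8 : θ * (∑ j ∈ Finset.range n, ‖agdDiff η ζ G u j‖ ^ 2 + ‖agdDiff η ζ G u n‖ ^ 2)
      ≤ 2 * η * (h u - h ((agdStep η ζ G)^[n] (u, u)).1) := by linarith
  linarith [mul_le_mul_of_nonneg_left h8 (Nat.cast_nonneg (α := ℝ) n)]

lemma LocalModel.norm_gd_le (M : LocalModel L₁ L₂ h G H) (hη : 0 ≤ η) (u : Vec d) :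
    ‖u - η • G u‖ ≤ (1 + η * L₁) * ‖u‖ := by
  refine (norm_sub_le _ _).trans ?_
  rw [norm_smul, Real.norm_of_nonneg hη]
  linarith [mul_le_mul_of_nonneg_left (M.norm_G_le u) hη]

/-- Accelerated descent that neither triggers nor finds a point of low value in the ball of
radius `U` stays in this ball. -/
lemma LocalModel.agd_trapped (M : LocalModel L₁ L₂ h G H) (hη : 0 ≤ η)
    (hηL : η * L₁ ≤ 1 / 4) (hθ : 0 < θ) (hθ1 : θ ≤ 1) (hθγ : θ ^ 2 = η * γ) (hζ : ζ = 1 - θ)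
    {U ϑ : ℝ} {N : ℕ} {u : Vec d} (hu : ‖u‖ ≤ U / 8)
    (hT : ∀ j < N, ¬ Triggers h G γ ((agdStep η ζ G)^[j] (u, u)))
    (hstuck : ∀ k ≤ N, ¬ (‖((agdStep η ζ G)^[k] (u, u)).1‖ ≤ U ∧
      h ((agdStep η ζ G)^[k] (u, u)).1 ≤ -ϑ))
    (hϑ : 0 ≤ ϑ) (hL₁ : 0 ≤ L₁) (hN : 2 * η * N * (L₁ * ‖u‖ ^ 2 + ϑ) ≤ θ * (U / 8) ^ 2) :
    ∀ k ≤ N, ‖((agdStep η ζ G)^[k] (u, u)).1‖ ≤ U := by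
  have hU : 0 ≤ U := by linarith [norm_nonneg u]
  intro k
  induction k with
  | zero => intro _; simp only [Function.iterate_zero, id_eq]; linarith
  | succ k ih =>
    intro hk
    have ih := ih (by omega)
    -- As for gradient descent, the bounds hold at step `k`, and the next point is one gradient step
    -- from the extrapolated point, itself within `U / 2`.
    have hval : -ϑ < h ((agdStep η ζ G)^[k] (u, u)).1 := by
      by_contra hc
      exact hstuck k (by omega) ⟨ih, not_lt.1 hc⟩
    have hTk : ∀ j < k, ¬ Triggers h G γ ((agdStep η ζ G)^[j] (u, u)) :=
      fun j hj => hT j (by omega)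
    have hη2 : η * L₁ ≤ 1 / 2 := by linarith
    have h1 := M.agd_displacement hη hη2 hθ.le hθ1 hθγ hζ u k hTk
    have h2 := M.agd_energy hη hη2 hθ.le hθ1 hθγ hζ u k hTk
    have hsum : 0 ≤ θ * ∑ j ∈ Finset.range k, ‖agdDiff η ζ G u j‖ ^ 2 :=
      mul_nonneg hθ.le (Finset.sum_nonneg fun _ _ => sq_nonneg _)
    have h3 : 2 * η * (h u - h ((agdStep η ζ G)^[k] (u, u)).1) ≤ 2 * η * (L₁ * ‖u‖ ^ 2 + ϑ) :=
      mul_le_mul_of_nonneg_left (by linarith [M.h_le u]) (by positivity)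
    have hX : 0 ≤ 2 * η * (L₁ * ‖u‖ ^ 2 + ϑ) := by positivity
    have hkN : (k : ℝ) ≤ N := by exact_mod_cast (by omega : k ≤ N)
    have hN1 : (1 : ℝ) ≤ N := by exact_mod_cast (by omega : 1 ≤ N)
    have h4 : ‖((agdStep η ζ G)^[k] (u, u)).1 - u‖ ≤ U / 8 := by
      refine le_of_sq_le_sq ?_ (by positivity)
      refine le_of_mul_le_mul_left ?_ hθ
      calc _ ≤ _ := h1
        _ ≤ k * (2 * η * (L₁ * ‖u‖ ^ 2 + ϑ)) := mul_le_mul_of_nonneg_left h3 (by positivity)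
        _ ≤ N * (2 * η * (L₁ * ‖u‖ ^ 2 + ϑ)) := mul_le_mul_of_nonneg_right hkN hX
        _ ≤ _ := by linarith
    have h5 : ‖agdDiff η ζ G u k‖ ≤ U / 8 := by
      refine le_of_sq_le_sq ?_ (by positivity)
      calc _ ≤ 2 * η * (L₁ * ‖u‖ ^ 2 + ϑ) := by linarith
        _ ≤ N * (2 * η * (L₁ * ‖u‖ ^ 2 + ϑ)) := le_mul_of_one_le_left hX hN1
        _ ≤ θ * (U / 8) ^ 2 := by linarith
        _ ≤ _ := mul_le_of_le_one_left (sq_nonneg _) hθ1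
    have h6 : ‖((agdStep η ζ G)^[k] (u, u)).1‖ ≤ U / 4 := by
      calc _ = ‖(((agdStep η ζ G)^[k] (u, u)).1 - u) + u‖ := by simp
        _ ≤ _ := (norm_add_le _ _).trans (by linarith)
    have h7 : ‖((agdStep η ζ G)^[k] (u, u)).2‖ ≤ U / 2 := by
      rw [agd_snd]
      refine (norm_add_le _ _).trans ?_
      have hζ0 : 0 ≤ ζ := by linarith
      rw [norm_smul, Real.norm_of_nonneg hζ0]
      have : ζ * ‖agdDiff η ζ G u k‖ ≤ ‖agdDiff η ζ G u k‖ :=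
        mul_le_of_le_one_left (norm_nonneg _) (by linarith)
      linarith
    rw [agd_fst_succ]
    refine (M.norm_gd_le hη _).trans ?_
    nlinarith [norm_nonneg ((agdStep η ζ G)^[k] (u, u)).2]

/-- As long as all displacements are small, the accelerated iterates stay near the origin. -/
lemma agd_norm_le_of_small (hζ : 0 ≤ ζ) (hζ1 : ζ ≤ 1) {ρ r : ℝ} {u : Vec d} (hu : ‖u‖ ≤ r)
    {k : ℕ} (hD : ∀ i ≤ k, ‖agdDiff η ζ G u i‖ ≤ ρ) :
    ‖((agdStep η ζ G)^[k] (u, u)).1‖ ≤ r + k * ρ ∧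
      ‖((agdStep η ζ G)^[k] (u, u)).2‖ ≤ r + (k + 1) * ρ := by
  have h1 : ‖((agdStep η ζ G)^[k] (u, u)).1‖ ≤ r + k * ρ := by
    induction k with
    | zero => simpa using hu
    | succ k ih =>
      have ih := ih fun i hi => hD i (by omega)
      have h2 := hD (k + 1) le_rfl
      rw [agdDiff] at h2
      calc _ = ‖((agdStep η ζ G)^[k + 1] (u, u)).1 - ((agdStep η ζ G)^[k] (u, u)).1
              + ((agdStep η ζ G)^[k] (u, u)).1‖ := by simp
        _ ≤ _ := (norm_add_le _ _).trans (by push_cast; linarith)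
  refine ⟨h1, ?_⟩
  rw [agd_snd]
  refine (norm_add_le _ _).trans ?_
  rw [norm_smul, Real.norm_of_nonneg hζ]
  have h2 := hD k le_rfl
  nlinarith [norm_nonneg (agdDiff η ζ G u k)]

/-- The output of a triggered run of NEON⁺ is a direction of negative curvature. -/
lemma LocalModel.agd_triggered (M : LocalModel L₁ L₂ h G H) (hη : 0 < η)
    (hηL : η * L₁ ≤ 1 / 4) (hL₂ : 0 ≤ L₂)
    (hθ : 0 < θ) (hθ1 : θ < 1) (hθγ : θ ^ 2 = η * γ)
    (hζ : ζ = 1 - θ) {F r K : ℝ} {t : ℕ} {u : Vec d} (hF : 0 < F) (hu : ‖u‖ = r)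
    (hr : L₁ * r ^ 2 ≤ F) (hK : 0 ≤ K) (hKr : 2 * K * r ^ 2 ≤ F) (hKt : 12 * K * η * t ≤ θ)
    (hKR : 8 * (L₂ * (r + (t + 1) * √(6 * η * F))) ≤ K) (hKγ : 2 * K ≤ γ)
    {τ : ℕ} (hτ : τ ≤ t) (hT : ∀ j < τ, ¬ Triggers h G γ ((agdStep η ζ G)^[j] (u, u)))
    (hTτ : Triggers h G γ ((agdStep η ζ G)^[τ] (u, u))) {z : Vec d}
    (hz : z = ncFind ζ η F ((List.range (τ + 1)).map fun j => (agdStep η ζ G)^[j] (u, u))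
      ((agdStep η ζ G)^[τ] (u, u)).1 ((agdStep η ζ G)^[τ] (u, u)).2) :
    z ≠ 0 ∧ inner ℝ z (H z) ≤ -K * ‖z‖ ^ 2 := by
  have hζ0 : 0 < ζ := by rw [hζ]; linarith
  have hζ1 : ζ ≤ 1 := by rw [hζ]; linarith
  set ρ := √(6 * η * F) with hρ
  have hρ0 : 0 < ρ := Real.sqrt_pos.2 (by positivity)
  have hρ2 : ρ ^ 2 = 6 * η * F := Real.sq_sqrt (by positivity)
  have hr0 : 0 ≤ r := hu ▸ norm_nonneg u
  have hyu : ∀ j, ‖((agdStep η ζ G)^[j] (u, u)).1 - ((agdStep η ζ G)^[j] (u, u)).2‖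
      = ζ * ‖agdDiff η ζ G u j‖ := fun j => by
    rw [agd_snd, sub_add_cancel_left, norm_neg, norm_smul, Real.norm_of_nonneg hζ0.le]
  rcases ncFind_spec ζ η F (fun j => (agdStep η ζ G)^[j] (u, u)) (τ + 1)
      ((agdStep η ζ G)^[τ] (u, u)).1 ((agdStep η ζ G)^[τ] (u, u)).2 with
      ⟨j, hj, hjbig, hjs, hres⟩ | ⟨hsmall, hres⟩
  · rw [hres] at hz
    simp only [hyu] at hjbig hjs
    have hDj : ρ ≤ ‖agdDiff η ζ G u j‖ := le_of_mul_le_mul_left hjbig hζ0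
    have hDi : ∀ i < j, ‖agdDiff η ζ G u i‖ ≤ ρ :=
      fun i hi => (lt_of_mul_lt_mul_left (hjs i hi) hζ0.le).le
    have hTj : ∀ i < j, ¬ Triggers h G γ ((agdStep η ζ G)^[i] (u, u)) :=
      fun i hi => hT i (by omega)
    have hη2 : η * L₁ ≤ 1 / 2 := by linarith
    have h1 := M.agd_displacement hη.le hη2 hθ.le hθ1.le hθγ hζ u j hTj
    have h2 := M.agd_energy hη.le hη2 hθ.le hθ1.le hθγ hζ u j hTj
    have hsum : 0 ≤ θ * ∑ i ∈ Finset.range j, ‖agdDiff η ζ G u i‖ ^ 2 :=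
      mul_nonneg hθ.le (Finset.sum_nonneg fun _ _ => sq_nonneg _)
    rw [← hz] at h1 h2
    have h3 := M.h_le u
    rw [hu] at h3
    -- A displacement of at least `√(6ηF)` accounts for `3F` of the decrease of `h`, while the start
    -- contributes at most `F`.
    have hX : h z ≤ -2 * F := by
      have h4 : ρ ^ 2 ≤ ‖agdDiff η ζ G u j‖ ^ 2 := pow_le_pow_left₀ hρ0.le hDj 2
      have h5 : 2 * η * (h z + 3 * F) ≤ 2 * η * F := by
        have := mul_le_mul_of_nonneg_left (h3.trans hr) (by positivity : 0 ≤ 2 * η)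
        linarith
      have := le_of_mul_le_mul_left h5 (by positivity)
      linarith
    have hz0 : z ≠ 0 := by
      rintro h0
      rw [h0, M.h_zero] at hX
      linarith
    have hjt : (j : ℝ) ≤ t := by exact_mod_cast (by omega : j ≤ t)
    -- One half of `-h z` pays for the distance from `u`, the other, at least `F`, for the norm of
    -- `u`.
    have hzn : K * ‖z‖ ^ 2 ≤ -h z := by
      have h6 : ‖z‖ ^ 2 ≤ 2 * ‖z - u‖ ^ 2 + 2 * r ^ 2 := by
        have h7 : ‖z‖ ≤ ‖z - u‖ + r := by
          calc ‖z‖ = ‖(z - u) + u‖ := by simp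
            _ ≤ _ := (norm_add_le _ _).trans (by rw [hu])
        have h8 := pow_le_pow_left₀ (norm_nonneg z) h7 2
        nlinarith [sq_nonneg (‖z - u‖ - r)]
      have h9 : θ * (2 * K * ‖z - u‖ ^ 2) ≤ θ * (-h z / 2) := by
        have hX' : 0 ≤ η * K * (-h z) :=
          mul_nonneg (mul_nonneg hη.le hK) (by linarith)
        calc θ * (2 * K * ‖z - u‖ ^ 2) = 2 * K * (θ * ‖z - u‖ ^ 2) := by ring
          _ ≤ 2 * K * (j * (2 * η * (h u - h z))) := mul_le_mul_of_nonneg_left h1 (by positivity)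
          _ ≤ 2 * K * (j * (2 * η * (3 / 2 * -h z))) := by
              refine mul_le_mul_of_nonneg_left ?_ (by positivity)
              refine mul_le_mul_of_nonneg_left ?_ (by positivity)
              exact mul_le_mul_of_nonneg_left (by linarith) (by positivity)
          _ = j * (6 * (η * K * -h z)) := by ring
          _ ≤ t * (6 * (η * K * -h z)) := mul_le_mul_of_nonneg_right hjt (by linarith)
          _ = (12 * K * η * t) * (-h z / 2) := by ring
          _ ≤ _ := mul_le_mul_of_nonneg_right hKt (by linarith)
      have h10 := le_of_mul_le_mul_left h9 hθ
      have h11 := mul_le_mul_of_nonneg_left h6 hK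
      linarith
    have hj0 : j ≠ 0 := by
      rintro rfl
      simp only [agdDiff, norm_zero] at hDj
      linarith
    obtain ⟨k, rfl⟩ := Nat.exists_eq_succ_of_ne_zero hj0
    -- The displacement at `j` has no upper bound here, but all earlier ones do. So `z` is treated
    -- as one gradient step from the preceding extrapolated point.
    have hzR : ‖z‖ ≤ 2 * (r + (t + 1) * ρ) := by
      have h12 := (agd_norm_le_of_small (G := G) (η := η) hζ0.le hζ1 hu.le (k := k)
        fun i hi => hDi i (by omega)).2
      rw [hz, agd_fst_succ]
      refine (M.norm_gd_le hη.le _).trans ?_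
      have hkt : (k : ℝ) + 1 ≤ t + 1 := by
        have : (k : ℝ) ≤ t := by exact_mod_cast (by omega : k ≤ t)
        linarith
      have h13 := mul_le_mul_of_nonneg_right hkt hρ0.le
      nlinarith [norm_nonneg ((agdStep η ζ G)^[k] (u, u)).2]
    refine ⟨hz0, ?_⟩
    have h14 := M.inner_hessian_le (u := z) (κ := K) (by linarith)
    refine h14.trans (mul_le_mul_of_nonneg_right ?_ (sq_nonneg _))
    have := mul_le_mul_of_nonneg_left hzR hL₂
    linarith
  · rw [hres] at hz
    simp only [hyu] at hsmall
    have hDi : ∀ i ≤ τ, ‖agdDiff η ζ G u i‖ ≤ ρ :=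
      fun i hi => (lt_of_mul_lt_mul_left (hsmall i (by omega)) hζ0.le).le
    obtain ⟨h1, h2⟩ := agd_norm_le_of_small (G := G) (η := η) hζ0.le hζ1 hu.le hDi
    have hτt : (τ : ℝ) ≤ t := by exact_mod_cast hτ
    have h3 := mul_le_mul_of_nonneg_right hτt hρ0.le
    set y := ((agdStep η ζ G)^[τ] (u, u)).1
    set v := ((agdStep η ζ G)^[τ] (u, u)).2
    simp only [Triggers] at hTτ
    -- All displacements are small, so both points are near the origin and the failed test itself
    -- shows negative curvature along `y - v`. Strictness of the test excludes the zero vector.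
    have h4 := (abs_le.1 (M.taylor₂ (u := v) (v := y) (R := r + (t + 1) * ρ)
      (by linarith) (by linarith))).1
    change h y - h v - inner ℝ (G v) (y - v) < -(γ / 2) * ‖y - v‖ ^ 2 at hTτ
    rw [← hz] at h4 hTτ
    refine ⟨?_, ?_⟩
    · rintro h0
      have h5 : y = v := by rw [← sub_eq_zero, ← hz, h0]
      rw [h0, h5] at hTτ
      simp at hTτ
    · have h6 := mul_le_mul_of_nonneg_right hKR (sq_nonneg ‖z‖)
      have h7 := mul_le_mul_of_nonneg_right hKγ (sq_nonneg ‖z‖)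
      nlinarith

end agd

/-! ### Thin sets on the sphere -/

section sphere

variable {E : Type*} [NormedAddCommGroup E] [InnerProductSpace ℝ E]

/-- Two points on a line parallel to `e` project radially to points of a sphere that are
separated in the direction `e`, unless one of them lies in the double cone around `e`. -/
lemma radial_separation {e p : E} (he : ‖e‖ = 1) {l r : ℝ} (hl : 0 < l) (hr : 0 < r)
    (hp0 : p ≠ 0) (hp0' : p + l • e ≠ 0) (hp1' : ‖p + l • e‖ < 1)
    (hs : |inner ℝ e p| ≤ ‖p‖ / 2) (hs' : |inner ℝ e (p + l • e)| ≤ ‖p + l • e‖ / 2) :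
    let v := (r / ‖p + l • e‖) • (p + l • e) - (r / ‖p‖) • p
    ‖v‖ ≤ 2 * inner ℝ e v ∧ r * l / 2 ≤ inner ℝ e v := by
  intro v
  set p' := p + l • e with hp'
  set n := ‖p‖ with hn
  set n' := ‖p'‖ with hn'
  set s := inner ℝ e p with hs_def
  have hn0 : 0 < n := norm_pos_iff.2 hp0
  have hn0' : 0 < n' := norm_pos_iff.2 hp0'
  have hee : inner ℝ e e = (1 : ℝ) := by rw [real_inner_self_eq_norm_sq, he, one_pow]
  have hsp : inner ℝ e p' = s + l := by rw [hp', inner_add_right, inner_smul_right, hee, mul_one]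
  rw [hsp] at hs'
  have hnn : n' ^ 2 - n ^ 2 = l * (2 * s + l) := by
    rw [hn', hp', norm_add_sq_real, inner_smul_right, real_inner_comm, norm_smul, he,
      Real.norm_of_nonneg hl.le]
    ring
  obtain ⟨hs1, hs2⟩ := abs_le.1 hs
  obtain ⟨hs3, hs4⟩ := abs_le.1 hs'
  -- The cone conditions give `|2s + l| ≤ (n + n') / 2`, and `n'² - n² = l (2s + l)`.
  have hd1 : n' - n ≤ l / 2 := by
    by_contra hc
    push Not at hc
    nlinarith
  have hd2 : -(l / 2) ≤ n' - n := by
    by_contra hc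
    push Not at hc
    nlinarith
  have hev : inner ℝ e v = r * (((s + l) * n - s * n') / (n * n')) := by
    have hv : v = (r / n') • p' - (r / n) • p := rfl
    rw [hv, inner_sub_right, inner_smul_right, inner_smul_right, hsp, ← hs_def]
    field_simp
  have hnum : 3 / 4 * (l * n) ≤ (s + l) * n - s * n' := by
    have : s * (n' - n) ≤ (n / 2) * (l / 2) :=
      (le_abs_self _).trans (by
        rw [abs_mul]
        exact mul_le_mul hs (abs_le.2 ⟨hd2, hd1⟩) (abs_nonneg _) (by positivity))
    nlinarith
  have hlow : r * (3 / 4 * l / n') ≤ inner ℝ e v := by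
    rw [hev]
    refine mul_le_mul_of_nonneg_left ?_ hr.le
    rw [div_le_div_iff₀ hn0' (by positivity)]
    nlinarith
  refine ⟨?_, ?_⟩
  -- The part of `v` orthogonal to `e` comes only from the change of the norm, so it is no larger
  -- than the part along `e`.
  · set q := p - s • e with hq
    have hqn : ‖q‖ ≤ n := by
      refine le_of_sq_le_sq ?_ hn0.le
      rw [hq, norm_sub_sq_real, inner_smul_right, real_inner_comm, ← hs_def, norm_smul, he, mul_pow,
        Real.norm_eq_abs, sq_abs]
      nlinarith [sq_nonneg s]
    have hvq : v = (inner ℝ e v) • e + (r * ((n - n') / (n * n'))) • q := by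
      have e1 : v = ((r / n') * (s + l) - (r / n) * s) • e + (r / n' - r / n) • q := by
        have hv : v = (r / n') • p' - (r / n) • p := rfl
        rw [hv, hq, hp']; module
      rw [e1, inner_add_right, inner_smul_right, inner_smul_right, hee, hq, inner_sub_right,
        inner_smul_right, hee, ← hs_def]
      congr 1
      · congr 1; ring
      · congr 1; field_simp
    have h1 : ‖(r * ((n - n') / (n * n'))) • q‖ ≤ inner ℝ e v := by
      rw [norm_smul, norm_mul, Real.norm_of_nonneg hr.le, mul_assoc]
      refine le_trans (mul_le_mul_of_nonneg_left ?_ hr.le) hlow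
      rw [Real.norm_eq_abs, abs_div, abs_of_pos (mul_pos hn0 hn0'), div_mul_eq_mul_div,
        div_le_div_iff₀ (by positivity) hn0']
      have h2 : |n - n'| ≤ l / 2 := abs_le.2 ⟨by linarith, by linarith⟩
      have h3 : |n - n'| * ‖q‖ ≤ l / 2 * n := mul_le_mul h2 hqn (norm_nonneg _) (by positivity)
      have h4 := mul_le_mul_of_nonneg_right h3 hn0'.le
      have h5 : 0 ≤ l * n * n' := by positivity
      linarith
    have h0 : 0 ≤ inner ℝ e v := le_trans (by positivity) hlow
    calc ‖v‖ = ‖(inner ℝ e v) • e + (r * ((n - n') / (n * n'))) • q‖ := congrArg _ hvq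
      _ ≤ ‖(inner ℝ e v) • e‖ + ‖(r * ((n - n') / (n * n'))) • q‖ := norm_add_le _ _
      _ ≤ inner ℝ e v + inner ℝ e v := by
          refine add_le_add ?_ h1
          rw [norm_smul, he, mul_one, Real.norm_of_nonneg h0]
      _ = _ := by ring
  · refine le_trans ?_ hlow
    rw [mul_div_assoc]
    refine mul_le_mul_of_nonneg_left ?_ hr.le
    rw [div_le_div_iff₀ (by norm_num) hn0']
    nlinarith

/-- If the translates of `A` by multiples of `c • e` up to `(N - 1) * c ≤ 1 / d` are disjoint and
`A` lies in the unit ball of a `d`-dimensional space, then `N` times its volume is at most three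
times the volume of the ball. -/
lemma card_mul_volume_le [MeasurableSpace E] [BorelSpace E] [FiniteDimensional ℝ E]
    (μ : Measure E) [μ.IsAddHaarMeasure] {A : Set E} (hA : MeasurableSet A)
    (hA1 : A ⊆ Metric.ball 0 1) {e : E} (he : ‖e‖ = 1) {N : ℕ} {c : ℝ} (hc : 0 < c)
    (hd : 0 < Module.finrank ℝ E)
    (hNc : N * c ≤ 1 / Module.finrank ℝ E)
    (hsep : ∀ p ∈ A, ∀ l : ℝ, c ≤ l → p + l • e ∉ A) :
    N * μ A ≤ 3 * μ (Metric.ball 0 1) := by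
  set d := Module.finrank ℝ E with hd_def
  have hd' : (0 : ℝ) < d := by exact_mod_cast hd
  let S : ℕ → Set E := fun k => (fun p => p + (-((k : ℝ) * c)) • e) ⁻¹' A
  have hS : ∀ k, μ (S k) = μ A := fun k => measure_preimage_add_right _ _ _
  have hSm : ∀ k, MeasurableSet (S k) := fun k => (measurable_add_const _) hA
  have hdisj : Set.PairwiseDisjoint (↑(Finset.range N)) S := by
    have key : ∀ i j : ℕ, i < j → Disjoint (S i) (S j) := by
      intro i j hij
      rw [Set.disjoint_left]
      intro p hi hj
      simp only [S, Set.mem_preimage] at hi hj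
      have hij' : (1 : ℝ) ≤ (j : ℝ) - i := by
        have : (i : ℝ) + 1 ≤ j := by exact_mod_cast hij
        linarith
      refine hsep _ hj (((j : ℝ) - i) * c) (by nlinarith) ?_
      convert hi using 1
      module
    intro i _ j _ hij
    rcases lt_or_gt_of_ne hij with h | h
    · exact key i j h
    · exact (key j i h).symm
  have hsub : (⋃ k ∈ Finset.range N, S k) ⊆ Metric.ball 0 (1 + 1 / d) := by
    intro p hp
    simp only [Set.mem_iUnion, Finset.mem_range, exists_prop] at hp
    obtain ⟨k, hk, hp⟩ := hp
    have h1 : ‖p + (-((k : ℝ) * c)) • e‖ < 1 := by simpa using hA1 hp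
    have h2 : (k : ℝ) ≤ N := by exact_mod_cast hk.le
    rw [mem_ball_zero_iff]
    calc ‖p‖ = ‖(p + (-((k : ℝ) * c)) • e) + ((k : ℝ) * c) • e‖ := by congr 1; module
      _ ≤ ‖p + (-((k : ℝ) * c)) • e‖ + ‖((k : ℝ) * c) • e‖ := norm_add_le _ _
      _ < 1 + 1 / d := by
        rw [norm_smul, he, mul_one, Real.norm_of_nonneg (by positivity)]
        nlinarith
  -- Shifts of total length `1 / d` enlarge the volume of the ball by at most the factor `e < 3`.
  have h3 : (1 + 1 / (d : ℝ)) ^ d ≤ 3 := by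
    have h4 : (1 + 1 / (d : ℝ)) ^ d ≤ Real.exp 1 := by
      calc _ ≤ Real.exp (1 / d) ^ d := pow_le_pow_left₀ (by positivity)
            (by linarith [Real.add_one_le_exp (1 / (d : ℝ))]) _
        _ = Real.exp (d * (1 / d)) := (Real.exp_nat_mul _ _).symm
        _ = _ := by rw [mul_one_div_cancel hd'.ne']
    linarith [Real.exp_one_lt_d9]
  calc N * μ A = ∑ k ∈ Finset.range N, μ (S k) := by simp [hS]
    _ = μ (⋃ k ∈ Finset.range N, S k) :=
      (measure_biUnion_finset hdisj fun k _ => hSm k).symm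
    _ ≤ μ (Metric.ball 0 (1 + 1 / d)) := measure_mono hsub
    _ = ENNReal.ofReal ((1 + 1 / d) ^ d) * μ (Metric.ball 0 1) :=
      Measure.addHaar_ball_of_pos _ _ (by positivity)
    _ ≤ _ := by
      gcongr
      rw [show (3 : ENNReal) = ENNReal.ofReal 3 by simp]
      exact ENNReal.ofReal_le_ofReal h3

open Pointwise in
/-- A set whose points, together with the origin, are not separated in the direction `e` has
small probability on the sphere. -/
lemma sphereUniform_le {d : ℕ} (hd : 0 < d) {r : ℝ} (hr : 0 < r) {T : Set (Vec d)}
    (hT : MeasurableSet T) {e : Vec d} (he : ‖e‖ = 1) {N : ℕ} (hN : 0 < N)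
    (hsep : ∀ u ∈ insert 0 T, ∀ w ∈ insert 0 T, ‖w - u‖ ≤ 2 * inner ℝ e (w - u) →
      inner ℝ e (w - u) < r / (2 * d * N)) :
    sphereUniform d r T ≤ 3 / N := by
  have hd' : (1 : ℝ) ≤ d := by exact_mod_cast hd
  have hN' : (1 : ℝ) ≤ N := by exact_mod_cast hN
  have hfr : Module.finrank ℝ (Vec d) = d := finrank_euclideanSpace_fin
  -- The cone over `T` in the punctured open unit ball: its volume determines the spherical measure
  -- of `T`, and it can be translated.
  let A : Set (Vec d) := {p | p ≠ 0 ∧ ‖p‖ < 1 ∧ (r / ‖p‖) • p ∈ T}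
  have hA : MeasurableSet A := by
    refine (measurableSet_singleton 0).compl.inter ((measurableSet_lt measurable_norm
      measurable_const).inter ?_)
    exact ((measurable_const.div measurable_norm).smul measurable_id) hT
  have hsm : r / (2 * d * N) ≤ r / 2 := by
    apply div_le_div_of_nonneg_left hr.le (by norm_num)
    nlinarith
  -- Comparison with the origin: a point of the sphere inside the double cone around `e` would be
  -- separated from `0` by at least `r / 2`.
  have hcone : ∀ p ∈ A, |inner ℝ e p| ≤ ‖p‖ / 2 := by
    rintro p ⟨hp0, hp1, hpT⟩
    by_contra hc
    push Not at hc
    have hn : 0 < ‖p‖ := norm_pos_iff.2 hp0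
    have hnorm : ‖(r / ‖p‖) • p‖ = r := by
      rw [norm_smul, Real.norm_of_nonneg (by positivity), div_mul_cancel₀ _ hn.ne']
    have hin : inner ℝ e ((r / ‖p‖) • p) = r / ‖p‖ * inner ℝ e p := inner_smul_right _ _ _
    have hhalf : r / 2 ≤ r / ‖p‖ * |inner ℝ e p| := by
      rw [div_mul_eq_mul_div, div_le_div_iff₀ (by norm_num) hn]
      nlinarith
    rcases le_or_gt 0 (inner ℝ e p) with h | h
    · rw [abs_of_nonneg h] at hhalf
      have h1 := hsep 0 (by simp) _ (Set.mem_insert_of_mem _ hpT)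
      rw [sub_zero, hnorm, hin] at h1
      linarith [h1 (by linarith)]
    · rw [abs_of_neg h] at hhalf
      have h1 := hsep _ (Set.mem_insert_of_mem _ hpT) 0 (by simp)
      rw [zero_sub, norm_neg, hnorm, inner_neg_right, hin] at h1
      linarith [h1 (by linarith)]
  have hvol : N * (volume : Measure (Vec d)) A ≤ 3 * volume (Metric.ball (0 : Vec d) 1) := by
    refine card_mul_volume_le volume hA (fun p hp => by simpa using hp.2.1) he
      (c := 1 / (d * N)) (by positivity) (by rw [hfr]; exact hd) (le_of_eq ?_) ?_
    · rw [hfr]; field_simp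
    · intro p hp l hl hp'
      have hl0 : 0 < l := lt_of_lt_of_le (by positivity) hl
      obtain ⟨h1, h2⟩ := radial_separation he hl0 hr hp.1 hp'.1 hp'.2.1 (hcone p hp)
        (hcone _ hp')
      have h3 := hsep _ (Set.mem_insert_of_mem _ hp.2.2) _ (Set.mem_insert_of_mem _ hp'.2.2) h1
      have h4 : r / (2 * d * N) ≤ r * l / 2 := by
        calc r / (2 * d * N) = r * (1 / (d * N)) / 2 := by field_simp
          _ ≤ _ := by gcongr
      linarith
  set σ := (volume : Measure (Vec d)).toSphere with hσ
  have hmap : Measurable fun v : Metric.sphere (0 : Vec d) 1 => r • (v : Vec d) :=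
    measurable_subtype_coe.const_smul r
  rw [sphereUniform, Measure.map_apply hmap hT, Measure.smul_apply, smul_eq_mul,
    Measure.toSphere_apply_univ, Measure.toSphere_apply' _ (hmap hT), hfr]
  have hsub : Set.Ioo (0 : ℝ) 1 • (Subtype.val '' ((fun v : Metric.sphere (0 : Vec d) 1 =>
      r • (v : Vec d)) ⁻¹' T)) ⊆ A := by
    rintro p ⟨a, ⟨ha0, ha1⟩, -, ⟨v, hv, rfl⟩, rfl⟩
    have hv1 : ‖(v : Vec d)‖ = 1 := by simp
    have hn : ‖a • (v : Vec d)‖ = a := by rw [norm_smul, hv1, mul_one, Real.norm_of_nonneg ha0.le]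
    refine ⟨?_, ?_, ?_⟩
    · rw [← norm_pos_iff]; simp only [hn]; exact ha0
    · simp only [hn]; exact ha1
    · simp only [hn, smul_smul, div_mul_cancel₀ _ ha0.ne']; exact hv
  have hb0 : (volume : Measure (Vec d)) (Metric.ball 0 1) ≠ 0 :=
    (Metric.measure_ball_pos _ _ one_pos).ne'
  have hb1 : (volume : Measure (Vec d)) (Metric.ball 0 1) ≠ ⊤ := measure_ball_lt_top.ne
  have hd0 : (d : ENNReal) ≠ 0 := by exact_mod_cast hd.ne'
  have hN0 : (N : ENNReal) ≠ 0 := by exact_mod_cast hN.ne'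
  have hle : volume (Set.Ioo (0 : ℝ) 1 • (Subtype.val '' ((fun v : Metric.sphere (0 : Vec d) 1 =>
      r • (v : Vec d)) ⁻¹' T))) ≤ 3 / N * volume (Metric.ball (0 : Vec d) 1) := by
    refine (measure_mono hsub).trans ?_
    rw [← ENNReal.mul_div_right_comm, ENNReal.le_div_iff_mul_le (Or.inl hN0) (Or.inl (by simp)),
      mul_comm]
    exact hvol
  calc _ ≤ ((d : ENNReal) * volume (Metric.ball (0 : Vec d) 1))⁻¹
        * (d * (3 / N * volume (Metric.ball (0 : Vec d) 1))) := by gcongr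
    _ = ((d : ENNReal) * volume (Metric.ball (0 : Vec d) 1))⁻¹
        * (d * volume (Metric.ball (0 : Vec d) 1)) * (3 / N) := by ring
    _ = _ := by
      rw [ENNReal.inv_mul_cancel (mul_ne_zero hd0 hb0) (ENNReal.mul_ne_top (by simp) hb1), one_mul]

lemma isProbabilityMeasure_sphereUniform {d : ℕ} (hd : 0 < d) (r : ℝ) :
    IsProbabilityMeasure (sphereUniform d r) := by
  have hmap : Measurable fun v : Metric.sphere (0 : Vec d) 1 => r • (v : Vec d) :=
    measurable_subtype_coe.const_smul r
  have hfr : Module.finrank ℝ (Vec d) = d := finrank_euclideanSpace_fin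
  refine ⟨?_⟩
  rw [sphereUniform, Measure.map_apply hmap MeasurableSet.univ, Measure.smul_apply, smul_eq_mul,
    Set.preimage_univ, Measure.toSphere_apply_univ, hfr]
  refine ENNReal.inv_mul_cancel (mul_ne_zero (by exact_mod_cast hd.ne') ?_)
    (ENNReal.mul_ne_top (by simp) measure_ball_lt_top.ne)
  exact (Metric.measure_ball_pos _ _ one_pos).ne'

end sphere

/-! ### Trace inequalities -/

section trace

variable {d : ℕ}

/-- The trace of an operator. -/
def opTrace (T : Vec d →L[ℝ] Vec d) : ℝ := LinearMap.trace ℝ (Vec d) (T : Vec d →ₗ[ℝ] Vec d)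

lemma opTrace_eq_sum {ι : Type*} [Fintype ι] (b : OrthonormalBasis ι ℝ (Vec d))
    (T : Vec d →L[ℝ] Vec d) : opTrace T = ∑ i, inner ℝ (b i) (T (b i)) :=
  LinearMap.trace_eq_sum_inner _ b

lemma opTrace_add (S T : Vec d →L[ℝ] Vec d) : opTrace (S + T) = opTrace S + opTrace T := by
  simp [opTrace]

lemma opTrace_sub (S T : Vec d →L[ℝ] Vec d) : opTrace (S - T) = opTrace S - opTrace T := by
  simp [opTrace]

lemma opTrace_mul_comm (S T : Vec d →L[ℝ] Vec d) : opTrace (S * T) = opTrace (T * S) :=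
  LinearMap.trace_mul_comm ℝ (S : Vec d →ₗ[ℝ] Vec d) (T : Vec d →ₗ[ℝ] Vec d)

/-- The trace as a continuous linear functional. -/
def opTraceCLM (d : ℕ) : (Vec d →L[ℝ] Vec d) →L[ℝ] ℝ :=
  LinearMap.toContinuousLinearMap
    { toFun := opTrace
      map_add' := opTrace_add
      map_smul' := fun c T => by simp [opTrace] }

lemma opTraceCLM_apply (T : Vec d →L[ℝ] Vec d) : opTraceCLM d T = opTrace T := rfl

/-- A symmetric operator is diagonal in an orthonormal basis. -/
lemma exists_eigenbasis (S : Vec d →L[ℝ] Vec d)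
    (hS : ∀ v w, inner ℝ (S v) w = inner ℝ v (S w)) :
    ∃ (b : OrthonormalBasis (Fin d) ℝ (Vec d)) (lam : Fin d → ℝ), ∀ i, S (b i) = lam i • b i := by
  have h : (S : Vec d →ₗ[ℝ] Vec d).IsSymmetric := hS
  have hn : Module.finrank ℝ (Vec d) = d := finrank_euclideanSpace_fin
  exact ⟨h.eigenvectorBasis hn, h.eigenvalues hn, fun i => h.apply_eigenvectorBasis hn i⟩

lemma pow_apply_eigen {S : Vec d →L[ℝ] Vec d} {v : Vec d} {c : ℝ} (h : S v = c • v) (k : ℕ) :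
    (S ^ k) v = c ^ k • v := by
  induction k with
  | zero => simp
  | succ k ih => rw [pow_succ, mul_apply_eq_comp, h, map_smul, ih, smul_smul, pow_succ, mul_comm]

lemma opTrace_pow {S : Vec d →L[ℝ] Vec d} {b : OrthonormalBasis (Fin d) ℝ (Vec d)}
    {lam : Fin d → ℝ} (hb : ∀ i, S (b i) = lam i • b i) (k : ℕ) :
    opTrace (S ^ k) = ∑ i, lam i ^ k := by
  rw [opTrace_eq_sum b]
  refine Finset.sum_congr rfl fun i _ => ?_
  rw [pow_apply_eigen (hb i), inner_smul_right, real_inner_self_eq_norm_sq]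
  simp

/-- The norm is the largest absolute eigenvalue, and in an even power every eigenvalue contributes
nonnegatively. -/
lemma norm_pow_le_opTrace (hd : 0 < d) (S : Vec d →L[ℝ] Vec d)
    (hS : ∀ v w, inner ℝ (S v) w = inner ℝ v (S w)) (p : ℕ) :
    ‖S‖ ^ (2 * p) ≤ opTrace (S ^ (2 * p)) := by
  obtain ⟨b, lam, hb⟩ := exists_eigenbasis S hS
  have : Nonempty (Fin d) := ⟨⟨0, hd⟩⟩
  obtain ⟨i, -, hi⟩ := Finset.exists_max_image Finset.univ (fun i => |lam i|)
    Finset.univ_nonempty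
  have h1 : ‖S‖ ≤ |lam i| := S.opNorm_le_bound (abs_nonneg _)
    (norm_apply_le_of_diagonal b S lam hb (abs_nonneg _) fun j => hi j (Finset.mem_univ j))
  rw [opTrace_pow hb]
  calc ‖S‖ ^ (2 * p) ≤ |lam i| ^ (2 * p) := pow_le_pow_left₀ (norm_nonneg _) h1 _
    _ = lam i ^ (2 * p) := by rw [pow_mul, sq_abs, ← pow_mul]
    _ ≤ _ := Finset.single_le_sum (f := fun j => lam j ^ (2 * p))
        (fun j _ => (even_two_mul p).pow_nonneg _) (Finset.mem_univ i)

lemma opTrace_even_nonneg (S : Vec d →L[ℝ] Vec d)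
    (hS : ∀ v w, inner ℝ (S v) w = inner ℝ v (S w)) (p : ℕ) : 0 ≤ opTrace (S ^ (2 * p)) := by
  obtain ⟨b, lam, hb⟩ := exists_eigenbasis S hS
  rw [opTrace_pow hb]
  exact Finset.sum_nonneg fun i _ => (even_two_mul p).pow_nonneg _

/-- Expansion in two eigenbases reduces traces of products of noncommuting operators to scalar
expressions with the common weights `⟪eᵢ, fⱼ⟫²`. -/
lemma opTrace_pow_mul_pow {W Y : Vec d →L[ℝ] Vec d} {e f : OrthonormalBasis (Fin d) ℝ (Vec d)}
    {w y : Fin d → ℝ} (he : ∀ i, W (e i) = w i • e i) (hf : ∀ i, Y (f i) = y i • f i) (k l : ℕ) :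
    opTrace (W ^ k * Y ^ l) = ∑ i, ∑ j, w i ^ k * y j ^ l * inner ℝ (e i) (f j) ^ 2 := by
  rw [opTrace_eq_sum f, Finset.sum_comm]
  refine Finset.sum_congr rfl fun j _ => ?_
  rw [mul_apply_eq_comp, pow_apply_eigen (hf j), map_smul, inner_smul_right]
  have h1 : (W ^ k) (f j) = ∑ i, (inner ℝ (e i) (f j) * w i ^ k) • e i := by
    conv_lhs => rw [← e.sum_repr' (f j)]
    rw [map_sum]
    refine Finset.sum_congr rfl fun i _ => ?_
    rw [map_smul, pow_apply_eigen (he i), smul_smul]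
  rw [h1, inner_sum, Finset.mul_sum]
  refine Finset.sum_congr rfl fun i _ => ?_
  rw [inner_smul_right, real_inner_comm]
  ring

/-- Pair each term with its mirror image; each pair is bounded by the rearrangement `(|w|^q -
|y|^q)(|w|^s - |y|^s) ≥ 0`. -/
lemma sum_pow_mul_pow_le (w y : ℝ) (r : ℕ) :
    ∑ q ∈ Finset.range (2 * r + 1), w ^ q * y ^ (2 * r - q)
      ≤ (2 * r + 1) / 2 * (w ^ (2 * r) + y ^ (2 * r)) := by
  have hpair : ∀ q ∈ Finset.range (2 * r + 1),
      w ^ q * y ^ (2 * r - q) + w ^ (2 * r - q) * y ^ q ≤ w ^ (2 * r) + y ^ (2 * r) := by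
    intro q hq
    have hq := Finset.mem_range.1 hq
    obtain ⟨s, hs⟩ : ∃ s, 2 * r = q + s := ⟨2 * r - q, by omega⟩
    have e1 : 2 * r - q = s := by omega
    rw [e1]
    have h1 : ∀ v : ℝ, v ^ (2 * r) = |v| ^ q * |v| ^ s := fun v => by
      rw [← pow_add, ← hs, pow_mul, pow_mul, sq_abs]
    rw [h1, h1]
    have h2 : 0 ≤ (|w| ^ q - |y| ^ q) * (|w| ^ s - |y| ^ s) := by
      rcases le_total |w| |y| with h | h
      · exact mul_nonneg_of_nonpos_of_nonpos
          (sub_nonpos.2 (pow_le_pow_left₀ (abs_nonneg _) h _))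
          (sub_nonpos.2 (pow_le_pow_left₀ (abs_nonneg _) h _))
      · exact mul_nonneg (sub_nonneg.2 (pow_le_pow_left₀ (abs_nonneg _) h _))
          (sub_nonneg.2 (pow_le_pow_left₀ (abs_nonneg _) h _))
    have h3 : w ^ q * y ^ s ≤ |w| ^ q * |y| ^ s := by
      rw [← abs_pow, ← abs_pow, ← abs_mul]; exact le_abs_self _
    have h4 : w ^ s * y ^ q ≤ |w| ^ s * |y| ^ q := by
      rw [← abs_pow, ← abs_pow, ← abs_mul]; exact le_abs_self _
    linarith
  have hrefl : ∑ q ∈ Finset.range (2 * r + 1), w ^ (2 * r - q) * y ^ q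
      = ∑ q ∈ Finset.range (2 * r + 1), w ^ q * y ^ (2 * r - q) := by
    rw [← Finset.sum_range_reflect]
    refine Finset.sum_congr rfl fun q hq => ?_
    have hq := Finset.mem_range.1 hq
    rw [show 2 * r - (2 * r + 1 - 1 - q) = q by omega, show 2 * r + 1 - 1 - q = 2 * r - q by omega]
  have h := Finset.sum_le_sum hpair
  rw [Finset.sum_add_distrib, hrefl, Finset.sum_const, Finset.card_range, nsmul_eq_mul] at h
  push_cast at h
  linarith

lemma sub_mul_pow_sub_le (w y : ℝ) (r : ℕ) :
    (w - y) * (w ^ (2 * r + 1) - y ^ (2 * r + 1))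
      ≤ (2 * r + 1) / 2 * ((w - y) ^ 2 * w ^ (2 * r) + (w - y) ^ 2 * y ^ (2 * r)) := by
  have h := geom_sum₂_mul w y (2 * r + 1)
  rw [← h, Nat.add_sub_cancel]
  nlinarith [mul_le_mul_of_nonneg_left (sum_pow_mul_pow_le w y r) (sq_nonneg (w - y))]

/-- A mean value inequality for the trace of odd powers. -/
lemma opTrace_sub_mul_pow_sub_le (W Y : Vec d →L[ℝ] Vec d)
    (hW : ∀ v w, inner ℝ (W v) w = inner ℝ v (W w))
    (hY : ∀ v w, inner ℝ (Y v) w = inner ℝ v (Y w)) (r : ℕ) {K : ℝ} (hK : ‖W - Y‖ ≤ K) :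
    opTrace ((W - Y) * (W ^ (2 * r + 1) - Y ^ (2 * r + 1)))
      ≤ (2 * r + 1) / 2 * K ^ 2 * (opTrace (W ^ (2 * r)) + opTrace (Y ^ (2 * r))) := by
  obtain ⟨e, w, he⟩ := exists_eigenbasis W hW
  obtain ⟨f, y, hf⟩ := exists_eigenbasis Y hY
  set c : Fin d → Fin d → ℝ := fun i j => inner ℝ (e i) (f j) ^ 2 with hc
  have hc0 : ∀ i j, 0 ≤ c i j := fun i j => sq_nonneg _
  have hWY : ∀ k l, opTrace (W ^ k * Y ^ l) = ∑ i, ∑ j, w i ^ k * y j ^ l * c i j :=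
    opTrace_pow_mul_pow he hf
  have h1 : opTrace ((W - Y) * (W ^ (2 * r + 1) - Y ^ (2 * r + 1)))
      = ∑ i, ∑ j, (w i - y j) * (w i ^ (2 * r + 1) - y j ^ (2 * r + 1)) * c i j := by
    have e1 : (W - Y) * (W ^ (2 * r + 1) - Y ^ (2 * r + 1))
        = W ^ (2 * r + 2) * Y ^ 0 - W ^ 1 * Y ^ (2 * r + 1) - Y * W ^ (2 * r + 1)
          + W ^ 0 * Y ^ (2 * r + 2) := by
      rw [pow_succ' W (2 * r + 1), pow_succ' Y (2 * r + 1)]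
      simp only [pow_zero, pow_one, mul_one, one_mul, sub_mul, mul_sub]
      abel
    have e2 : opTrace (Y * W ^ (2 * r + 1)) = opTrace (W ^ (2 * r + 1) * Y ^ 1) := by
      rw [opTrace_mul_comm, pow_one]
    rw [e1, opTrace_add, opTrace_sub, opTrace_sub, e2, hWY, hWY, hWY, hWY]
    simp only [← Finset.sum_sub_distrib, ← Finset.sum_add_distrib]
    refine Finset.sum_congr rfl fun i _ => Finset.sum_congr rfl fun j _ => ?_
    ring
  have hD : ∀ i j, inner ℝ ((W - Y) (e i)) (f j) = (w i - y j) * inner ℝ (e i) (f j) := by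
    intro i j
    rw [sub_apply, inner_sub_left, hY, he, hf, inner_smul_left, inner_smul_right]
    simp only [conj_trivial]; ring
  have hDf : ∀ i j, inner ℝ (e i) ((W - Y) (f j)) = (w i - y j) * inner ℝ (e i) (f j) := by
    intro i j
    rw [sub_apply, inner_sub_right, ← hW, he, hf, inner_smul_left, inner_smul_right]
    simp only [conj_trivial]; ring
  have hK0 : 0 ≤ K := (norm_nonneg _).trans hK
  -- The weighted row and column sums are the squared norms of `W - Y` on the basis vectors, so the
  -- operator norm suffices and no Hilbert–Schmidt norm appears.
  have hrow : ∀ i, ∑ j, (w i - y j) ^ 2 * c i j ≤ K ^ 2 := by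
    intro i
    have : ∑ j, (w i - y j) ^ 2 * c i j = ‖(W - Y) (e i)‖ ^ 2 := by
      rw [← f.sum_sq_inner_left]
      exact Finset.sum_congr rfl fun j _ => by rw [hD, hc, mul_pow]
    rw [this]
    refine pow_le_pow_left₀ (norm_nonneg _) ?_ 2
    simpa using ((W - Y).le_opNorm (e i)).trans (mul_le_mul_of_nonneg_right hK (norm_nonneg _))
  have hcol : ∀ j, ∑ i, (w i - y j) ^ 2 * c i j ≤ K ^ 2 := by
    intro j
    have : ∑ i, (w i - y j) ^ 2 * c i j = ‖(W - Y) (f j)‖ ^ 2 := by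
      rw [← e.sum_sq_inner_right]
      exact Finset.sum_congr rfl fun i _ => by rw [hDf, hc, mul_pow]
    rw [this]
    refine pow_le_pow_left₀ (norm_nonneg _) ?_ 2
    simpa using ((W - Y).le_opNorm (f j)).trans (mul_le_mul_of_nonneg_right hK (norm_nonneg _))
  have h2 : ∑ i, ∑ j, (w i - y j) ^ 2 * w i ^ (2 * r) * c i j ≤ K ^ 2 * opTrace (W ^ (2 * r)) := by
    rw [opTrace_pow he, Finset.mul_sum]
    refine Finset.sum_le_sum fun i _ => ?_
    calc _ = (∑ j, (w i - y j) ^ 2 * c i j) * w i ^ (2 * r) := by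
          rw [Finset.sum_mul]; exact Finset.sum_congr rfl fun j _ => by ring
      _ ≤ _ := mul_le_mul_of_nonneg_right (hrow i) ((even_two_mul r).pow_nonneg _)
  have h3 : ∑ i, ∑ j, (w i - y j) ^ 2 * y j ^ (2 * r) * c i j ≤ K ^ 2 * opTrace (Y ^ (2 * r)) := by
    rw [opTrace_pow hf, Finset.mul_sum, Finset.sum_comm]
    refine Finset.sum_le_sum fun j _ => ?_
    calc _ = (∑ i, (w i - y j) ^ 2 * c i j) * y j ^ (2 * r) := by
          rw [Finset.sum_mul]; exact Finset.sum_congr rfl fun i _ => by ring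
      _ ≤ _ := mul_le_mul_of_nonneg_right (hcol j) ((even_two_mul r).pow_nonneg _)
  rw [h1]
  calc _ ≤ ∑ i, ∑ j, ((2 * r + 1) / 2 * ((w i - y j) ^ 2 * w i ^ (2 * r) * c i j
          + (w i - y j) ^ 2 * y j ^ (2 * r) * c i j)) := by
        refine Finset.sum_le_sum fun i _ => Finset.sum_le_sum fun j _ => ?_
        have := mul_le_mul_of_nonneg_right (sub_mul_pow_sub_le (w i) (y j) r) (hc0 i j)
        linarith
    _ = (2 * r + 1) / 2 * (∑ i, ∑ j, (w i - y j) ^ 2 * w i ^ (2 * r) * c i j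
          + ∑ i, ∑ j, (w i - y j) ^ 2 * y j ^ (2 * r) * c i j) := by
        simp only [← Finset.mul_sum, ← Finset.sum_add_distrib]
    _ ≤ (2 * r + 1) / 2 * (K ^ 2 * opTrace (W ^ (2 * r)) + K ^ 2 * opTrace (Y ^ (2 * r))) := by
        gcongr
    _ = _ := by ring

end trace

/-! ### Matrix concentration by trace moments -/

section concentration

variable {d : ℕ} {Ξ : Type*} [MeasurableSpace Ξ] (D : Measure Ξ) [IsProbabilityMeasure D]

lemma measurePreserving_comp_perm {ι : Type*} [Fintype ι] (σ : Equiv.Perm ι) :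
    MeasurePreserving (fun ω : ι → Ξ => ω ∘ σ) (Measure.pi fun _ : ι => D)
      (Measure.pi fun _ : ι => D) := by
  have hm : Measurable fun ω : ι → Ξ => ω ∘ σ :=
    measurable_pi_lambda _ fun i => measurable_pi_apply (σ i)
  refine ⟨hm, ?_⟩
  symm
  refine Measure.pi_eq fun s hs => ?_
  rw [Measure.map_apply hm (MeasurableSet.univ_pi hs)]
  have : (fun ω : ι → Ξ => ω ∘ σ) ⁻¹' Set.univ.pi s = Set.univ.pi fun i => s (σ.symm i) := by
    ext ω
    simp only [Set.mem_preimage, Set.mem_univ_pi, Function.comp_apply]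
    exact ⟨fun h i => by simpa using h (σ.symm i), fun h i => by simpa using h (σ i)⟩
  rw [this, Measure.pi_pi]
  exact Equiv.prod_comp σ.symm fun i => D (s i)

/-- The sum of the centered operators. -/
def centeredSum (X : Ξ → Vec d →L[ℝ] Vec d) (m : ℕ) (ξ : Fin m → Ξ) : Vec d →L[ℝ] Vec d :=
  ∑ i, (X (ξ i) - ∫ e, X e ∂D)

variable {D} {X : Ξ → Vec d →L[ℝ] Vec d} {L : ℝ}

lemma integrable_of_norm_le (hX : StronglyMeasurable X) (hL : ∀ e, ‖X e‖ ≤ L) : Integrable X D :=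
  Integrable.of_bound hX.aestronglyMeasurable L (Filter.Eventually.of_forall hL)

lemma norm_integral_operator_le (hL : ∀ e, ‖X e‖ ≤ L) : ‖∫ e, X e ∂D‖ ≤ L := by
  simpa using norm_integral_le_of_norm_le_const (Filter.Eventually.of_forall hL) (μ := D)

lemma integral_operator_symm (hX : StronglyMeasurable X) (hL : ∀ e, ‖X e‖ ≤ L)
    (hs : ∀ e v w, inner ℝ (X e v) w = inner ℝ v (X e w)) (v w : Vec d) :
    inner ℝ ((∫ e, X e ∂D) v) w = inner ℝ v ((∫ e, X e ∂D) w) := by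
  have hi := integrable_of_norm_le (D := D) hX hL
  rw [ContinuousLinearMap.integral_apply hi, ContinuousLinearMap.integral_apply hi,
    real_inner_comm, ← integral_inner (hi.apply_continuousLinearMap v),
    ← integral_inner (hi.apply_continuousLinearMap w)]
  refine integral_congr_ae (Filter.Eventually.of_forall fun e => ?_)
  simp only
  rw [real_inner_comm, hs]

lemma centeredSum_symm (hX : StronglyMeasurable X) (hL : ∀ e, ‖X e‖ ≤ L)
    (hs : ∀ e v w, inner ℝ (X e v) w = inner ℝ v (X e w)) (m : ℕ) (ξ : Fin m → Ξ) (v w : Vec d) :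
    inner ℝ (centeredSum D X m ξ v) w = inner ℝ v (centeredSum D X m ξ w) := by
  simp only [centeredSum, sum_apply, sub_apply, sum_inner, inner_sum, inner_sub_left,
    inner_sub_right, hs, integral_operator_symm hX hL hs]

lemma norm_centeredSum_le (hL : ∀ e, ‖X e‖ ≤ L) (m : ℕ) (ξ : Fin m → Ξ) :
    ‖centeredSum D X m ξ‖ ≤ m * (2 * L) := by
  calc _ ≤ ∑ i, ‖X (ξ i) - ∫ e, X e ∂D‖ := norm_sum_le _ _
    _ ≤ ∑ _i : Fin m, 2 * L := Finset.sum_le_sum fun i _ =>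
        (norm_sub_le _ _).trans (by linarith [hL (ξ i), norm_integral_operator_le (D := D) hL])
    _ = _ := by simp

lemma stronglyMeasurable_centeredSum {D : Measure Ξ} (hX : StronglyMeasurable X) (m : ℕ) :
    StronglyMeasurable (centeredSum D X m) := by
  unfold centeredSum
  exact Finset.stronglyMeasurable_fun_sum _ fun i _ =>
    (hX.comp_measurable (measurable_pi_apply i)).sub stronglyMeasurable_const

lemma integrable_opTrace {Ω : Type*} [MeasurableSpace Ω] {μ : Measure Ω} [IsFiniteMeasure μ]
    {Y : Ω → Vec d →L[ℝ] Vec d} (hY : StronglyMeasurable Y) {K : ℝ} (hK : ∀ ω, ‖Y ω‖ ≤ K) :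
    Integrable (fun ω => opTrace (Y ω)) μ :=
  (opTraceCLM d).integrable_comp
    (Integrable.of_bound hY.aestronglyMeasurable K (Filter.Eventually.of_forall hK))

lemma norm_pow_le_of_le {T : Vec d →L[ℝ] Vec d} {K : ℝ} (hd : 0 < d) (h : ‖T‖ ≤ K) (k : ℕ) :
    ‖T ^ k‖ ≤ K ^ k := by
  have : Nontrivial (Vec d) := Module.nontrivial_of_finrank_pos (R := ℝ) (by simpa using hd)
  exact (norm_pow_le T k).trans (pow_le_pow_left₀ (norm_nonneg _) h k)

/-- One step of the trace moment recursion, by exchanging one sample with a fresh one. -/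
lemma integral_opTrace_mul_le (hd : 0 < d) (hX : StronglyMeasurable X) (hL : ∀ e, ‖X e‖ ≤ L)
    (hs : ∀ e v w, inner ℝ (X e v) w = inner ℝ v (X e w)) {m : ℕ} (i : Fin m) (r : ℕ) :
    ∫ ξ, opTrace ((X (ξ i) - ∫ e, X e ∂D) * centeredSum D X m ξ ^ (2 * r + 1))
        ∂(Measure.pi fun _ : Fin m => D)
      ≤ (2 * r + 1) * (2 * L ^ 2) * ∫ ξ, opTrace (centeredSum D X m ξ ^ (2 * r))
        ∂(Measure.pi fun _ : Fin m => D) := by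
  set Xb := ∫ e, X e ∂D with hXb
  set S : (Fin m → Ξ) → Vec d →L[ℝ] Vec d := centeredSum D X m with hS
  set P := Measure.pi fun _ : Fin m => D
  set Q := Measure.pi fun _ : Fin (m + 1) => D with hQ
  have hSm : StronglyMeasurable S := stronglyMeasurable_centeredSum hX m
  have hSb : ∀ ξ, ‖S ξ‖ ≤ m * (2 * L) := norm_centeredSum_le hL m
  have hXbn : ‖Xb‖ ≤ L := norm_integral_operator_le hL
  have hSk : ∀ k, StronglyMeasurable fun ξ => S ξ ^ k := fun k => hSm.pow k
  have hSkb : ∀ k ξ, ‖S ξ ^ k‖ ≤ (m * (2 * L)) ^ k := fun k ξ => norm_pow_le_of_le hd (hSb ξ) k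
  -- passing to `m + 1` samples
  have htail : MeasurePreserving (fun ω : Fin (m + 1) → Ξ => (ω 0, fun j : Fin m => ω j.succ)) Q
      (D.prod P) := by
    have := measurePreserving_piFinSuccAbove (fun _ : Fin (m + 1) => D) 0
    exact this
  have htail_meas : Measurable fun ω : Fin (m + 1) → Ξ => fun j : Fin m => ω j.succ :=
    measurable_pi_lambda _ fun j => measurable_pi_apply _
  have hlift : ∀ g : Ξ × (Fin m → Ξ) → ℝ, StronglyMeasurable g →
      ∫ ω, g (ω 0, fun j => ω j.succ) ∂Q = ∫ q, g q ∂(D.prod P) := by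
    intro g hg
    rw [← htail.map_eq, integral_map htail.measurable.aemeasurable hg.aestronglyMeasurable]
  have hlift' : ∀ g : (Fin m → Ξ) → ℝ, StronglyMeasurable g →
      ∫ ω, g (fun j => ω j.succ) ∂Q = ∫ ξ, g ξ ∂P := by
    intro g hg
    have h1 := hlift (fun q => g q.2) (hg.comp_measurable measurable_snd)
    rw [h1, integral_fun_snd]
    simp
  have hopm : ∀ {Ω : Type _} [MeasurableSpace Ω] {Y : Ω → Vec d →L[ℝ] Vec d},
      StronglyMeasurable Y → StronglyMeasurable fun ω => opTrace (Y ω) := fun hY =>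
    (opTraceCLM d).continuous.comp_stronglyMeasurable hY
  let T : (Fin (m + 1) → Ξ) → Vec d →L[ℝ] Vec d := fun ω => S fun j => ω j.succ
  have hTm : StronglyMeasurable T := hSm.comp_measurable htail_meas
  have hTb : ∀ ω, ‖T ω‖ ≤ m * (2 * L) := fun ω => hSb _
  have hTk : ∀ k, StronglyMeasurable fun ω => T ω ^ k := fun k => hTm.pow k
  have hTkb : ∀ k ω, ‖T ω ^ k‖ ≤ (m * (2 * L)) ^ k := fun k ω => norm_pow_le_of_le hd (hTb ω) k
  have hXm : ∀ j : Fin (m + 1), StronglyMeasurable fun ω : Fin (m + 1) → Ξ => X (ω j) :=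
    fun j => hX.comp_measurable (measurable_pi_apply j)
  set k := 2 * r + 1 with hk
  have hint : ∀ j : Fin (m + 1), Integrable (fun ω => opTrace ((X (ω j) - Xb) * T ω ^ k)) Q := by
    intro j
    refine integrable_opTrace (((hXm j).sub stronglyMeasurable_const).mul (hTk k))
      (K := (2 * L) * (m * (2 * L)) ^ k) fun ω => ?_
    refine (norm_mul_le _ _).trans (mul_le_mul ?_ (hTkb k ω) (norm_nonneg _) ?_)
    · exact (norm_sub_le _ _).trans (by linarith [hL (ω j)])
    · linarith [(norm_nonneg _).trans hXbn]
  -- the fresh sample is independent of the sum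
  have hzero : ∫ ω, opTrace ((X (ω 0) - Xb) * T ω ^ k) ∂Q = 0 := by
    have hg : StronglyMeasurable fun q : Ξ × (Fin m → Ξ) =>
        opTrace ((X q.1 - Xb) * S q.2 ^ k) :=
      hopm (((hX.comp_measurable measurable_fst).sub stronglyMeasurable_const).mul
        ((hSk k).comp_measurable measurable_snd))
    have h1 := hlift _ hg
    simp only at h1
    change ∫ ω, opTrace ((X (ω 0) - Xb) * S (fun j => ω j.succ) ^ k) ∂Q = 0
    rw [h1, integral_prod_symm]
    · refine integral_eq_zero_of_ae (Filter.Eventually.of_forall fun ξ => ?_)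
      simp only [Pi.zero_apply]
      have hi := integrable_of_norm_le (D := D) hX hL
      let Φ : (Vec d →L[ℝ] Vec d) →L[ℝ] ℝ :=
        (opTraceCLM d).comp
          ((ContinuousLinearMap.compL ℝ (Vec d) (Vec d) (Vec d)).flip (S ξ ^ k))
      have h2 : ∀ e, opTrace ((X e - Xb) * S ξ ^ k) = Φ (X e - Xb) := fun e => rfl
      simp only [h2]
      have h3 := Φ.integral_comp_comm (hi.sub (integrable_const Xb))
      simp only [Pi.sub_apply] at h3
      rw [h3, integral_sub hi (integrable_const _)]
      simp [← hXb]
    · refine integrable_opTrace (((hX.comp_measurable measurable_fst).sub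
        stronglyMeasurable_const).mul ((hSk k).comp_measurable measurable_snd))
        (K := (2 * L) * (m * (2 * L)) ^ k) fun q => ?_
      refine (norm_mul_le _ _).trans (mul_le_mul ?_ (hSkb k q.2) (norm_nonneg _) ?_)
      · exact (norm_sub_le _ _).trans (by linarith [hL q.1])
      · linarith [(norm_nonneg _).trans hXbn]
  -- exchange of the `i`-th sample with the fresh one
  set σ : Equiv.Perm (Fin (m + 1)) := Equiv.swap 0 i.succ with hσ
  have hσp := measurePreserving_comp_perm D σ
  let T' : (Fin (m + 1) → Ξ) → Vec d →L[ℝ] Vec d := fun ω => T (ω ∘ σ)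
  have hTT' : ∀ ω, T ω - T' ω = X (ω i.succ) - X (ω 0) := by
    intro ω
    simp only [T, T', hS, centeredSum, ← Finset.sum_sub_distrib]
    rw [Finset.sum_eq_single i]
    · simp [hσ]
    · intro j _ hj
      have : σ j.succ = j.succ := by
        rw [hσ]
        exact Equiv.swap_apply_of_ne_of_ne (Fin.succ_ne_zero _) (by simpa using hj)
      simp [this]
    · simp
  have hT'm : StronglyMeasurable T' := hTm.comp_measurable hσp.measurable
  have hT'k : ∀ k, StronglyMeasurable fun ω => T' ω ^ k := fun k => hT'm.pow k
  have hT'kb : ∀ k ω, ‖T' ω ^ k‖ ≤ (m * (2 * L)) ^ k := fun k ω => hTkb k _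
  have hswap : ∀ g : (Fin (m + 1) → Ξ) → ℝ, StronglyMeasurable g →
      ∫ ω, g (ω ∘ σ) ∂Q = ∫ ω, g ω ∂Q := by
    intro g hg
    conv_rhs => rw [hQ, ← hσp.map_eq]
    rw [integral_map hσp.measurable.aemeasurable hg.aestronglyMeasurable]
  set I := ∫ ω, opTrace ((X (ω i.succ) - X (ω 0)) * T ω ^ k) ∂Q with hI
  have hdiffm : StronglyMeasurable fun ω : Fin (m + 1) → Ξ => X (ω i.succ) - X (ω 0) :=
    (hXm _).sub (hXm _)
  have hdiffb : ∀ ω : Fin (m + 1) → Ξ, ‖X (ω i.succ) - X (ω 0)‖ ≤ 2 * L := fun ω =>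
    (norm_sub_le _ _).trans (by linarith [hL (ω i.succ), hL (ω 0)])
  have hL0 : 0 ≤ L := (norm_nonneg _).trans hXbn
  have hI1 : ∫ ξ, opTrace ((X (ξ i) - Xb) * S ξ ^ k) ∂P = I := by
    have h1 := hlift' (fun ξ => opTrace ((X (ξ i) - Xb) * S ξ ^ k))
      (hopm (((hX.comp_measurable (measurable_pi_apply i)).sub stronglyMeasurable_const).mul
        (hSk k)))
    rw [← h1]
    change ∫ ω, opTrace ((X (ω i.succ) - Xb) * T ω ^ k) ∂Q = I
    rw [← sub_zero (∫ ω, opTrace ((X (ω i.succ) - Xb) * T ω ^ k) ∂Q), ← hzero,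
      ← integral_sub (hint _) (hint _), hI]
    refine integral_congr_ae (Filter.Eventually.of_forall fun ω => ?_)
    simp only
    rw [← opTrace_sub, ← sub_mul, sub_sub_sub_cancel_right]
  have hI2 : I = ∫ ω, opTrace ((X (ω 0) - X (ω i.succ)) * T' ω ^ k) ∂Q := by
    have h1 := hswap (fun ω => opTrace ((X (ω i.succ) - X (ω 0)) * T ω ^ k))
      (hopm (hdiffm.mul (hTk k)))
    rw [hI, ← h1]
    refine integral_congr_ae (Filter.Eventually.of_forall fun ω => ?_)
    simp [T', hσ]
  have hi1 : Integrable (fun ω => opTrace ((X (ω i.succ) - X (ω 0)) * T ω ^ k)) Q :=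
    integrable_opTrace (hdiffm.mul (hTk k)) (K := (2 * L) * (m * (2 * L)) ^ k) fun ω =>
      (norm_mul_le _ _).trans (mul_le_mul (hdiffb ω) (hTkb k ω) (norm_nonneg _) (by linarith))
  have hi2 : Integrable (fun ω => opTrace ((X (ω 0) - X (ω i.succ)) * T' ω ^ k)) Q :=
    integrable_opTrace (((hXm _).sub (hXm _)).mul (hT'k k)) (K := (2 * L) * (m * (2 * L)) ^ k)
      fun ω => (norm_mul_le _ _).trans (mul_le_mul (by rw [norm_sub_rev]; exact hdiffb ω)
        (hT'kb k ω) (norm_nonneg _) (by linarith))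
  have hi3 : Integrable (fun ω => opTrace (T ω ^ (2 * r))) Q :=
    integrable_opTrace (hTk _) (hTkb _)
  have hi4 : Integrable (fun ω => opTrace (T' ω ^ (2 * r))) Q :=
    integrable_opTrace (hT'k _) (hT'kb _)
  have hJ : ∫ ω, opTrace (T ω ^ (2 * r)) ∂Q = ∫ ξ, opTrace (S ξ ^ (2 * r)) ∂P :=
    hlift' (fun ξ => opTrace (S ξ ^ (2 * r))) (hopm (hSk _))
  have hJ' : ∫ ω, opTrace (T' ω ^ (2 * r)) ∂Q = ∫ ξ, opTrace (S ξ ^ (2 * r)) ∂P := by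
    rw [← hJ]
    exact hswap (fun ω => opTrace (T ω ^ (2 * r))) (hopm (hTk _))
  have hTs : ∀ ω v w, inner ℝ (T ω v) w = inner ℝ v (T ω w) := fun ω =>
    centeredSum_symm hX hL hs m _
  -- Adding `I` to its exchanged form produces the trace of `(T - T') * (T ^ k - T' ^ k)`, because
  -- `T - T'` is the difference of the exchanged samples. The trace mean value inequality then
  -- lowers the power by one on each side.
  have h2I : 2 * I ≤ (2 * r + 1) / 2 * (2 * L) ^ 2 * (2 * ∫ ξ, opTrace (S ξ ^ (2 * r)) ∂P) := by
    calc 2 * I = ∫ ω, (opTrace ((X (ω i.succ) - X (ω 0)) * T ω ^ k)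
            + opTrace ((X (ω 0) - X (ω i.succ)) * T' ω ^ k)) ∂Q := by
          rw [integral_add hi1 hi2, ← hI2, ← hI]; ring
      _ ≤ ∫ ω, ((2 * r + 1) / 2 * (2 * L) ^ 2
            * (opTrace (T ω ^ (2 * r)) + opTrace (T' ω ^ (2 * r)))) ∂Q := by
          refine integral_mono (hi1.add hi2) ((hi3.add hi4).const_mul _) fun ω => ?_
          simp only
          have h3 := opTrace_sub_mul_pow_sub_le (T ω) (T' ω) (hTs ω) (hTs _) r (K := 2 * L)
            (by rw [hTT']; exact hdiffb ω)
          rw [hTT'] at h3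
          refine le_trans (le_of_eq ?_) h3
          rw [← opTrace_add]
          congr 1
          simp only [sub_mul, mul_sub, hk]
          abel
      _ = _ := by
          rw [integral_const_mul, integral_add hi3 hi4, hJ, hJ']; ring
  rw [hI1]
  linarith

/-- Splitting one factor of the power into its summands sets up the recursion. The cap `P` makes the
factor of every step the same. -/
lemma integral_opTrace_pow_le (hd : 0 < d) (hX : StronglyMeasurable X) (hL : ∀ e, ‖X e‖ ≤ L)
    (hs : ∀ e v w, inner ℝ (X e v) w = inner ℝ v (X e w)) (m P : ℕ) {p : ℕ} (hp : p ≤ P) :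
    ∫ ξ, opTrace (centeredSum D X m ξ ^ (2 * p)) ∂(Measure.pi fun _ : Fin m => D)
      ≤ d * (4 * P * L ^ 2 * m) ^ p := by
  induction p with
  | zero =>
    have h1 : opTrace (1 : Vec d →L[ℝ] Vec d) = d := by
      rw [opTrace_eq_sum (EuclideanSpace.basisFun (Fin d) ℝ)]
      simp
    simp [h1]
  | succ p ih =>
    have ih := ih (by omega)
    have hSm : StronglyMeasurable (centeredSum D X m) := stronglyMeasurable_centeredSum hX m
    have hSb := norm_centeredSum_le (D := D) hL m
    have hsum : ∀ ξ : Fin m → Ξ, opTrace (centeredSum D X m ξ ^ (2 * (p + 1)))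
        = ∑ i, opTrace ((X (ξ i) - ∫ e, X e ∂D) * centeredSum D X m ξ ^ (2 * p + 1)) := by
      intro ξ
      rw [show 2 * (p + 1) = (2 * p + 1) + 1 by ring, pow_succ']
      change opTrace ((∑ i, (X (ξ i) - ∫ e, X e ∂D)) * _) = _
      rw [Finset.sum_mul, ← opTraceCLM_apply, map_sum]
      rfl
    have hnn : 0 ≤ ∫ ξ, opTrace (centeredSum D X m ξ ^ (2 * p))
        ∂(Measure.pi fun _ : Fin m => D) :=
      integral_nonneg fun ξ => opTrace_even_nonneg _ (centeredSum_symm hX hL hs m ξ) p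
    simp only [hsum]
    rw [integral_finsetSum]
    · calc _ ≤ ∑ _i : Fin m, ((2 * p + 1) * (2 * L ^ 2)
            * ∫ ξ, opTrace (centeredSum D X m ξ ^ (2 * p)) ∂(Measure.pi fun _ : Fin m => D)) :=
          Finset.sum_le_sum fun i _ => integral_opTrace_mul_le hd hX hL hs i p
        _ = ((2 * p + 1) * (2 * L ^ 2) * m)
            * ∫ ξ, opTrace (centeredSum D X m ξ ^ (2 * p)) ∂(Measure.pi fun _ : Fin m => D) := by
          simp; ring
        _ ≤ (4 * P * L ^ 2 * m) * (d * (4 * P * L ^ 2 * m) ^ p) := by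
          refine mul_le_mul ?_ ih hnn (by positivity)
          have h1 : (p : ℝ) + 1 ≤ P := by exact_mod_cast hp
          have h2 : 0 ≤ L ^ 2 * m := by positivity
          nlinarith
        _ = _ := by ring
    · intro i _
      have hXm : StronglyMeasurable fun ξ : Fin m → Ξ => X (ξ i) :=
        hX.comp_measurable (measurable_pi_apply i)
      refine integrable_opTrace ((hXm.sub stronglyMeasurable_const).mul (hSm.pow _))
        (K := (2 * L) * (m * (2 * L)) ^ (2 * p + 1)) fun ξ => ?_
      have hXbn : ‖∫ e, X e ∂D‖ ≤ L := norm_integral_operator_le hL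
      refine (norm_mul_le _ _).trans (mul_le_mul ?_ (norm_pow_le_of_le hd (hSb ξ) _)
        (norm_nonneg _) ?_)
      · exact (norm_sub_le _ _).trans (by linarith [hL (ξ i)])
      · linarith [(norm_nonneg _).trans hXbn]

/-- Concentration of an average of independent bounded symmetric operators in operator norm. -/
lemma measure_norm_average_sub_le (hd : 0 < d) (hX : StronglyMeasurable X)
    (hL0 : 0 < L) (hL : ∀ e, ‖X e‖ ≤ L)
    (hs : ∀ e v w, inner ℝ (X e v) w = inner ℝ v (X e w)) {δ ε : ℝ} (hδ : 0 < δ)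
    (hδ1 : δ ≤ 1 / 100) (hε : 0 < ε) {m : ℕ}
    (hm : 16 * L ^ 2 * Real.log (6 * d / δ) ≤ m * ε ^ 2) :
    (Measure.pi fun _ : Fin m => D) {ξ | ε < ‖(m : ℝ)⁻¹ • ∑ i, X (ξ i) - ∫ e, X e ∂D‖}
      ≤ ENNReal.ofReal (δ / 6) := by
  have hd1 : (1 : ℝ) ≤ d := by exact_mod_cast hd
  set l := Real.log (6 * d / δ) with hl
  have hl6 : 6 ≤ l := by
    rw [hl, Real.le_log_iff_exp_le (by positivity)]
    have h1 : Real.exp 6 ≤ 600 := by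
      have : Real.exp 6 = Real.exp 1 ^ 6 := by rw [← Real.exp_nat_mul]; norm_num
      rw [this]
      calc Real.exp 1 ^ 6 ≤ 2.72 ^ 6 :=
            pow_le_pow_left₀ (Real.exp_pos _).le (by linarith [Real.exp_one_lt_d9]) 6
        _ ≤ _ := by norm_num
    refine h1.trans ?_
    rw [le_div_iff₀ hδ]
    nlinarith
  -- The moment order is the logarithm of the inverse target probability, so that Markov's
  -- inequality leaves `d * exp (-p) ≤ δ / 6`.
  set p := ⌈l⌉₊ with hp
  have hlp : l ≤ p := Nat.le_ceil l
  have hpl : (p : ℝ) < l + 1 := Nat.ceil_lt_add_one (by linarith)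
  have hm0 : 0 < m := by
    rcases Nat.eq_zero_or_pos m with rfl | h
    · have : 0 < 16 * L ^ 2 * l := by positivity
      simp only [Nat.cast_zero, zero_mul] at hm
      linarith
    · exact h
  have hm' : (0 : ℝ) < m := by exact_mod_cast hm0
  set S := centeredSum D X m with hS
  have hnorm : ∀ ξ : Fin m → Ξ, ‖(m : ℝ)⁻¹ • ∑ i, X (ξ i) - ∫ e, X e ∂D‖ = (m : ℝ)⁻¹ * ‖S ξ‖ := by
    intro ξ
    have : (m : ℝ)⁻¹ • ∑ i, X (ξ i) - ∫ e, X e ∂D = (m : ℝ)⁻¹ • S ξ := by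
      rw [hS, centeredSum, Finset.sum_sub_distrib, smul_sub]
      congr 1
      rw [Finset.sum_const, Finset.card_univ, Fintype.card_fin, ← Nat.cast_smul_eq_nsmul ℝ,
        smul_smul, inv_mul_cancel₀ hm'.ne', one_smul]
    rw [this, norm_smul, norm_inv, Real.norm_natCast]
  have hsub : {ξ : Fin m → Ξ | ε < ‖(m : ℝ)⁻¹ • ∑ i, X (ξ i) - ∫ e, X e ∂D‖}
      ⊆ {ξ | (m * ε) ^ (2 * p) ≤ opTrace (S ξ ^ (2 * p))} := by
    intro ξ hξ
    simp only [Set.mem_ofPred_eq, hnorm] at hξ ⊢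
    rw [lt_inv_mul_iff₀ hm'] at hξ
    exact (pow_le_pow_left₀ (by positivity) hξ.le _).trans
      (norm_pow_le_opTrace hd _ (centeredSum_symm hX hL hs m ξ) p)
  have hint : Integrable (fun ξ => opTrace (S ξ ^ (2 * p))) (Measure.pi fun _ : Fin m => D) :=
    integrable_opTrace ((stronglyMeasurable_centeredSum hX m).pow _)
      fun ξ => norm_pow_le_of_le hd (norm_centeredSum_le hL m ξ) _
  have hmarkov := mul_meas_ge_le_integral_of_nonneg
    (Filter.Eventually.of_forall fun ξ =>
      opTrace_even_nonneg _ (centeredSum_symm hX hL hs m ξ) p) hint ((m * ε) ^ (2 * p))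
  have hmom := integral_opTrace_pow_le (D := D) hd hX hL hs m p le_rfl
  refine (measure_mono hsub).trans ?_
  rw [← ofReal_measureReal]
  refine ENNReal.ofReal_le_ofReal ?_
  have hpos : 0 < ((m : ℝ) * ε) ^ (2 * p) := by positivity
  have h1 := hmarkov.trans hmom
  -- As `p < l + 1` and `l ≥ 6`, the constant `16` in the batch size leaves room for the factor `exp
  -- (-1)` in each of the `p` factors.
  have h2 : (4 * p * L ^ 2 * m) ^ p ≤ Real.exp (-p) * (m * ε) ^ (2 * p) := by
    have h3 : Real.exp (-(p : ℝ)) = Real.exp (-1) ^ p := by rw [← Real.exp_nat_mul]; simp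
    rw [h3, pow_mul, ← mul_pow]
    refine pow_le_pow_left₀ (by positivity) ?_ _
    have h4 : (0.36 : ℝ) ≤ Real.exp (-1) := by linarith [Real.exp_neg_one_gt_d9]
    have h5 : 0 ≤ ((m : ℝ) * ε) ^ 2 := by positivity
    have h6 : 4 * p * L ^ 2 * m ≤ 0.36 * (m * ε) ^ 2 := by
      have h7 := mul_le_mul_of_nonneg_left hm hm'.le
      have h8 : 4 * (p : ℝ) ≤ 0.36 * (16 * l) := by linarith
      have h9 := mul_le_mul_of_nonneg_right h8 (by positivity : 0 ≤ L ^ 2 * m)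
      linarith
    nlinarith
  have h10 : d * Real.exp (-(p : ℝ)) ≤ δ / 6 := by
    have h11 : Real.exp (-(p : ℝ)) ≤ Real.exp (-l) := Real.exp_le_exp.2 (by linarith)
    have h12 : Real.exp (-l) = δ / (6 * d) := by
      rw [Real.exp_neg, hl, Real.exp_log (by positivity), inv_div]
    rw [h12] at h11
    calc _ ≤ d * (δ / (6 * d)) := mul_le_mul_of_nonneg_left h11 (by positivity)
      _ = _ := by field_simp
  refine le_of_mul_le_mul_left ?_ hpos
  calc _ ≤ _ := h1
    _ ≤ d * (Real.exp (-p) * (m * ε) ^ (2 * p)) := mul_le_mul_of_nonneg_left h2 (by positivity)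
    _ = (m * ε) ^ (2 * p) * (d * Real.exp (-p)) := by ring
    _ ≤ _ := mul_le_mul_of_nonneg_left h10 hpos.le

end concentration

/-! ### Measurability, and the Hessian of the expectation -/

section measurability

variable {d : ℕ} {Ξ : Type*} [MeasurableSpace Ξ] {L₁ L₂ : ℝ} {f : Vec d → Ξ → ℝ}

lemma smoothFun_zero (hL₁ : 0 ≤ L₁) (hL₂ : 0 ≤ L₂) : SmoothFun L₁ L₂ (fun _ : Vec d => (0 : ℝ)) := by
  have hg : gradient (fun _ : Vec d => (0 : ℝ)) = fun _ => 0 := by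
    ext1 z; simp [gradient]
  have hh : ∀ z, hessian (fun _ : Vec d => (0 : ℝ)) z = 0 := fun z => by
    rw [hessian, hg]; simp
  refine ⟨differentiable_const _, by rw [hg]; exact differentiable_const _, fun y z => ?_,
    fun y z => ?_⟩
  · rw [hg]; simpa using by positivity
  · rw [hh, hh]; simpa using by positivity

/-- A family of continuous functions, integrable at each point, can be made measurable by
changing it on a null set of parameters. -/
lemma exists_measurable_version {D : Measure Ξ} (hL₁ : 0 ≤ L₁) (hL₂ : 0 ≤ L₂)
    (hint : ∀ z, Integrable (f z) D) (hf : ∀ e, SmoothFun L₁ L₂ (fun z => f z e)) :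
    ∃ f' : Vec d → Ξ → ℝ, (∀ z, Measurable (f' z)) ∧
      (∀ e, SmoothFun L₁ L₂ (fun z => f' z e)) ∧ ∀ᵐ e ∂D, ∀ z, f' z e = f z e := by
  classical
  let q : ℕ → Vec d := TopologicalSpace.denseSeq (Vec d)
  have hmk : ∀ n, f (q n) =ᵐ[D] (hint (q n)).1.mk (f (q n)) := fun n => (hint (q n)).1.ae_eq_mk
  let N : Set Ξ := toMeasurable D {e | ¬ ∀ n, f (q n) e = (hint (q n)).1.mk (f (q n)) e}
  have hN0 : D N = 0 := by
    rw [measure_toMeasurable]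
    exact ae_all_iff.2 hmk
  have hNm : MeasurableSet N := measurableSet_toMeasurable _ _
  have hNc : ∀ e ∉ N, ∀ n, f (q n) e = (hint (q n)).1.mk (f (q n)) e := by
    intro e he
    by_contra hc
    exact he (subset_toMeasurable _ _ hc)
  -- Zero on the exceptional set keeps every member smooth. Measurability is then checked on a dense
  -- sequence and passes to all points by continuity in `z`.
  let f' : Vec d → Ξ → ℝ := fun z e => if e ∈ N then 0 else f z e
  have hsm : ∀ e, SmoothFun L₁ L₂ (fun z => f' z e) := by
    intro e
    by_cases he : e ∈ N
    · simpa [f', he] using smoothFun_zero hL₁ hL₂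
    · simpa [f', he] using hf e
  refine ⟨f', ?_, hsm, ?_⟩
  · have hq : ∀ n, Measurable (f' (q n)) := by
      intro n
      have : f' (q n) = N.piecewise (fun _ => 0) ((hint (q n)).1.mk (f (q n))) := by
        ext e
        by_cases he : e ∈ N
        · simp [f', he]
        · simp [f', he, hNc e he n]
      rw [this]
      exact Measurable.piecewise hNm measurable_const
        (hint (q n)).1.stronglyMeasurable_mk.measurable
    intro z
    have hz : z ∈ closure (Set.range q) := (TopologicalSpace.denseRange_denseSeq (Vec d)) z
    obtain ⟨u, hu, hlim⟩ := mem_closure_iff_seq_limit.1 hz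
    choose k hk using hu
    refine measurable_of_tendsto_metrizable (f := fun n => f' (u n))
      (fun n => by rw [← hk n]; exact hq _) ?_
    rw [tendsto_pi_nhds]
    intro e
    exact (((hsm e).1.continuous.tendsto z).comp hlim)
  · have : ∀ᵐ e ∂D, e ∉ N := measure_eq_zero_iff_ae_notMem.1 hN0
    filter_upwards [this] with e he z
    simp [f', he]

/-- A directional derivative is a pointwise limit of difference quotients along `1 / n`. -/
lemma stronglyMeasurable_fderiv_apply {W : Type*} [NormedAddCommGroup W] [NormedSpace ℝ W]
    {φ : Vec d → Ξ → W} (hφ : ∀ z, StronglyMeasurable (φ z))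
    (hd : ∀ e, Differentiable ℝ fun z => φ z e) (z v : Vec d) :
    StronglyMeasurable fun e => fderiv ℝ (fun w => φ w e) z v := by
  refine stronglyMeasurable_of_tendsto Filter.atTop
    (f := fun (n : ℕ) e => (n : ℝ) • (φ (z + (n : ℝ)⁻¹ • v) e - φ z e)) (fun n => ?_) ?_
  · exact ((hφ _).sub (hφ _)).const_smul _
  · rw [tendsto_pi_nhds]
    intro e
    exact ((hd e z).hasFDerivAt.lim_real v).comp tendsto_natCast_atTop_atTop

lemma stronglyMeasurable_gradient (hm : ∀ z, Measurable (f z))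
    (hf : ∀ e, SmoothFun L₁ L₂ (fun z => f z e)) (z : Vec d) :
    StronglyMeasurable fun e => gradient (fun w => f w e) z := by
  let b := EuclideanSpace.basisFun (Fin d) ℝ
  have : (fun e => gradient (fun w => f w e) z)
      = fun e => ∑ j, (fderiv ℝ (fun w => f w e) z (b j)) • b j := by
    ext1 e
    rw [← b.sum_repr' (gradient (fun w => f w e) z)]
    refine Finset.sum_congr rfl fun j _ => ?_
    rw [fderiv_eq_toDual_gradient, InnerProductSpace.toDual_apply_apply, real_inner_comm]
  rw [this]
  exact Finset.stronglyMeasurable_fun_sum _ fun j _ =>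
    (stronglyMeasurable_fderiv_apply (fun z => (hm z).stronglyMeasurable)
      (fun e => (hf e).1) z (b j)).smul_const _

lemma measurable_gradient_uncurry (hm : ∀ z, Measurable (f z))
    (hf : ∀ e, SmoothFun L₁ L₂ (fun z => f z e)) :
    Measurable fun q : Vec d × Ξ => gradient (fun w => f w q.2) q.1 :=
  measurable_uncurry_of_continuous_of_measurable
    (u := fun z e => gradient (fun w => f w e) z) (fun e => (hf e).2.1.continuous)
    fun z => (stronglyMeasurable_gradient hm hf z).measurable

lemma stronglyMeasurable_hessian (hm : ∀ z, Measurable (f z))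
    (hf : ∀ e, SmoothFun L₁ L₂ (fun z => f z e)) (z : Vec d) :
    StronglyMeasurable fun e => hessian (fun w => f w e) z := by
  let b := EuclideanSpace.basisFun (Fin d) ℝ
  have : (fun e => hessian (fun w => f w e) z)
      = fun e => ∑ j, ContinuousLinearMap.smulRightL ℝ (Vec d) (Vec d) (innerSL ℝ (b j))
        (fderiv ℝ (gradient fun w => f w e) z (b j)) := by
    ext1 e
    refine ContinuousLinearMap.ext fun v => ?_
    conv_lhs => rw [← b.sum_repr' v]
    simp [hessian, sum_apply]
  rw [this]
  refine Finset.stronglyMeasurable_fun_sum _ fun j _ =>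
    (ContinuousLinearMap.continuous _).comp_stronglyMeasurable ?_
  exact stronglyMeasurable_fderiv_apply (φ := fun z e => gradient (fun w => f w e) z)
    (stronglyMeasurable_gradient hm hf) (fun e => (hf e).2.1) z (b j)

lemma hasFDerivAt_of_quadratic_bound {W : Type*} [NormedAddCommGroup W] [NormedSpace ℝ W]
    {φ : Vec d → W} {A : Vec d →L[ℝ] W} {z : Vec d} {K : ℝ}
    (h : ∀ w, ‖φ w - φ z - A (w - z)‖ ≤ K * ‖w - z‖ ^ 2) : HasFDerivAt φ A z := by
  rw [hasFDerivAt_iff_isLittleO]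
  refine Asymptotics.IsBigO.trans_isLittleO (Asymptotics.IsBigO.of_bound K
    (Filter.Eventually.of_forall fun w => ?_)) (Asymptotics.isLittleO_pow_sub_sub z one_lt_two)
  simpa using h w

/-- The Taylor remainders are quadratic uniformly in the sample, so they survive integration and
identify the derivatives of the expectation directly. -/
lemma hessian_integral {D : Measure Ξ} [IsProbabilityMeasure D] (hL₁ : 0 ≤ L₁) (hL₂ : 0 ≤ L₂)
    (hm : ∀ z, Measurable (f z)) (hint : ∀ z, Integrable (f z) D)
    (hf : ∀ e, SmoothFun L₁ L₂ (fun z => f z e)) (x : Vec d) :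
    hessian (fun z => ∫ e, f z e ∂D) x = ∫ e, hessian (fun w => f w e) x ∂D := by
  have hgint : ∀ z, Integrable (fun e => gradient (fun w => f w e) z) D := by
    intro z
    let b := EuclideanSpace.basisFun (Fin d) ℝ
    have : (fun e => gradient (fun w => f w e) z)
        = fun e => ∑ j, (inner ℝ (gradient (fun w => f w e) z) (b j)) • b j := by
      ext1 e
      conv_lhs => rw [← b.sum_repr' (gradient (fun w => f w e) z)]
      exact Finset.sum_congr rfl fun j _ => by rw [real_inner_comm]
    rw [this]
    refine integrable_finsetSum _ fun j _ => Integrable.smul_const ?_ _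
    -- Gradients are not assumed integrable: each coordinate is dominated by two function values and
    -- the Taylor error at distance one.
    refine Integrable.mono' (g := fun e => |f (z + b j) e| + |f z e| + L₁)
      (((hint _).abs.add (hint _).abs).add (integrable_const _)) ?_
      (Filter.Eventually.of_forall fun e => ?_)
    · exact ((stronglyMeasurable_gradient hm hf z).inner
        stronglyMeasurable_const).aestronglyMeasurable
    · have h1 := (hf e).taylor_one hL₁ z (z + b j)
      simp only [add_sub_cancel_left, OrthonormalBasis.norm_eq_one, one_pow, mul_one] at h1
      rw [Real.norm_eq_abs, abs_le]
      obtain ⟨h2, h3⟩ := abs_le.1 h1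
      obtain ⟨h4, h5⟩ := abs_le.1 (le_refl |f (z + b j) e|)
      obtain ⟨h6, h7⟩ := abs_le.1 (le_refl |f z e|)
      constructor <;> linarith
  have hhint : Integrable (fun e => hessian (fun w => f w e) x) D :=
    Integrable.of_bound (stronglyMeasurable_hessian hm hf x).aestronglyMeasurable L₁
      (Filter.Eventually.of_forall fun e => (hf e).norm_hessian_le hL₁ x)
  have hgrad : gradient (fun z => ∫ e, f z e ∂D) = fun z => ∫ e, gradient (fun w => f w e) z ∂D := by
    ext1 z
    refine HasGradientAt.gradient ?_
    rw [hasGradientAt_iff_hasFDerivAt]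
    refine hasFDerivAt_of_quadratic_bound (K := L₁) fun w => ?_
    have h1 : (∫ e, f w e ∂D) - (∫ e, f z e ∂D)
        - InnerProductSpace.toDual ℝ (Vec d) (∫ e, gradient (fun w => f w e) z ∂D) (w - z)
        = ∫ e, (f w e - f z e - inner ℝ (gradient (fun w => f w e) z) (w - z)) ∂D := by
      have h0 := integral_sub ((hint w).sub (hint z)) ((hgint z).inner_const (w - z))
      simp only [Pi.sub_apply] at h0
      rw [h0, integral_sub (hint w) (hint z), InnerProductSpace.toDual_apply_apply, real_inner_comm,
        ← integral_inner (hgint z)]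
      congr 1
      exact integral_congr_ae (Filter.Eventually.of_forall fun e => real_inner_comm _ _)
    rw [h1]
    have h2 := norm_integral_le_of_norm_le_const (μ := D)
      (f := fun e => f w e - f z e - inner ℝ (gradient (fun w => f w e) z) (w - z))
      (Filter.Eventually.of_forall fun e => (hf e).taylor_one hL₁ z w)
    simpa using h2
  refine HasFDerivAt.fderiv ?_
  rw [hgrad]
  refine hasFDerivAt_of_quadratic_bound (K := L₂) fun w => ?_
  have h1 : (∫ e, gradient (fun w => f w e) w ∂D) - (∫ e, gradient (fun w => f w e) x ∂D)
      - (∫ e, hessian (fun w => f w e) x ∂D) (w - x)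
      = ∫ e, (gradient (fun w => f w e) w - gradient (fun w => f w e) x
        - hessian (fun w => f w e) x (w - x)) ∂D := by
    have h0 := integral_sub ((hgint w).sub (hgint x)) (hhint.apply_continuousLinearMap (w - x))
    simp only [Pi.sub_apply] at h0
    rw [h0, integral_sub (hgint w) (hgint x), ContinuousLinearMap.integral_apply hhint]
  rw [h1]
  have h2 := norm_integral_le_of_norm_le_const (μ := D)
    (f := fun e => gradient (fun w => f w e) w - gradient (fun w => f w e) x
        - hessian (fun w => f w e) x (w - x)) (C := L₂ * ‖w - x‖ * ‖w - x‖)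
    (Filter.Eventually.of_forall fun e =>
      (hf e).taylor_gradient hL₂ x (u := x) (v := w) (R := ‖w - x‖) (by simp) le_rfl)
  simp only [probReal_univ, mul_one] at h2
  linarith

end measurability

/-! ### From trapped trajectories to failure probabilities -/

section sample

variable {d m : ℕ} {Ξ : Type*} {L₁ L₂ : ℝ} {f : Vec d → Ξ → ℝ}

/-- The gradient of `ĝ` for the mini-batch `ξ`. -/
def sampleGrad (f : Vec d → Ξ → ℝ) (x : Vec d) (ξ : Fin m → Ξ) (u : Vec d) : Vec d :=
  (avgAns (ifo f ξ) (x + u)).2 - (avgAns (ifo f ξ) x).2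

/-- The function `ĝ` for the mini-batch `ξ`. -/
def sampleFun (f : Vec d → Ξ → ℝ) (x : Vec d) (ξ : Fin m → Ξ) (u : Vec d) : ℝ :=
  gHat (avgAns (ifo f ξ) x) u (avgAns (ifo f ξ) (x + u)).1

/-- The Hessian at `x` of the average over the mini-batch `ξ`. -/
def sampleHess (f : Vec d → Ξ → ℝ) (x : Vec d) (ξ : Fin m → Ξ) : Vec d →L[ℝ] Vec d :=
  (m : ℝ)⁻¹ • ∑ i, hessian (fun w => f w (ξ i)) x

/-- Everything deterministic is proved for `LocalModel`; this is its only entry point for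
mini-batches. -/
lemma sample_localModel (hm : 0 < m) (hL₁ : 0 ≤ L₁) (hL₂ : 0 ≤ L₂)
    (hf : ∀ e, SmoothFun L₁ L₂ (fun z => f z e)) (x : Vec d) (ξ : Fin m → Ξ) :
    LocalModel L₁ L₂ (sampleFun f x ξ) (sampleGrad f x ξ) (sampleHess f x ξ) := by
  obtain ⟨h1, h2, h3⟩ := SmoothFun.sum_smul (fun i z => f z (ξ i)) hm fun i => hf (ξ i)
  have hans : ∀ z, avgAns (ifo f ξ) z = ((m : ℝ)⁻¹ * ∑ i, f z (ξ i),
      gradient (fun z => (m : ℝ)⁻¹ * ∑ i, f z (ξ i)) z) := by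
    intro z
    rw [h2]
    simp only [avgAns, ifo, Prod.ext_iff, Prod.smul_fst, Prod.smul_snd, Prod.fst_sum,
      Prod.snd_sum, smul_eq_mul, and_self]
  have key := h1.localModel hL₁ hL₂ x
  rw [h3] at key
  convert key using 1
  · ext u; simp only [sampleFun, hans]
  · ext1 u; simp only [sampleGrad, hans]
  · rfl

variable [MeasurableSpace Ξ]

lemma measurable_sampleGrad (hmeas : ∀ z, Measurable (f z))
    (hf : ∀ e, SmoothFun L₁ L₂ (fun z => f z e)) (x : Vec d) :
    Measurable fun q : (Fin m → Ξ) × Vec d => sampleGrad f x q.1 q.2 := by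
  have hG := measurable_gradient_uncurry hmeas hf
  have key : ∀ φ : (Fin m → Ξ) × Vec d → Vec d, Measurable φ →
      Measurable fun q : (Fin m → Ξ) × Vec d => (avgAns (ifo f q.1) (φ q)).2 := by
    intro φ hφ
    simp only [avgAns, ifo, Prod.smul_snd, Prod.snd_sum]
    have h1 : ∀ i : Fin m, Measurable fun q : (Fin m → Ξ) × Vec d =>
        gradient (fun w => f w (q.1 i)) (φ q) := fun i =>
      hG.comp (hφ.prodMk ((measurable_pi_apply i).comp measurable_fst))
    have h2 : Measurable fun q : (Fin m → Ξ) × Vec d =>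
        ∑ i, gradient (fun w => f w (q.1 i)) (φ q) :=
      Finset.measurable_fun_sum _ fun i _ => h1 i
    exact h2.const_smul (m : ℝ)⁻¹
  have h1 : Measurable fun q : (Fin m → Ξ) × Vec d => x + q.2 := by fun_prop
  exact Measurable.sub (key _ h1) (key (fun _ => x) measurable_const)

lemma measurable_iterate {Ω Y : Type*} [MeasurableSpace Ω] [MeasurableSpace Y] {S : Ω → Y → Y}
    (hS : Measurable fun q : Ω × Y => S q.1 q.2) (k : ℕ) :
    Measurable fun q : Ω × Y => (S q.1)^[k] q.2 := by
  induction k with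
  | zero => exact measurable_snd
  | succ k ih =>
    simp only [Function.iterate_succ_apply']
    exact hS.comp (measurable_fst.prodMk ih)

lemma measurable_gd_iterate (hmeas : ∀ z, Measurable (f z))
    (hf : ∀ e, SmoothFun L₁ L₂ (fun z => f z e)) (x : Vec d) (η : ℝ) (k : ℕ) :
    Measurable fun q : (Fin m → Ξ) × Vec d => (gdStep η (sampleGrad f x q.1))^[k] q.2 :=
  measurable_iterate (S := fun ξ : Fin m → Ξ => gdStep η (sampleGrad f x ξ))
    (measurable_snd.sub ((measurable_sampleGrad hmeas hf x).const_smul η)) k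

lemma measurable_agd_iterate (hmeas : ∀ z, Measurable (f z))
    (hf : ∀ e, SmoothFun L₁ L₂ (fun z => f z e)) (x : Vec d) (η ζ : ℝ) (k : ℕ) :
    Measurable fun q : (Fin m → Ξ) × Vec d =>
      ((agdStep η ζ (sampleGrad f x q.1))^[k] (q.2, q.2)).1 := by
  have hS : Measurable fun q : (Fin m → Ξ) × (Vec d × Vec d) =>
      agdStep η ζ (sampleGrad f x q.1) q.2 := by
    have h1 : Measurable fun q : (Fin m → Ξ) × (Vec d × Vec d) =>
        q.2.2 - η • sampleGrad f x q.1 q.2.2 :=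
      (measurable_snd.comp measurable_snd).sub (((measurable_sampleGrad hmeas hf x).comp
        (measurable_fst.prodMk (measurable_snd.comp measurable_snd))).const_smul η)
    exact h1.prodMk (h1.add ((h1.sub (measurable_fst.comp measurable_snd)).const_smul ζ))
  exact ((measurable_iterate (S := fun ξ : Fin m → Ξ => agdStep η ζ (sampleGrad f x ξ)) hS k).comp
    (measurable_fst.prodMk (measurable_snd.prodMk measurable_snd))).fst

lemma stronglyMeasurable_sampleHess (hmeas : ∀ z, Measurable (f z))
    (hf : ∀ e, SmoothFun L₁ L₂ (fun z => f z e)) (x : Vec d) :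
    StronglyMeasurable fun ξ : Fin m → Ξ => sampleHess f x ξ := by
  unfold sampleHess
  have h1 : ∀ i : Fin m, StronglyMeasurable fun ξ : Fin m → Ξ => hessian (fun w => f w (ξ i)) x :=
    fun i => (stronglyMeasurable_hessian hmeas hf x).comp_measurable (measurable_pi_apply i)
  have h2 : StronglyMeasurable fun ξ : Fin m → Ξ => ∑ i, hessian (fun w => f w (ξ i)) x :=
    Finset.stronglyMeasurable_fun_sum _ fun i _ => h1 i
  exact h2.const_smul (m : ℝ)⁻¹

lemma sphereUniform_norm_ne {r : ℝ} (hr : 0 < r) : sphereUniform d r {u | ‖u‖ ≠ r} = 0 := by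
  have hmap : Measurable fun v : Metric.sphere (0 : Vec d) 1 => r • (v : Vec d) :=
    measurable_subtype_coe.const_smul r
  have hset : MeasurableSet {u : Vec d | ‖u‖ ≠ r} :=
    (measurableSet_eq_fun measurable_norm measurable_const).compl
  rw [sphereUniform, Measure.map_apply hmap hset]
  have : (fun v : Metric.sphere (0 : Vec d) 1 => r • (v : Vec d)) ⁻¹' {u | ‖u‖ ≠ r} = ∅ := by
    ext v
    simp [norm_smul, abs_of_pos hr]
  rw [this, measure_empty]

/-- If, for mini-batches with an accurate Hessian, failure forces the iterates to stay in a ball,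
and starting points that stay in this ball are not separated in some direction, then failure is
unlikely. -/
lemma runLaw_le_of_trapped (D : Measure Ξ) [IsProbabilityMeasure D] (hd : 0 < d)
    (hL₁ : 0 < L₁) (hL₂ : 0 < L₂) (hmeas : ∀ z, Measurable (f z)) (hint : ∀ z, Integrable (f z) D)
    (hf : ∀ e, SmoothFun L₁ L₂ (fun z => f z e)) (x : Vec d) {δ ε r U : ℝ} (hδ : 0 < δ)
    (hδ1 : δ ≤ 1 / 100) (hε : 0 < ε) (hr : 0 < r)
    (hm : 16 * L₁ ^ 2 * Real.log (6 * d / δ) ≤ m * ε ^ 2) {N n : ℕ} (hn : 0 < n)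
    (iter : (Vec d → Vec d) → ℕ → Vec d → Vec d)
    (hiter : ∀ k, Measurable fun q : (Fin m → Ξ) × Vec d => iter (sampleGrad f x q.1) k q.2)
    (Bad : Set ((Fin m → Ξ) × Vec d))
    (h : ∀ ξ, ‖sampleHess f x ξ - hessian (fun z => ∫ e, f z e ∂D) x‖ ≤ ε →
      (∀ u, ‖u‖ = r → (ξ, u) ∈ Bad → ∀ k ≤ N, ‖iter (sampleGrad f x ξ) k u‖ ≤ U) ∧
      ∃ e : Vec d, ‖e‖ = 1 ∧
        ∀ u ∈ insert 0 {u | ∀ k ≤ N, ‖iter (sampleGrad f x ξ) k u‖ ≤ U},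
        ∀ w ∈ insert 0 {u | ∀ k ≤ N, ‖iter (sampleGrad f x ξ) k u‖ ≤ U},
        ‖w - u‖ ≤ 2 * inner ℝ e (w - u) → inner ℝ e (w - u) < r / (2 * d * n)) :
    runLaw D m d r Bad ≤ ENNReal.ofReal (δ / 6) + 3 / n := by
  have := isProbabilityMeasure_sphereUniform hd r
  set H := hessian (fun z => ∫ e, f z e ∂D) x with hH
  set A : Set (Fin m → Ξ) := {ξ | ε < ‖sampleHess f x ξ - H‖} with hA
  have hHm : StronglyMeasurable fun e => hessian (fun w => f w e) x :=
    stronglyMeasurable_hessian hmeas hf x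
  have hA_le : (Measure.pi fun _ : Fin m => D) A ≤ ENNReal.ofReal (δ / 6) := by
    have := measure_norm_average_sub_le (D := D) hd hHm hL₁
      (fun e => (hf e).norm_hessian_le hL₁.le x) (fun e => (hf e).hessian_symm x) hδ hδ1 hε hm
    rw [← hessian_integral hL₁.le hL₂.le hmeas hint hf x] at this
    exact this
  have hA_meas : MeasurableSet A := measurableSet_lt measurable_const
    ((stronglyMeasurable_sampleHess hmeas hf x).sub stronglyMeasurable_const).norm.measurable
  let B : Set ((Fin m → Ξ) × Vec d) :=
    {q | q.1 ∈ Aᶜ ∧ ∀ k ≤ N, ‖iter (sampleGrad f x q.1) k q.2‖ ≤ U}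
  have hB_meas : MeasurableSet B := by
    have hB : B = Prod.fst ⁻¹' Aᶜ ∩
        ⋂ k ∈ Set.Iic N, {q | ‖iter (sampleGrad f x q.1) k q.2‖ ≤ U} := by
      ext q
      simp only [B, Set.mem_ofPred_eq, Set.mem_inter_iff, Set.mem_preimage, Set.mem_iInter,
        Set.mem_Iic]
    rw [hB]
    exact (measurable_fst hA_meas.compl).inter (MeasurableSet.biInter (Set.to_countable _)
      fun k _ => measurableSet_le (hiter k).norm measurable_const)
  -- `Bad` need not be measurable, so it is covered: inaccurate Hessians, a null set of wrong
  -- radius, and the measurable trapped set.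
  have hsub : Bad ⊆ (A ×ˢ Set.univ ∪ Set.univ ×ˢ {u | ‖u‖ ≠ r}) ∪ B := by
    rintro ⟨ξ, u⟩ hq
    by_cases h1 : ξ ∈ A
    · exact Or.inl (Or.inl ⟨h1, trivial⟩)
    · by_cases h2 : ‖u‖ = r
      · exact Or.inr ⟨h1, (h ξ (not_lt.1 h1)).1 u h2 hq⟩
      · exact Or.inl (Or.inr ⟨trivial, h2⟩)
  -- For each fixed mini-batch the trapped starting points are unseparated in a direction depending
  -- on the batch, and the bound `3 / n` integrates over batches.
  have hB_le : runLaw D m d r B ≤ 3 / n := by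
    rw [runLaw, Measure.prod_apply hB_meas]
    calc _ ≤ ∫⁻ _ξ, (3 / n : ENNReal) ∂(Measure.pi fun _ : Fin m => D) := by
          refine lintegral_mono fun ξ => ?_
          by_cases h1 : ξ ∈ A
          · have : Prod.mk ξ ⁻¹' B = ∅ := by
              ext u; simp [B, h1]
            rw [this, measure_empty]; exact zero_le
          · obtain ⟨-, e, he, hsep⟩ := h ξ (not_lt.1 h1)
            have h2 : Prod.mk ξ ⁻¹' B = {u | ∀ k ≤ N, ‖iter (sampleGrad f x ξ) k u‖ ≤ U} := by
              ext u; simp [B, h1]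
            rw [h2]
            refine sphereUniform_le hd hr ?_ he hn hsep
            rw [← h2]
            exact measurable_prodMk_left hB_meas
      _ = _ := by simp
  calc runLaw D m d r Bad ≤ _ := measure_mono hsub
    _ ≤ (runLaw D m d r (A ×ˢ Set.univ) + runLaw D m d r (Set.univ ×ˢ {u | ‖u‖ ≠ r}))
        + runLaw D m d r B :=
      (measure_union_le _ _).trans (add_le_add_left (measure_union_le _ _) _)
    _ ≤ (ENNReal.ofReal (δ / 6) + 0) + 3 / n := by
      refine add_le_add (add_le_add ?_ ?_) hB_le
      · rw [runLaw, Measure.prod_prod, measure_univ, mul_one]; exact hA_le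
      · rw [runLaw, Measure.prod_prod, sphereUniform_norm_ne hr, mul_zero]
    _ = _ := by rw [add_zero]

/-- It suffices to bound failure probabilities for measurable families. -/
lemma runLaw_le_of_measurable (D : Measure Ξ) [IsProbabilityMeasure D] (hd : 0 < d)
    (hL₁ : 0 ≤ L₁) (hL₂ : 0 ≤ L₂) (hint : ∀ z, Integrable (f z) D)
    (hf : ∀ e, SmoothFun L₁ L₂ (fun z => f z e)) (x : Vec d) {r κ : ℝ} {b : ENNReal}
    (prog : Vec d → IFOProg m d (Vec d))
    (h : ∀ f' : Vec d → Ξ → ℝ, (∀ z, Measurable (f' z)) → (∀ z, Integrable (f' z) D) →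
      (∀ e, SmoothFun L₁ L₂ (fun z => f' z e)) →
      (fun z => ∫ e, f' z e ∂D) = (fun z => ∫ e, f z e ∂D) →
      runLaw D m d r {ω | ¬ IsNC (hessian (fun z => ∫ e, f' z e ∂D) x) κ
        ((prog ω.2).run (ifo f' ω.1)).1} ≤ b) :
    runLaw D m d r {ω | ¬ IsNC (hessian (fun z => ∫ e, f z e ∂D) x) κ
        ((prog ω.2).run (ifo f ω.1)).1} ≤ b := by
  have := isProbabilityMeasure_sphereUniform hd r
  obtain ⟨f', h1, h2, h3⟩ := exists_measurable_version hL₁ hL₂ hint hf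
  have hae : ∀ z, f' z =ᵐ[D] f z := fun z => h3.mono fun e he => he z
  have hF : (fun z => ∫ e, f' z e ∂D) = (fun z => ∫ e, f z e ∂D) :=
    funext fun z => integral_congr_ae (hae z)
  have key := h f' h1 (fun z => (hint z).congr (hae z).symm) h2 hF
  rw [hF] at key
  refine le_trans (measure_mono_ae ?_) key
  have h4 : ∀ᵐ ξ ∂(Measure.pi fun _ : Fin m => D), ∀ i, ∀ z, f' z (ξ i) = f z (ξ i) :=
    ae_all_iff.2 fun i => (Measure.quasiMeasurePreserving_eval (fun _ : Fin m => D) i).ae h3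
  have h5 : ∀ᵐ ω ∂(runLaw D m d r), ∀ i, ∀ z, f' z (ω.1 i) = f z (ω.1 i) :=
    Measure.quasiMeasurePreserving_fst.ae h4
  filter_upwards [h5] with ω hω hbad
  have : ifo f' ω.1 = ifo f ω.1 := by
    ext1 i
    have : (fun z => f' z (ω.1 i)) = fun z => f z (ω.1 i) := funext (hω i)
    ext1 z
    simp only [ifo, hω i z, this]
  change ¬ IsNC _ _ _ at hbad
  rw [← this] at hbad
  exact hbad

end sample

/-! ### Inequalities between the parameters -/

/-- The relations between the parameters of the two procedures: `η L₁ = A²`, and `F`, `r`, `κ` are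
expressed through the search scale `ρ`. -/
structure Scaling (c A η ρ F r κ L₁ L₂ γ ℓ : ℝ) : Prop where
  c_ge : 43 ≤ c
  A_pos : 0 < A
  A_le : 10 ^ 4 * c ^ 3 * A ≤ 1
  L₁_pos : 0 < L₁
  L₂_pos : 0 < L₂
  γ_pos : 0 < γ
  γ_le : γ ≤ L₁
  ℓ_ge : 6 ≤ ℓ
  η_eq : η * L₁ = A ^ 2
  ρ_eq : L₂ * ρ = A * γ / ℓ
  F_eq : F = ρ ^ 2 * γ / ℓ
  r_eq : r = ρ * γ / (L₁ * ℓ)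
  κ_eq : κ = γ / (72 * c ^ 2 * ℓ)

namespace Scaling

variable {c A η ρ F r κ L₁ L₂ γ ℓ : ℝ}

lemma c_pos (S : Scaling c A η ρ F r κ L₁ L₂ γ ℓ) : 0 < c := by linarith [S.c_ge]

lemma ℓ_pos (S : Scaling c A η ρ F r κ L₁ L₂ γ ℓ) : 0 < ℓ := by linarith [S.ℓ_ge]

lemma ρ_pos (S : Scaling c A η ρ F r κ L₁ L₂ γ ℓ) : 0 < ρ := by
  have h : 0 < L₂ * ρ := S.ρ_eq ▸ div_pos (mul_pos S.A_pos S.γ_pos) S.ℓ_pos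
  exact pos_of_mul_pos_right h S.L₂_pos.le

lemma F_pos (S : Scaling c A η ρ F r κ L₁ L₂ γ ℓ) : 0 < F := by
  have := S.ρ_pos; have := S.γ_pos; have := S.ℓ_pos
  rw [S.F_eq]; positivity

lemma r_pos (S : Scaling c A η ρ F r κ L₁ L₂ γ ℓ) : 0 < r := by
  have := S.ρ_pos; have := S.γ_pos; have := S.ℓ_pos; have := S.L₁_pos
  rw [S.r_eq]; positivity

lemma κ_pos (S : Scaling c A η ρ F r κ L₁ L₂ γ ℓ) : 0 < κ := by
  have := S.γ_pos; have := S.ℓ_pos; have := S.c_pos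
  rw [S.κ_eq]; positivity

lemma η_pos (S : Scaling c A η ρ F r κ L₁ L₂ γ ℓ) : 0 < η :=
  pos_of_mul_pos_left (S.η_eq ▸ pow_pos S.A_pos 2) S.L₁_pos.le

lemma c_pow_A_le (S : Scaling c A η ρ F r κ L₁ L₂ γ ℓ) : 10 ^ 4 * c ^ 2 * A ≤ 1 / 43 := by
  have h1 : 43 * (10 ^ 4 * c ^ 2 * A) ≤ 10 ^ 4 * c ^ 3 * A := by
    have := S.A_pos
    calc 43 * (10 ^ 4 * c ^ 2 * A) ≤ c * (10 ^ 4 * c ^ 2 * A) := by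
          gcongr; exact S.c_ge
      _ = _ := by ring
  linarith [S.A_le]

lemma A_le_small (S : Scaling c A η ρ F r κ L₁ L₂ γ ℓ) : A ≤ 1 / 10 ^ 4 := by
  have h1 : (1 : ℝ) ≤ c ^ 2 := one_le_pow₀ (by linarith [S.c_ge])
  nlinarith [S.c_pow_A_le, S.A_pos]

lemma η_mul_le (S : Scaling c A η ρ F r κ L₁ L₂ γ ℓ) : η * L₁ ≤ 1 / 16 := by
  rw [S.η_eq]; nlinarith [S.A_le_small, S.A_pos]

lemma η_mul_γ_le (S : Scaling c A η ρ F r κ L₁ L₂ γ ℓ) : η * γ ≤ 1 / 16 :=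
  (mul_le_mul_of_nonneg_left S.γ_le S.η_pos.le).trans S.η_mul_le

lemma r_le (S : Scaling c A η ρ F r κ L₁ L₂ γ ℓ) : r ≤ ρ / ℓ := by
  have := S.ρ_pos; have := S.γ_pos; have := S.ℓ_pos; have := S.L₁_pos
  rw [S.r_eq, div_le_div_iff₀ (by positivity) (by positivity)]
  have := mul_le_mul_of_nonneg_left S.γ_le (by positivity : 0 ≤ ρ * ℓ)
  linarith

lemma r_le_ρ (S : Scaling c A η ρ F r κ L₁ L₂ γ ℓ) : r ≤ ρ / 6 :=
  S.r_le.trans (div_le_div_of_nonneg_left S.ρ_pos.le (by norm_num) S.ℓ_ge)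

lemma L₁_mul_r_sq_le (S : Scaling c A η ρ F r κ L₁ L₂ γ ℓ) : L₁ * r ^ 2 ≤ F / 6 := by
  have hρ := S.ρ_pos; have hγ := S.γ_pos; have hℓ := S.ℓ_pos; have hL := S.L₁_pos
  have h1 : L₁ * r = ρ * γ / ℓ := by rw [S.r_eq]; field_simp
  calc L₁ * r ^ 2 = ρ * γ / ℓ * r := by rw [← h1]; ring
    _ ≤ ρ * γ / ℓ * (ρ / 6) := by gcongr; exact S.r_le_ρ
    _ = F / 6 := by rw [S.F_eq]; ring

lemma κ_mul (S : Scaling c A η ρ F r κ L₁ L₂ γ ℓ) : κ * (72 * c ^ 2 * ℓ) = γ := by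
  have := S.c_pos; have := S.ℓ_pos
  rw [S.κ_eq]; field_simp

lemma κ_le (S : Scaling c A η ρ F r κ L₁ L₂ γ ℓ) : κ ≤ γ / 100 := by
  have h1 : (1 : ℝ) ≤ c ^ 2 := one_le_pow₀ (by linarith [S.c_ge])
  have h2 : (100 : ℝ) ≤ 72 * c ^ 2 * ℓ := by nlinarith [S.ℓ_ge]
  have := mul_le_mul_of_nonneg_left h2 S.κ_pos.le
  linarith [S.κ_mul]

/-- This ties the radii to the thresholds: `q = 12` gives exactly `2F`, and `q = 4` gives `2F / 9`,
well below `5F / 2`. -/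
lemma κ_mul_sq (S : Scaling c A η ρ F r κ L₁ L₂ γ ℓ) (q : ℝ) :
    κ * (q * c * ρ) ^ 2 = q ^ 2 / 72 * F := by
  have := S.c_pos; have := S.ℓ_pos
  rw [S.κ_eq, S.F_eq]; field_simp

/-- In the search ball the cubic Taylor error costs at most half of the curvature `2κ`; this is one
of the estimates that require `c ^ 3 * A` to be small. -/
lemma four_L₂_mul_le (S : Scaling c A η ρ F r κ L₁ L₂ γ ℓ) {q : ℝ} (hq : q ≤ 12) :
    4 * (L₂ * (q * c * ρ)) ≤ κ := by
  have hc := S.c_pos; have hℓ := S.ℓ_pos; have hA := S.A_pos; have hγ := S.γ_pos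
  calc 4 * (L₂ * (q * c * ρ)) = q * (4 * c * (L₂ * ρ)) := by ring
    _ ≤ 12 * (4 * c * (L₂ * ρ)) := by
        have := S.L₂_pos; have := S.ρ_pos
        gcongr
    _ = 48 * c * A * γ / ℓ := by rw [S.ρ_eq]; ring
    _ ≤ κ := by
      rw [S.κ_eq, div_le_div_iff₀ hℓ (by positivity)]
      have h := mul_le_mul_of_nonneg_right S.A_le (mul_pos hγ hℓ).le
      have : 0 ≤ c ^ 3 * A * (γ * ℓ) := by positivity
      linarith

/-! ### Gradient descent -/

lemma gd_energy (S : Scaling c A η ρ F r κ L₁ L₂ γ ℓ) {N : ℕ} (hN : N * (η * γ) ≤ 1.1 * c * ℓ) :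
    2 * η * N * (L₁ * r ^ 2 + 5 / 2 * F) ≤ (4 * c * ρ / 8) ^ 2 := by
  have hF := S.F_pos; have hη := S.η_pos; have hc := S.c_pos; have hℓ := S.ℓ_pos; have hρ := S.ρ_pos
  have h1 : N * η * F ≤ 1.1 * c * ρ ^ 2 := by
    calc N * η * F = N * (η * γ) * (ρ ^ 2 / ℓ) := by rw [S.F_eq]; ring
      _ ≤ 1.1 * c * ℓ * (ρ ^ 2 / ℓ) := by gcongr
      _ = _ := by field_simp
  have h2 : 2 * η * N * (L₁ * r ^ 2 + 5 / 2 * F) ≤ 2 * η * N * (F / 6 + 5 / 2 * F) := by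
    gcongr; exact S.L₁_mul_r_sq_le
  have h3 : 43 * (c * ρ ^ 2) ≤ c * (c * ρ ^ 2) := by gcongr; exact S.c_ge
  nlinarith

/-- The total relative error over the whole run, in the form `power_growth` asks for. -/
lemma gd_perturbation (S : Scaling c A η ρ F r κ L₁ L₂ γ ℓ) {N : ℕ}
    (hN : N * (η * γ) ≤ 1.1 * c * ℓ) : N * (η * (L₂ * (4 * c * ρ))) ≤ 1 / 16 := by
  have hA := S.A_pos; have hc := S.c_pos; have hℓ := S.ℓ_pos
  calc N * (η * (L₂ * (4 * c * ρ))) = N * η * (4 * c) * (L₂ * ρ) := by ring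
    _ = N * (η * γ) * (4 * c * A / ℓ) := by rw [S.ρ_eq]; ring
    _ ≤ 1.1 * c * ℓ * (4 * c * A / ℓ) := by gcongr
    _ = 4.4 * (c ^ 2 * A) := by field_simp; ring
    _ ≤ 1 / 16 := by linarith [S.c_pow_A_le]

/-! ### Accelerated gradient descent -/

variable {θ : ℝ}

lemma agd_energy (S : Scaling c A η ρ F r κ L₁ L₂ γ ℓ) (hθ : 0 < θ) (hθ2 : θ ^ 2 = η * γ) {N : ℕ}
    (hN : N * θ ≤ 1.1 * c * ℓ) :
    2 * η * N * (L₁ * r ^ 2 + 2 * F) ≤ θ * (12 * c * ρ / 8) ^ 2 := by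
  have hF := S.F_pos; have hη := S.η_pos; have hc := S.c_pos; have hℓ := S.ℓ_pos; have hρ := S.ρ_pos
  have h1 : N * η * F ≤ 1.1 * c * ρ ^ 2 * θ := by
    calc N * η * F = N * (η * γ) * (ρ ^ 2 / ℓ) := by rw [S.F_eq]; ring
      _ = N * θ * (ρ ^ 2 / ℓ * θ) := by rw [← hθ2]; ring
      _ ≤ 1.1 * c * ℓ * (ρ ^ 2 / ℓ * θ) := by gcongr
      _ = _ := by field_simp
  have h2 : 2 * η * N * (L₁ * r ^ 2 + 2 * F) ≤ 2 * η * N * (F / 6 + 2 * F) := by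
    gcongr; exact S.L₁_mul_r_sq_le
  have h3 : 43 * (c * ρ ^ 2 * θ) ≤ c * (c * ρ ^ 2 * θ) := by gcongr; exact S.c_ge
  nlinarith

lemma agd_perturbation (S : Scaling c A η ρ F r κ L₁ L₂ γ ℓ) (hθ : 0 < θ) (hθ2 : θ ^ 2 = η * γ)
    {N : ℕ} (hN : N * θ ≤ 1.1 * c * ℓ) :
    144 * N * (η * (L₂ * (12 * c * ρ))) ≤ 0.9 * θ := by
  have hA := S.A_pos; have hc := S.c_pos; have hℓ := S.ℓ_pos
  calc 144 * N * (η * (L₂ * (12 * c * ρ))) = 1728 * N * η * c * (L₂ * ρ) := by ring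
    _ = N * (η * γ) * (1728 * c * A / ℓ) := by rw [S.ρ_eq]; ring
    _ = N * θ * (1728 * c * A / ℓ * θ) := by rw [← hθ2]; ring
    _ ≤ 1.1 * c * ℓ * (1728 * c * A / ℓ * θ) := by gcongr
    _ = 1900.8 * (c ^ 2 * A) * θ := by field_simp; ring
    _ ≤ 0.9 * θ := by gcongr; linarith [S.c_pow_A_le]

lemma agd_extrapolation (S : Scaling c A η ρ F r κ L₁ L₂ γ ℓ) (hθ : 0 < θ)
    (hθ2 : θ ^ 2 = η * γ) {N : ℕ} (hN : N * θ ≤ 1.1 * c * ℓ) : 12 * κ * η * N ≤ θ := by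
  have hc := S.c_pos; have hℓ := S.ℓ_pos
  have h1 : (1.1 : ℝ) ≤ 6 * c := by linarith [S.c_ge]
  calc 12 * κ * η * N = N * (η * γ) * (1 / (6 * c ^ 2 * ℓ)) := by rw [S.κ_eq]; field_simp; ring
    _ = N * θ * (1 / (6 * c ^ 2 * ℓ) * θ) := by rw [← hθ2]; ring
    _ ≤ 1.1 * c * ℓ * (1 / (6 * c ^ 2 * ℓ) * θ) := by gcongr
    _ = 1.1 / (6 * c) * θ := by field_simp
    _ ≤ 1 * θ := by gcongr; rw [div_le_one (by positivity)]; exact h1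
    _ = θ := one_mul θ

/-- Here the accumulated displacements grow like `√ℓ`, so `A * √ℓ` itself must be small. This is why
the accelerated step size carries the extra factor `1 / ℓ`. -/
lemma agd_radius (S : Scaling c A η ρ F r κ L₁ L₂ γ ℓ) (hAℓ : 10 ^ 4 * c ^ 3 * (A * √ℓ) ≤ 1)
    (hθ : 0 < θ) (hθ2 : θ ^ 2 = η * γ) {N : ℕ} (hN : N * θ ≤ 1.1 * c * ℓ) :
    8 * (L₂ * (r + N * √(6 * η * F))) ≤ κ := by
  have hA := S.A_pos; have hc := S.c_pos; have hℓ := S.ℓ_pos; have hρ := S.ρ_pos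
  have hγ := S.γ_pos; have hL := S.L₂_pos
  have hs : 1 ≤ √ℓ := by rw [Real.one_le_sqrt]; linarith [S.ℓ_ge]
  have hss : √ℓ * √ℓ = ℓ := Real.mul_self_sqrt hℓ.le
  have h1 : √(6 * η * F) ≤ 2.5 * (θ * ρ) / √ℓ := by
    apply Real.sqrt_le_iff.2 ⟨by positivity, ?_⟩
    have : (2.5 * (θ * ρ) / √ℓ) ^ 2 = 6.25 * (η * γ) * ρ ^ 2 / ℓ := by
      rw [div_pow, Real.sq_sqrt hℓ.le, ← hθ2]; ring
    rw [this, S.F_eq]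
    have : 0 ≤ η * γ * ρ ^ 2 / ℓ := by rw [← hθ2]; positivity
    calc 6 * η * (ρ ^ 2 * γ / ℓ) = 6 * (η * γ * ρ ^ 2 / ℓ) := by ring
      _ ≤ 6.25 * (η * γ * ρ ^ 2 / ℓ) := by linarith
      _ = _ := by ring
  have h2 : N * √(6 * η * F) ≤ 2.75 * (c * ρ * √ℓ) := by
    calc N * √(6 * η * F) ≤ N * (2.5 * (θ * ρ) / √ℓ) := by gcongr
      _ = N * θ * (2.5 * ρ / √ℓ) := by ring
      _ ≤ 1.1 * c * ℓ * (2.5 * ρ / √ℓ) := by gcongr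
      _ = 1.1 * c * (√ℓ * √ℓ) * (2.5 * ρ / √ℓ) := by rw [hss]
      _ = _ := by field_simp; ring
  have h3 : r ≤ c * ρ * √ℓ := by
    calc r ≤ ρ / 6 := S.r_le_ρ
      _ ≤ 1 * ρ * 1 := by linarith
      _ ≤ c * ρ * √ℓ := by gcongr; linarith [S.c_ge]
  calc 8 * (L₂ * (r + N * √(6 * η * F))) ≤ 8 * (L₂ * (3.75 * (c * ρ * √ℓ))) := by
        gcongr; linarith
    _ = 30 * c * √ℓ * (L₂ * ρ) := by ring
    _ = 30 * c * (A * √ℓ) * γ / ℓ := by rw [S.ρ_eq]; ring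
    _ ≤ κ := by
      rw [S.κ_eq, div_le_div_iff₀ hℓ (by positivity)]
      have h := mul_le_mul_of_nonneg_right hAℓ (mul_pos hγ hℓ).le
      have : 0 ≤ c ^ 3 * (A * √ℓ) * (γ * ℓ) := by positivity
      linarith

lemma two_κ_mul_r_sq_le (S : Scaling c A η ρ F r κ L₁ L₂ γ ℓ) : 2 * κ * r ^ 2 ≤ F := by
  have h1 := S.κ_le; have h2 := S.γ_le; have h3 := S.L₁_mul_r_sq_le; have h4 := S.F_pos
  have h5 := mul_le_mul_of_nonneg_right (show 2 * κ ≤ L₁ by linarith [S.γ_pos]) (sq_nonneg r)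
  linarith

end Scaling

/-- `exp (x / 2) ≤ 1 + x` for `x ≤ 1`, raised to a power. -/
lemma exp_le_one_add_pow {x : ℝ} (hx : 0 ≤ x) (hx1 : x ≤ 1) (N : ℕ) :
    Real.exp (N * (x / 2)) ≤ (1 + x) ^ N := by
  rw [Real.exp_nat_mul]
  gcongr
  have h1 := Real.one_sub_le_exp_neg (x / 2)
  have h2 : Real.exp (x / 2) * Real.exp (-(x / 2)) = 1 := by rw [← Real.exp_add]; simp
  have h3 := Real.exp_pos (x / 2)
  nlinarith

/-! ### Smallest eigenvalue and nearby operators -/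

section spectral

variable {d : ℕ}

/-- A negative value of `lambdaMin` is attained. -/
lemma exists_unit_of_lambdaMin_le {H : Vec d →L[ℝ] Vec d} {γ : ℝ} (hγ : 0 < γ)
    (h : lambdaMin H ≤ -γ) : ∃ v : Vec d, ‖v‖ = 1 ∧ inner ℝ v (H v) ≤ -γ := by
  set E : Set ℝ := {μ : ℝ | Module.End.HasEigenvalue (H : Vec d →ₗ[ℝ] Vec d) μ} with hE
  have hne : E.Nonempty := by
    by_contra hne
    rw [Set.not_nonempty_iff_eq_empty] at hne
    -- The infimum of the empty set is `0` by convention, so a negative value guarantees that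
    -- eigenvalues exist.
    have : lambdaMin H = 0 := by rw [lambdaMin, ← hE, hne, Real.sInf_empty]
    linarith
  have hfin : E.Finite := Module.End.finite_hasEigenvalue _
  have hmem : lambdaMin H ∈ E := hne.csInf_mem hfin
  obtain ⟨v, hv⟩ := Module.End.HasEigenvalue.exists_hasEigenvector hmem
  have hv0 : ‖v‖ ≠ 0 := norm_ne_zero_iff.2 hv.2
  have hHv : H v = lambdaMin H • v := hv.apply_eq_smul
  refine ⟨‖v‖⁻¹ • v, by rw [norm_smul, norm_inv, norm_norm, inv_mul_cancel₀ hv0], ?_⟩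
  have : inner ℝ (‖v‖⁻¹ • v) (H (‖v‖⁻¹ • v)) = lambdaMin H := by
    rw [map_smul, hHv, real_inner_smul_left, real_inner_smul_right, real_inner_smul_right,
      real_inner_self_eq_norm_sq]
    field_simp
  rwa [this]

/-- The Rayleigh quotient of any unit vector bounds the lowest eigenvalue from above. -/
lemma exists_eigenbasis_min {S : Vec d →L[ℝ] Vec d}
    (hS : ∀ v w, inner ℝ (S v) w = inner ℝ v (S w)) {v : Vec d} {μ : ℝ} (hv : ‖v‖ = 1)
    (hμ : inner ℝ v (S v) ≤ μ) :
    ∃ (b : OrthonormalBasis (Fin d) ℝ (Vec d)) (lam : Fin d → ℝ) (i₀ : Fin d),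
      (∀ i, S (b i) = lam i • b i) ∧ (∀ i, lam i₀ ≤ lam i) ∧ lam i₀ ≤ μ := by
  obtain ⟨b, lam, hb⟩ := exists_eigenbasis S hS
  have hne : Nonempty (Fin d) := by
    by_contra hne
    rw [not_nonempty_iff] at hne
    have : v = 0 := Subsingleton.elim _ _
    simp [this] at hv
  obtain ⟨i₀, hi₀⟩ := Finite.exists_min lam
  refine ⟨b, lam, i₀, hb, hi₀, le_trans ?_ hμ⟩
  have h1 : inner ℝ v (S v) = ∑ i, lam i * inner ℝ (b i) v ^ 2 := by
    rw [← b.sum_inner_mul_inner v (S v)]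
    refine Finset.sum_congr rfl fun i _ => ?_
    rw [← hS, hb, real_inner_smul_left, real_inner_comm (b i) v]
    ring
  have h2 : ∑ i, inner ℝ (b i) v ^ 2 = 1 := by
    have := b.sum_sq_norm_inner_right v
    simpa [hv, Real.norm_eq_abs, sq_abs] using this
  rw [h1]
  calc lam i₀ = lam i₀ * ∑ i, inner ℝ (b i) v ^ 2 := by rw [h2, mul_one]
    _ = ∑ i, lam i₀ * inner ℝ (b i) v ^ 2 := Finset.mul_sum _ _ _
    _ ≤ _ := Finset.sum_le_sum fun i _ => mul_le_mul_of_nonneg_right (hi₀ i) (sq_nonneg _)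

lemma inner_sub_apply_le (A B : Vec d →L[ℝ] Vec d) {ε : ℝ} (h : ‖B - A‖ ≤ ε) (z : Vec d) :
    |inner ℝ z (B z) - inner ℝ z (A z)| ≤ ε * ‖z‖ ^ 2 := by
  rw [← inner_sub_right, ← sub_apply]
  calc _ ≤ ‖z‖ * ‖(B - A) z‖ := abs_real_inner_le_norm _ _
    _ ≤ ‖z‖ * (ε * ‖z‖) := by
      gcongr
      exact ((B - A).le_opNorm z).trans (by gcongr)
    _ = _ := by ring

lemma isNC_of_close {A B : Vec d →L[ℝ] Vec d} {κ : ℝ} (h : ‖B - A‖ ≤ κ / 2) {z : Vec d}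
    (hz : z ≠ 0) (hB : inner ℝ z (B z) ≤ -κ * ‖z‖ ^ 2) : IsNC A (κ / 2) z := by
  refine ⟨hz, ?_⟩
  have h1 := (abs_le.1 (inner_sub_apply_le A B h z)).1
  rw [div_le_iff₀ (by have := norm_pos_iff.2 hz; positivity)]
  linarith

end spectral

/-! ### Failure confines the run, and confinement excludes separation -/

section failure

variable {d : ℕ} {c A η ρ F r κ L₁ L₂ γ ℓ θ : ℝ} {h : Vec d → ℝ} {G : Vec d → Vec d}
  {H : Vec d →L[ℝ] Vec d}

/-- A vector with a small value of `ĝ` is a direction of negative curvature. -/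
lemma LocalModel.inner_le_of_selectMin (M : LocalModel L₁ L₂ h G H)
    (S : Scaling c A η ρ F r κ L₁ L₂ γ ℓ) {q θ : ℝ} (hq : q ≤ 12) (hθ : q ^ 2 / 72 * F ≤ θ)
    (hθ0 : 0 < θ) {P : ℕ → Vec d} {n : ℕ}
    (hP : ∃ k < n, ‖P k‖ ≤ q * c * ρ ∧ h (P k) ≤ -θ) {z : Vec d}
    (hz : z = selectMin (q * c * ρ) θ ((List.range n).map fun k => (P k, h (P k)))) :
    z ≠ 0 ∧ inner ℝ z (H z) ≤ -κ * ‖z‖ ^ 2 := by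
  obtain ⟨k, hk, h1, h2⟩ := hP
  obtain ⟨y, hy, h3, h4, h5⟩ := selectMin_spec (U := q * c * ρ) (θ := θ)
    (l := (List.range n).map fun k => (P k, h (P k)))
    ⟨(P k, h (P k)), List.mem_map.2 ⟨k, List.mem_range.2 hk, rfl⟩, h1, h2⟩
  obtain ⟨j, -, rfl⟩ := List.mem_map.1 hy
  rw [← hz] at h5
  simp only at h3 h4 h5
  rw [← h5] at h3 h4
  have hz0 : z ≠ 0 := by
    rintro rfl
    rw [M.h_zero] at h4
    linarith
  refine ⟨hz0, ?_⟩
  have h6 : ‖z‖ ^ 2 ≤ (q * c * ρ) ^ 2 := by gcongr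
  have h7 : κ * ‖z‖ ^ 2 ≤ θ :=
    (mul_le_mul_of_nonneg_left h6 S.κ_pos.le).trans ((S.κ_mul_sq q).trans_le hθ)
  refine (M.inner_hessian_le (κ := κ) (by linarith)).trans ?_
  gcongr
  have : 4 * (L₂ * ‖z‖) ≤ 4 * (L₂ * (q * c * ρ)) := by have := S.L₂_pos; gcongr
  linarith [S.four_L₂_mul_le hq]

/-- A low value in the ball would make the selected vector a direction of negative curvature;
without one the energy traps the run. -/
lemma LocalModel.gd_failure (M : LocalModel L₁ L₂ h G H)
    (S : Scaling c A η ρ F r κ L₁ L₂ γ ℓ) {t : ℕ}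
    (ht : ((t + 1 : ℕ) : ℝ) * (η * γ) ≤ 1.1 * c * ℓ) {u z : Vec d} (hu : ‖u‖ = r)
    (hz : z = selectMin (4 * c * ρ) (5 / 2 * F)
      ((List.range (t + 2)).map fun k => ((gdStep η G)^[k] u, h ((gdStep η G)^[k] u))))
    (hbad : ¬ (z ≠ 0 ∧ inner ℝ z (H z) ≤ -κ * ‖z‖ ^ 2)) :
    ∀ k ≤ t + 1, ‖(gdStep η G)^[k] u‖ ≤ 4 * c * ρ := by
  have hF := S.F_pos
  have hρ := S.ρ_pos
  refine M.gd_trapped S.η_pos.le (by linarith [S.η_mul_le]) ?_ ?_ (by positivity) S.L₁_pos.le ?_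
    (θ := 5 / 2 * F)
  · have h1 : 43 * ρ ≤ c * ρ := by gcongr; exact S.c_ge
    rw [hu]; linarith [S.r_le_ρ]
  · intro k hk hcon
    exact hbad (M.inner_le_of_selectMin S (q := 4) (θ := 5 / 2 * F)
      (P := fun k => (gdStep η G)^[k] u) (by norm_num) (by linarith) (by positivity)
      ⟨k, by omega, hcon⟩ hz)
  · rw [hu]; exact S.gd_energy ht

/-- A triggered run always succeeds, so a failing run passes every test and the energy estimate
covers its whole length. -/
lemma LocalModel.agd_failure (M : LocalModel L₁ L₂ h G H)
    (S : Scaling c A η ρ F r κ L₁ L₂ γ ℓ) (hAℓ : 10 ^ 4 * c ^ 3 * (A * √ℓ) ≤ 1)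
    (hθ : 0 < θ) (hθ2 : θ ^ 2 = η * γ) {ζ : ℝ} (hζ : ζ = 1 - θ) {t : ℕ}
    (ht : ((t + 1 : ℕ) : ℝ) * θ ≤ 1.1 * c * ℓ) {u z : Vec d} (hu : ‖u‖ = r)
    (hz : (∃ τ ≤ t, (∀ j < τ, ¬ Triggers h G γ ((agdStep η ζ G)^[j] (u, u))) ∧
        Triggers h G γ ((agdStep η ζ G)^[τ] (u, u)) ∧
        z = ncFind ζ η F ((List.range (τ + 1)).map fun j => (agdStep η ζ G)^[j] (u, u))
          ((agdStep η ζ G)^[τ] (u, u)).1 ((agdStep η ζ G)^[τ] (u, u)).2) ∨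
      (∀ j ≤ t, ¬ Triggers h G γ ((agdStep η ζ G)^[j] (u, u))) ∧
        z = selectMin (12 * c * ρ) (2 * F) ((List.range (t + 2)).map fun j =>
          (((agdStep η ζ G)^[j] (u, u)).1, h ((agdStep η ζ G)^[j] (u, u)).1)))
    (hbad : ¬ (z ≠ 0 ∧ inner ℝ z (H z) ≤ -κ * ‖z‖ ^ 2)) :
    ∀ k ≤ t + 1, ‖((agdStep η ζ G)^[k] (u, u)).1‖ ≤ 12 * c * ρ := by
  have hF := S.F_pos
  have hρ := S.ρ_pos
  have hη := S.η_pos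
  have hθ1 : θ < 1 := by nlinarith [S.η_mul_γ_le]
  obtain ⟨τ, hτ, h1, h2, h3⟩ | ⟨h1, h2⟩ := hz
  · refine absurd ?_ hbad
    have hκ := S.κ_pos
    refine M.agd_triggered hη (by linarith [S.η_mul_le]) S.L₂_pos.le hθ hθ1 hθ2 hζ hF hu
      (by linarith [S.L₁_mul_r_sq_le]) hκ.le S.two_κ_mul_r_sq_le ?_ ?_
      (by linarith [S.κ_le, S.γ_pos]) hτ h1 h2 h3
    · refine le_trans ?_ (S.agd_extrapolation hθ hθ2 ht)
      gcongr
      simp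
    · have := S.agd_radius hAℓ hθ hθ2 ht
      push_cast at this
      exact this
  · refine M.agd_trapped hη.le (by linarith [S.η_mul_le]) hθ hθ1.le hθ2 hζ (ϑ := 2 * F) ?_
      (fun j hj => h1 j (by omega)) ?_ (by positivity) S.L₁_pos.le ?_
    · have h1 : 43 * ρ ≤ c * ρ := by gcongr; exact S.c_ge
      rw [hu]; linarith [S.r_le_ρ]
    · intro k hk hcon
      exact hbad (M.inner_le_of_selectMin S (q := 12) (θ := 2 * F)
        (P := fun k => ((agdStep η ζ G)^[k] (u, u)).1)
        (by norm_num) (by linarith) (by positivity) ⟨k, by omega, hcon⟩ h2)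
    · rw [hu]; exact S.agd_energy hθ hθ2 ht

/-- The exponential growth of a separation `r / (2 d n)` exceeds the search radius. -/
lemma Scaling.lt_growth (S : Scaling c A η ρ F r κ L₁ L₂ γ ℓ) (hd : 0 < d) {n : ℕ} (hn : 0 < n)
    (hgap : 768 * c * (d * n * ℓ * (L₁ / γ)) < Real.exp (3 * ℓ)) {p E : ℝ}
    (hE : Real.exp (3 * ℓ) ≤ E) (hp : r / (2 * d * n) ≤ p) : 24 * (c * ρ) < E * (p / 16) := by
  have hρ := S.ρ_pos; have hγ := S.γ_pos; have hℓ := S.ℓ_pos; have hL := S.L₁_pos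
  have hr := S.r_pos
  have hd' : (0 : ℝ) < d := by exact_mod_cast hd
  have hn' : (0 : ℝ) < n := by exact_mod_cast hn
  -- `24cρ` is twice the larger search radius `12cρ`, the `16` is the loss in `momentum_growth`, and
  -- `768 = 24 * 2 * 16`. The smaller radius and loss of gradient descent are covered as well.
  calc 24 * (c * ρ) = 768 * c * (d * n * ℓ * (L₁ / γ)) * (r / (2 * d * n) / 16) := by
        rw [S.r_eq]; field_simp; ring
    _ < Real.exp (3 * ℓ) * (r / (2 * d * n) / 16) := by gcongr
    _ ≤ E * (p / 16) := by
      have := (Real.exp_pos (3 * ℓ)).trans_le hE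
      gcongr

lemma gdStep_iterate_zero (hG : G 0 = 0) (k : ℕ) : (gdStep η G)^[k] 0 = 0 := by
  have : gdStep η G 0 = 0 := by simp [gdStep, hG]
  exact Function.iterate_fixed this k

/-- A larger separation would be amplified by at least `exp (3ℓ)`, beyond the diameter of the search
ball. -/
lemma LocalModel.gd_not_separated (M : LocalModel L₁ L₂ h G H)
    (S : Scaling c A η ρ F r κ L₁ L₂ γ ℓ) (hd : 0 < d) {n : ℕ} (hn : 0 < n)
    (hgap : 768 * c * (d * n * ℓ * (L₁ / γ)) < Real.exp (3 * ℓ)) {N : ℕ}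
    (hN : c * ℓ ≤ N * (η * γ)) (hN' : N * (η * γ) ≤ 1.1 * c * ℓ)
    {b : OrthonormalBasis (Fin d) ℝ (Vec d)} {lam : Fin d → ℝ} {i₀ : Fin d}
    (hb : ∀ i, H (b i) = lam i • b i) (hmin : ∀ i, lam i₀ ≤ lam i) (hlam : lam i₀ ≤ -(0.9 * γ))
    {u w : Vec d} (hu : u ∈ insert 0 {u | ∀ k ≤ N, ‖(gdStep η G)^[k] u‖ ≤ 4 * c * ρ})
    (hw : w ∈ insert 0 {u | ∀ k ≤ N, ‖(gdStep η G)^[k] u‖ ≤ 4 * c * ρ})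
    (huw : ‖w - u‖ ≤ 2 * inner ℝ (b i₀) (w - u)) :
    inner ℝ (b i₀) (w - u) < r / (2 * d * n) := by
  have hρ := S.ρ_pos; have hγ := S.γ_pos; have hc := S.c_pos; have hη := S.η_pos
  have hℓ := S.ℓ_pos
  -- The origin is a fixed point of the iteration, hence trapped as well.
  have key : ∀ y ∈ insert 0 {u | ∀ k ≤ N, ‖(gdStep η G)^[k] u‖ ≤ 4 * c * ρ},
      ∀ k ≤ N, ‖(gdStep η G)^[k] y‖ ≤ 4 * c * ρ := by
    rintro y (rfl | hy) k hk
    · rw [gdStep_iterate_zero M.G_zero, norm_zero]; positivity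
    · exact hy k hk
  by_contra! hcon
  have h1 := M.gd_separation hb hmin (by linarith) hη.le (by linarith [S.η_mul_le]) S.L₂_pos.le
    (S.gd_perturbation hN') (key u hu) (key w hw) huw
  have hx : η * (0.9 * γ) ≤ η * -lam i₀ := by gcongr; linarith
  have h2 : Real.exp (3 * ℓ) ≤ (1 + η * -lam i₀) ^ N := by
    calc Real.exp (3 * ℓ) ≤ Real.exp (N * (η * (0.9 * γ) / 2)) := by
          apply Real.exp_le_exp.2
          have : 43 * ℓ ≤ c * ℓ := by gcongr; exact S.c_ge
          linarith
      _ ≤ (1 + η * (0.9 * γ)) ^ N :=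
        exp_le_one_add_pow (by positivity) (by linarith [S.η_mul_γ_le]) N
      _ ≤ _ := by gcongr
  have h3 := S.lt_growth hd hn hgap h2 hcon
  have h4 : 0 < (1 + η * -lam i₀) ^ N := (Real.exp_pos _).trans_le h2
  have h5 : 0 < inner ℝ (b i₀) (w - u) := by
    have hr := S.r_pos
    have hd' : (0 : ℝ) < d := by exact_mod_cast hd
    have hn' : (0 : ℝ) < n := by exact_mod_cast hn
    exact (by positivity : 0 < r / (2 * d * n)).trans_le hcon
  have h6 := mul_pos h4 h5
  have h7 := mul_pos hc hρ
  linarith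

/-- The growth rate per step is of order `√(ηγ)` instead of `ηγ`, which is why fewer steps suffice.
-/
lemma LocalModel.agd_not_separated (M : LocalModel L₁ L₂ h G H)
    (S : Scaling c A η ρ F r κ L₁ L₂ γ ℓ) (hθ : 0 < θ) (hθ2 : θ ^ 2 = η * γ) {ζ : ℝ}
    (hζ : ζ = 1 - θ) (hd : 0 < d) {n : ℕ} (hn : 0 < n)
    (hgap : 768 * c * (d * n * ℓ * (L₁ / γ)) < Real.exp (3 * ℓ)) {N : ℕ}
    (hN : c * ℓ ≤ N * θ) (hN' : N * θ ≤ 1.1 * c * ℓ)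
    {b : OrthonormalBasis (Fin d) ℝ (Vec d)} {lam : Fin d → ℝ} {i₀ : Fin d}
    (hb : ∀ i, H (b i) = lam i • b i) (hmin : ∀ i, lam i₀ ≤ lam i) (hlam : lam i₀ ≤ -(0.9 * γ))
    {u w : Vec d}
    (hu : u ∈ insert 0 {u | ∀ k ≤ N, ‖((agdStep η ζ G)^[k] (u, u)).1‖ ≤ 12 * c * ρ})
    (hw : w ∈ insert 0 {u | ∀ k ≤ N, ‖((agdStep η ζ G)^[k] (u, u)).1‖ ≤ 12 * c * ρ})
    (huw : ‖w - u‖ ≤ 2 * inner ℝ (b i₀) (w - u)) :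
    inner ℝ (b i₀) (w - u) < r / (2 * d * n) := by
  have hρ := S.ρ_pos; have hγ := S.γ_pos; have hc := S.c_pos; have hη := S.η_pos
  have hℓ := S.ℓ_pos
  have hθ1 : θ < 1 := by nlinarith [S.η_mul_γ_le]
  have key : ∀ y ∈ insert 0 {u | ∀ k ≤ N, ‖((agdStep η ζ G)^[k] (u, u)).1‖ ≤ 12 * c * ρ},
      ∀ k ≤ N, ‖((agdStep η ζ G)^[k] (y, y)).1‖ ≤ 12 * c * ρ := by
    rintro y (rfl | hy) k hk
    · rw [agd_zero M.G_zero, norm_zero]; positivity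
    · exact hy k hk
  by_contra! hcon
  set σ := η * -lam i₀ with hσ
  have hx : 0.9 * θ ^ 2 ≤ σ := by
    rw [hθ2, hσ, mul_left_comm]; gcongr; linarith
  have hσ0 : 0 < σ := (by positivity : 0 < 0.9 * θ ^ 2).trans_le hx
  have hsq : 0.9 * θ ≤ √σ := by
    apply Real.le_sqrt_of_sq_le
    nlinarith [sq_nonneg θ]
  have h1 := M.agd_separation hb hmin hη.le S.η_mul_le S.L₂_pos.le hσ hσ0 hθ hθ1.le
    (by linarith) hζ ((S.agd_perturbation hθ hθ2 hN').trans hsq) (key u hu) (key w hw) huw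
  have h2 : Real.exp (3 * ℓ) ≤ (1 + √σ / 2) ^ N := by
    calc Real.exp (3 * ℓ) ≤ Real.exp (N * (0.9 * θ / 2 / 2)) := by
          apply Real.exp_le_exp.2
          have : 43 * ℓ ≤ c * ℓ := by gcongr; exact S.c_ge
          linarith
      _ ≤ (1 + 0.9 * θ / 2) ^ N := exp_le_one_add_pow (by positivity) (by linarith) N
      _ ≤ _ := by gcongr
  have h3 := S.lt_growth hd hn hgap h2 hcon
  linarith

end failure

/-! ### Failure probabilities of the two procedures -/

section probability

variable {d m : ℕ} {Ξ : Type*} [MeasurableSpace Ξ] {f : Vec d → Ξ → ℝ}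
  {c A η ρ F r κ L₁ L₂ γ ℓ δ : ℝ}

lemma Scaling.exists_eigenbasis_of_close (S : Scaling c A η ρ F r κ L₁ L₂ γ ℓ)
    {A B : Vec d →L[ℝ] Vec d} (hB : ∀ v w, inner ℝ (B v) w = inner ℝ v (B w))
    (hlam : lambdaMin A ≤ -γ) (h : ‖B - A‖ ≤ κ / 2) :
    ∃ (b : OrthonormalBasis (Fin d) ℝ (Vec d)) (lam : Fin d → ℝ) (i₀ : Fin d),
      (∀ i, B (b i) = lam i • b i) ∧ (∀ i, lam i₀ ≤ lam i) ∧ lam i₀ ≤ -(0.9 * γ) := by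
  obtain ⟨v, hv, hvA⟩ := exists_unit_of_lambdaMin_le S.γ_pos hlam
  refine exists_eigenbasis_min hB hv ?_
  have := (abs_le.1 (inner_sub_apply_le A B h v)).2
  rw [hv] at this
  linarith [S.κ_le, S.γ_pos]

lemma batch_pos (hd : 0 < d) (hL₁ : 0 < L₁) (hδ : 0 < δ) (hδ1 : δ ≤ 1 / 100) {ε : ℝ}
    (hm : 16 * L₁ ^ 2 * Real.log (6 * d / δ) ≤ m * ε ^ 2) : 0 < m := by
  rw [Nat.pos_iff_ne_zero]
  rintro rfl
  have hd' : (1 : ℝ) ≤ d := by exact_mod_cast hd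
  have : 0 < Real.log (6 * d / δ) := Real.log_pos (by rw [lt_div_iff₀ hδ]; linarith)
  have : 0 < 16 * L₁ ^ 2 * Real.log (6 * d / δ) := by positivity
  simp only [Nat.cast_zero, zero_mul] at hm
  linarith

/-- The accuracy `κ / 2` of the sampled Hessian is used twice: it preserves an eigenvalue below
`-0.9γ`, and it transfers curvature `-κ` of the sample to `-κ / 2` of the true Hessian. -/
theorem Scaling.runLaw_neon_le (S : Scaling c A η ρ F r κ L₁ L₂ γ ℓ) (D : Measure Ξ)
    [IsProbabilityMeasure D] (hd : 0 < d) (hint : ∀ z, Integrable (f z) D)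
    (hf : ∀ e, SmoothFun L₁ L₂ (fun z => f z e)) (x : Vec d)
    (hlam : lambdaMin (hessian (fun z => ∫ e, f z e ∂D) x) ≤ -γ) (hδ : 0 < δ) (hδ1 : δ ≤ 1 / 100)
    (hm : 16 * L₁ ^ 2 * Real.log (6 * d / δ) ≤ m * (κ / 2) ^ 2) {n : ℕ} (hn : 0 < n)
    (hgap : 768 * c * (d * n * ℓ * (L₁ / γ)) < Real.exp (3 * ℓ)) {t : ℕ}
    (ht : c * ℓ ≤ ((t + 1 : ℕ) : ℝ) * (η * γ)) (ht' : ((t + 1 : ℕ) : ℝ) * (η * γ) ≤ 1.1 * c * ℓ) :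
    runLaw D m d r {ω | ¬ IsNC (hessian (fun z => ∫ e, f z e ∂D) x) (κ / 2)
      ((neon x η t F (4 * c * ρ) ω.2).run (ifo f ω.1)).1} ≤ ENNReal.ofReal (δ / 6) + 3 / n := by
  refine runLaw_le_of_measurable D hd S.L₁_pos.le S.L₂_pos.le hint hf x
    (fun u => neon x η t F (4 * c * ρ) u) ?_
  intro f' hmeas hint' hf' hF
  rw [← hF] at hlam
  refine runLaw_le_of_trapped D hd S.L₁_pos S.L₂_pos hmeas hint' hf' x hδ hδ1
    (half_pos S.κ_pos) S.r_pos hm hn (N := t + 1) (U := 4 * c * ρ)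
    (fun G k u => (gdStep η G)^[k] u) (measurable_gd_iterate hmeas hf' x η) _ ?_
  intro ξ hξ
  have M := sample_localModel (batch_pos hd S.L₁_pos hδ hδ1 hm) S.L₁_pos.le S.L₂_pos.le hf' x ξ
  constructor
  · intro u hu hbad
    refine M.gd_failure S ht' hu rfl fun hcon => hbad ?_
    refine isNC_of_close hξ ?_ ?_
    · change ((neon x η t F (4 * c * ρ) u).run (ifo f' ξ)).1 ≠ 0
      rw [run_neon]
      exact hcon.1
    · change inner ℝ ((neon x η t F (4 * c * ρ) u).run (ifo f' ξ)).1 _ ≤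
        -κ * ‖((neon x η t F (4 * c * ρ) u).run (ifo f' ξ)).1‖ ^ 2
      rw [run_neon]
      exact hcon.2
  · obtain ⟨b, lam, i₀, hb, hmin, hle⟩ := S.exists_eigenbasis_of_close M.symm hlam hξ
    exact ⟨b i₀, b.norm_eq_one i₀, fun u hu w hw huw =>
      M.gd_not_separated S hd hn hgap ht ht' hb hmin hle hu hw huw⟩

/-- Same scheme as for gradient descent, with confinement measured on the `y`-iterates and `θ =
√(ηγ)`. -/
theorem Scaling.runLaw_neonPlus_le (S : Scaling c A η ρ F r κ L₁ L₂ γ ℓ)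
    (hAℓ : 10 ^ 4 * c ^ 3 * (A * √ℓ) ≤ 1) (D : Measure Ξ)
    [IsProbabilityMeasure D] (hd : 0 < d) (hint : ∀ z, Integrable (f z) D)
    (hf : ∀ e, SmoothFun L₁ L₂ (fun z => f z e)) (x : Vec d)
    (hlam : lambdaMin (hessian (fun z => ∫ e, f z e ∂D) x) ≤ -γ) (hδ : 0 < δ) (hδ1 : δ ≤ 1 / 100)
    (hm : 16 * L₁ ^ 2 * Real.log (6 * d / δ) ≤ m * (κ / 2) ^ 2) {n : ℕ} (hn : 0 < n)
    (hgap : 768 * c * (d * n * ℓ * (L₁ / γ)) < Real.exp (3 * ℓ)) {t : ℕ}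
    (ht : c * ℓ ≤ ((t + 1 : ℕ) : ℝ) * √(η * γ)) (ht' : ((t + 1 : ℕ) : ℝ) * √(η * γ) ≤ 1.1 * c * ℓ) :
    runLaw D m d r {ω | ¬ IsNC (hessian (fun z => ∫ e, f z e ∂D) x) (κ / 2)
      ((neonPlus x η γ t F (12 * c * ρ) (1 - √(η * γ)) ω.2).run (ifo f ω.1)).1}
      ≤ ENNReal.ofReal (δ / 6) + 3 / n := by
  have hηγ := mul_pos S.η_pos S.γ_pos
  have hθ := Real.sqrt_pos.2 hηγ
  have hθ2 := Real.sq_sqrt hηγ.le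
  refine runLaw_le_of_measurable D hd S.L₁_pos.le S.L₂_pos.le hint hf x
    (fun u => neonPlus x η γ t F (12 * c * ρ) (1 - √(η * γ)) u) ?_
  intro f' hmeas hint' hf' hF
  rw [← hF] at hlam
  refine runLaw_le_of_trapped D hd S.L₁_pos S.L₂_pos hmeas hint' hf' x hδ hδ1
    (half_pos S.κ_pos) S.r_pos hm hn (N := t + 1) (U := 12 * c * ρ)
    (fun G k u => ((agdStep η (1 - √(η * γ)) G)^[k] (u, u)).1)
    (measurable_agd_iterate hmeas hf' x η _) _ ?_
  intro ξ hξ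
  have M := sample_localModel (batch_pos hd S.L₁_pos hδ hδ1 hm) S.L₁_pos.le S.L₂_pos.le hf' x ξ
  constructor
  · intro u hu hbad
    exact M.agd_failure S hAℓ hθ hθ2 rfl ht' hu
      (run_neonPlus (ifo f' ξ) x η γ t F (12 * c * ρ) (1 - √(η * γ)) u).2
      fun hcon => hbad (isNC_of_close hξ hcon.1 hcon.2)
  · obtain ⟨b, lam, i₀, hb, hmin, hle⟩ := S.exists_eigenbasis_of_close M.symm hlam hξ
    exact ⟨b i₀, b.norm_eq_one i₀, fun u hu w hw huw =>
      M.agd_not_separated S hθ hθ2 rfl hd hn hgap ht ht' hb hmin hle hu hw huw⟩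

/-- If failing to find a direction of negative curvature is unlikely, then so is a false
certificate. -/
lemma runLaw_certificate_le (D : Measure Ξ) [IsProbabilityMeasure D] {H : Vec d →L[ℝ] Vec d}
    {κ : ℝ} (hγ : 0 ≤ γ) {R : (Fin m → Ξ) × Vec d → Vec d} {b : ENNReal}
    (h : lambdaMin H ≤ -γ → runLaw D m d r {ω | ¬ IsNC H κ (R ω)} ≤ b) :
    runLaw D m d r {ω | ¬ (R ω = 0 → -(2 * γ) ≤ lambdaMin H)} ≤ b := by
  by_cases hH : lambdaMin H ≤ -γ
  · refine (measure_mono fun ω hω => ?_).trans (h hH)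
    exact fun hcon => hω fun h0 => absurd h0 hcon.1
  · have : {ω | ¬ (R ω = 0 → -(2 * γ) ≤ lambdaMin H)} = ∅ := by
      ext ω
      simp only [Set.mem_ofPred_eq, Set.mem_empty_iff_false, iff_false, not_not]
      intro _
      linarith
    rw [this, measure_empty]
    exact zero_le

end probability

/-! ### Choice of the parameters and oracle cost -/

section parameters

variable {c A a η L₁ L₂ γ ℓ δ : ℝ} {d m : ℕ}

/-- The choice `n = ⌈9 / δ⌉` makes the spherical part at most `δ / 3`. -/
lemma ofReal_add_three_div_le (hδ : 0 < δ) :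
    ENNReal.ofReal (δ / 6) + 3 / (⌈9 / δ⌉₊ : ENNReal) ≤ ENNReal.ofReal δ := by
  have hn : 9 / δ ≤ (⌈9 / δ⌉₊ : ℝ) := Nat.le_ceil _
  have hn0 : (0 : ℝ) < (⌈9 / δ⌉₊ : ℝ) := (by positivity : 0 < 9 / δ).trans_le hn
  have h1 : (3 / (⌈9 / δ⌉₊ : ENNReal)) = ENNReal.ofReal (3 / (⌈9 / δ⌉₊ : ℝ)) := by
    rw [ENNReal.ofReal_div_of_pos hn0, ENNReal.ofReal_natCast]
    norm_num
  rw [h1, ← ENNReal.ofReal_add (by positivity) (by positivity)]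
  apply ENNReal.ofReal_le_ofReal
  have : 3 / (⌈9 / δ⌉₊ : ℝ) ≤ δ / 3 := by
    rw [div_le_div_iff₀ hn0 (by norm_num)]
    rw [div_le_iff₀ hδ] at hn
    linarith
  linarith

lemma scaling_of_parameters (hc : 43 ≤ c) (hA : 0 < A) (hA1 : 10 ^ 4 * c ^ 3 * A ≤ 1)
    (hL₁ : 0 < L₁) (hL₂ : 0 < L₂) (hγ : 0 < γ) (hγL : γ ≤ L₁) (hℓ : 6 ≤ ℓ)
    (hη : η = A ^ 2 / L₁) :
    Scaling c A η (searchScale η L₁ L₂ γ ℓ) (decreaseParam η L₁ L₂ γ ℓ) (noiseRadius η L₁ L₂ γ ℓ)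
      (2 * (ncConst c ℓ * γ)) L₁ L₂ γ ℓ := by
  have hℓ0 : 0 < ℓ := by linarith
  have hc0 : 0 < c := by linarith
  have hηL : η * L₁ = A ^ 2 := by rw [hη]; field_simp
  have hs : √(η * L₁) = A := by rw [hηL, Real.sqrt_sq hA.le]
  -- The base of the cube root is a perfect cube, because `√(η L₁) = A`.
  have hρ : searchScale η L₁ L₂ γ ℓ = A * γ / (L₂ * ℓ) := by
    have h1 : √(η * L₁) * decreaseParam η L₁ L₂ γ ℓ / L₂ = (A * γ / (L₂ * ℓ)) ^ 3 := by
      rw [hs, decreaseParam, hη]; field_simp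
    rw [searchScale, h1, ← Real.rpow_natCast, ← Real.rpow_mul (by positivity)]
    norm_num
  have hr : √η / √L₁ = A / L₁ := by
    rw [hη, Real.sqrt_div (by positivity), Real.sqrt_sq hA.le, div_div,
      Real.mul_self_sqrt hL₁.le]
  refine ⟨hc, hA, hA1, hL₁, hL₂, hγ, hγL, hℓ, hηL, ?_, ?_, ?_, ?_⟩
  · rw [hρ]; field_simp
  · rw [hρ, decreaseParam, hη]; field_simp
  · have : noiseRadius η L₁ L₂ γ ℓ = √η / √L₁ * (γ ^ 2 / (L₂ * ℓ ^ 2)) := by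
      rw [noiseRadius]
      field_simp
    rw [this, hr, hρ]; field_simp
  · rw [ncConst]; field_simp; norm_num

/-- The number of steps is at most 10% off after rounding. -/
lemma ceil_add_one_mul {s p : ℝ} (hp : 0 < p) (hp1 : p ≤ 1) (hs : 20 ≤ s) :
    s ≤ ((⌈s / p⌉₊ + 1 : ℕ) : ℝ) * p ∧ ((⌈s / p⌉₊ + 1 : ℕ) : ℝ) * p ≤ 1.1 * s := by
  have h1 : s / p ≤ ⌈s / p⌉₊ := Nat.le_ceil _
  have h2 : (⌈s / p⌉₊ : ℝ) < s / p + 1 := Nat.ceil_lt_add_one (by positivity)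
  have h3 : s / p * p = s := by field_simp
  push_cast
  constructor <;> nlinarith

/-- Consequences of the choice of `ℓ` for small `δ`. -/
lemma logFactor_spec (hc : 43 ≤ c) (hd : 0 < d) (hγ : 0 < γ) (hγL : γ ≤ L₁) (hδ : 0 < δ)
    (hδ1 : δ * (10 ^ 4 * c) ≤ 1) (hℓ : ℓ = logFactor d L₁ γ δ) :
    6 ≤ ℓ ∧ 15000 * c ≤ Real.exp ℓ ∧ d * (L₁ / γ) = 2 / 3 * δ * Real.exp ℓ ∧
      Real.log (6 * d / δ) ≤ 2 * ℓ := by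
  have hL : 0 < L₁ := hγ.trans_le hγL
  have hc0 : 0 < c := by linarith
  have hd' : (1 : ℝ) ≤ d := by exact_mod_cast hd
  have hd0 : (0 : ℝ) < d := by linarith
  have hexp : Real.exp ℓ = 3 * d * L₁ / (2 * γ * δ) := by
    rw [hℓ, logFactor, Real.exp_log (by positivity)]
  have h1 : (1 : ℝ) ≤ L₁ / γ := by rwa [one_le_div hγ]
  have h2 : d * (L₁ / γ) = 2 / 3 * δ * Real.exp ℓ := by rw [hexp]; field_simp
  have h3 : 3 * d / (2 * δ) ≤ Real.exp ℓ := by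
    rw [hexp, div_le_div_iff₀ (by positivity) (by positivity)]
    have := mul_le_mul_of_nonneg_left hγL (by positivity : 0 ≤ 3 * (d : ℝ) * (2 * δ))
    linarith
  have h4 : 15000 * c ≤ Real.exp ℓ := by
    refine le_trans ?_ h3
    rw [le_div_iff₀ (by positivity)]
    linarith
  have h5 : 6 ≤ ℓ := by
    rw [← Real.exp_le_exp]
    refine le_trans ?_ h4
    calc Real.exp 6 = Real.exp 1 ^ 6 := by rw [← Real.exp_nat_mul]; norm_num
      _ ≤ 3 ^ 6 := by gcongr; exact Real.exp_one_lt_three.le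
      _ ≤ 15000 * c := by linarith
  refine ⟨h5, h4, h2, ?_⟩
  rw [Real.log_le_iff_le_exp (by positivity)]
  calc 6 * d / δ = 4 * (3 * d / (2 * δ)) := by field_simp; norm_num
    _ ≤ 4 * Real.exp ℓ := by gcongr
    _ ≤ Real.exp ℓ * Real.exp ℓ := by gcongr; linarith
    _ = Real.exp (2 * ℓ) := by rw [← Real.exp_add]; ring_nf

/-- `ℓ` is defined so that `d L₁ / γ` is `δ` times `exp ℓ` up to a constant. The `1 / δ` in `n`
cancels that `δ`, and the two remaining factors `exp ℓ` absorb `ℓ` and the constants. -/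
lemma gap_of_logFactor (hc : 43 ≤ c) (hδ : 0 < δ) (hδ1 : δ ≤ 1) (hℓ : 6 ≤ ℓ)
    (h1 : 15000 * c ≤ Real.exp ℓ) (h2 : d * (L₁ / γ) = 2 / 3 * δ * Real.exp ℓ) :
    768 * c * (d * ⌈9 / δ⌉₊ * ℓ * (L₁ / γ)) < Real.exp (3 * ℓ) := by
  have hn : (⌈9 / δ⌉₊ : ℝ) < 9 / δ + 1 := Nat.ceil_lt_add_one (by positivity)
  have hn' : (⌈9 / δ⌉₊ : ℝ) * δ ≤ 10 := by
    have : 9 / δ * δ = 9 := by field_simp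
    nlinarith
  have h3 : ℓ ≤ Real.exp ℓ := by linarith [Real.add_one_le_exp ℓ]
  have h4 := Real.exp_pos ℓ
  calc 768 * c * (d * ⌈9 / δ⌉₊ * ℓ * (L₁ / γ))
      = 768 * c * ⌈9 / δ⌉₊ * ℓ * (d * (L₁ / γ)) := by ring
    _ = 512 * c * (⌈9 / δ⌉₊ * δ) * ℓ * Real.exp ℓ := by rw [h2]; ring
    _ ≤ 512 * c * 10 * Real.exp ℓ * Real.exp ℓ := by gcongr
    _ < 15000 * c * Real.exp ℓ * Real.exp ℓ := by
      have h5 : 512 * c * 10 < 15000 * c := by linarith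
      exact mul_lt_mul_of_pos_right (mul_lt_mul_of_pos_right h5 h4) h4
    _ ≤ Real.exp ℓ * Real.exp ℓ * Real.exp ℓ := by gcongr
    _ = Real.exp (3 * ℓ) := by rw [← Real.exp_add, ← Real.exp_add]; ring_nf

lemma log_le_of_batchSize_le {s M : ℝ} (hs : 0 < s) (hγ : 0 < γ) (hM : M = batchSize d L₁ γ δ s)
    (hm : M ≤ m) : 16 * L₁ ^ 2 * Real.log (6 * d / δ) ≤ m * (2 * (s * γ) / 2) ^ 2 := by
  rw [hM, batchSize, div_le_iff₀ (by positivity)] at hm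
  calc _ ≤ _ := hm
    _ = _ := by ring

/-- The size of the mini-batch. -/
lemma ceil_batchSize_le {s M : ℝ} (hc : 43 ≤ c) (hd : 0 < d) (hγ : 0 < γ) (hγL : γ ≤ L₁)
    (hδ : 0 < δ) (hδ1 : δ ≤ 1) (hℓ : 6 ≤ ℓ) (hlog : Real.log (6 * d / δ) ≤ 2 * ℓ)
    (hs : s = ncConst c ℓ) (hM : M = batchSize d L₁ γ δ s) :
    (⌈M⌉₊ : ℝ) ≤ 64 * 144 ^ 2 * c ^ 4 * ℓ ^ 3 * (L₁ / γ) ^ 2 := by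
  have hL : 0 < L₁ := hγ.trans_le hγL
  have hc0 : 0 < c := by linarith
  have hℓ0 : 0 < ℓ := by linarith
  have hd' : (1 : ℝ) ≤ d := by exact_mod_cast hd
  have hlog0 : 0 ≤ Real.log (6 * d / δ) :=
    Real.log_nonneg (by rw [le_div_iff₀ hδ]; linarith)
  have hMeq : M = 16 * 144 ^ 2 * c ^ 4 * ℓ ^ 2 * (L₁ / γ) ^ 2 * Real.log (6 * d / δ) := by
    rw [hM, hs, batchSize, ncConst]; field_simp; norm_num
  have hM1 : M ≤ 32 * 144 ^ 2 * c ^ 4 * ℓ ^ 3 * (L₁ / γ) ^ 2 := by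
    calc M ≤ 16 * 144 ^ 2 * c ^ 4 * ℓ ^ 2 * (L₁ / γ) ^ 2 * (2 * ℓ) := by rw [hMeq]; gcongr
      _ = _ := by ring
  have h1 : (1 : ℝ) ≤ L₁ / γ := by rwa [one_le_div hγ]
  have h2 : 1 ≤ 32 * 144 ^ 2 * c ^ 4 * ℓ ^ 3 * (L₁ / γ) ^ 2 := by
    have h3 : 1 ≤ c ^ 4 := one_le_pow₀ (by linarith)
    have h4 : 1 ≤ ℓ ^ 3 := one_le_pow₀ (by linarith)
    have h5 : 1 ≤ (L₁ / γ) ^ 2 := one_le_pow₀ h1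
    calc (1 : ℝ) ≤ 32 * 144 ^ 2 * 1 * 1 * 1 := by norm_num
      _ ≤ _ := by gcongr
  have h3 : (⌈M⌉₊ : ℝ) < M + 1 := Nat.ceil_lt_add_one (by rw [hMeq]; positivity)
  linarith

lemma neon_cost_le (hc : 43 ≤ c) (ha : 0 < a) (ha1 : a ≤ 1) (hγ : 0 < γ) (hγL : γ ≤ L₁)
    (hℓ : 6 ≤ ℓ) (hη : η = a / L₁)
    (hm : (m : ℝ) ≤ 64 * 144 ^ 2 * c ^ 4 * ℓ ^ 3 * (L₁ / γ) ^ 2) :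
    ((m * (⌈c * ℓ / (η * γ)⌉₊ + 3) : ℕ) : ℝ)
      ≤ 200 * 144 ^ 2 * c ^ 5 / a * ℓ ^ 4 * (L₁ / γ) ^ 3 := by
  have hL : 0 < L₁ := hγ.trans_le hγL
  have hc0 : 0 < c := by linarith
  have hℓ0 : 0 < ℓ := by linarith
  have h1 : c * ℓ / (η * γ) = c * ℓ * (L₁ / γ) / a := by rw [hη]; field_simp
  have h2 : (1 : ℝ) ≤ L₁ / γ := by rwa [one_le_div hγ]
  have h3 : 1 ≤ (L₁ / γ) / a := by rw [one_le_div ha]; linarith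
  have h4 : 200 ≤ c * ℓ := by nlinarith
  have h5 : (200 : ℝ) * 1 ≤ c * ℓ * ((L₁ / γ) / a) := by gcongr
  have h6 : (⌈c * ℓ / (η * γ)⌉₊ : ℝ) < c * ℓ / (η * γ) + 1 :=
    Nat.ceil_lt_add_one (by rw [h1]; positivity)
  have h7 : (⌈c * ℓ / (η * γ)⌉₊ : ℝ) + 3 ≤ 2 * (c * ℓ * (L₁ / γ) / a) := by
    rw [h1] at h6
    rw [← mul_div_assoc] at h5
    rw [h1]
    linarith
  push_cast
  calc (m : ℝ) * (⌈c * ℓ / (η * γ)⌉₊ + 3)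
      ≤ 64 * 144 ^ 2 * c ^ 4 * ℓ ^ 3 * (L₁ / γ) ^ 2 * (2 * (c * ℓ * (L₁ / γ) / a)) := by gcongr
    _ = 128 * (144 ^ 2 * c ^ 5 / a * ℓ ^ 4 * (L₁ / γ) ^ 3) := by ring
    _ ≤ 200 * (144 ^ 2 * c ^ 5 / a * ℓ ^ 4 * (L₁ / γ) ^ 3) := by gcongr; norm_num
    _ = _ := by ring

lemma neonPlus_cost_le (hc : 43 ≤ c) (ha : 0 < a) (ha1 : a ≤ 1) (hγ : 0 < γ) (hγL : γ ≤ L₁)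
    (hℓ : 6 ≤ ℓ) (hη : η = a / (L₁ * ℓ))
    (hm : (m : ℝ) ≤ 64 * 144 ^ 2 * c ^ 4 * ℓ ^ 3 * (L₁ / γ) ^ 2) :
    ((m * (2 * ⌈c * ℓ / √(η * γ)⌉₊ + 4) : ℕ) : ℝ)
      ≤ 200 * 144 ^ 2 * c ^ 5 / a * ℓ ^ (9 / 2 : ℝ) * (L₁ / γ) ^ (5 / 2 : ℝ) := by
  have hL : 0 < L₁ := hγ.trans_le hγL
  have hc0 : 0 < c := by linarith
  have hℓ0 : 0 < ℓ := by linarith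
  have h2 : (1 : ℝ) ≤ L₁ / γ := by rwa [one_le_div hγ]
  have h0 : 0 < L₁ / γ := by linarith
  have hpow1 : ℓ ^ (9 / 2 : ℝ) = ℓ ^ 4 * √ℓ := by
    rw [Real.sqrt_eq_rpow, ← Real.rpow_natCast, ← Real.rpow_add hℓ0]; norm_num
  have hpow2 : (L₁ / γ) ^ (5 / 2 : ℝ) = (L₁ / γ) ^ 2 * √(L₁ / γ) := by
    rw [Real.sqrt_eq_rpow, ← Real.rpow_natCast, ← Real.rpow_add h0]; norm_num
  have hsa : √a * √a = a := Real.mul_self_sqrt ha.le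
  have hsa0 : 0 < √a := Real.sqrt_pos.2 ha
  have hsa1 : √a ≤ 1 := Real.sqrt_le_one.2 ha1
  have h1 : c * ℓ / √(η * γ) = c * ℓ * √ℓ * √(L₁ / γ) / √a := by
    have : η * γ = a / (ℓ * (L₁ / γ)) := by rw [hη]; field_simp
    rw [this, Real.sqrt_div ha.le, Real.sqrt_mul hℓ0.le]
    field_simp
  have h3 : 1 ≤ √ℓ * √(L₁ / γ) / √a := by
    have e1 : 1 ≤ √ℓ := by rw [Real.one_le_sqrt]; linarith
    have e2 : 1 ≤ √(L₁ / γ) := by rwa [Real.one_le_sqrt]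
    rw [one_le_div hsa0]
    nlinarith
  have h4 : 200 ≤ c * ℓ := by nlinarith
  have h5 : (200 : ℝ) * 1 ≤ c * ℓ * (√ℓ * √(L₁ / γ) / √a) := by gcongr
  have h6 : (⌈c * ℓ / √(η * γ)⌉₊ : ℝ) < c * ℓ / √(η * γ) + 1 :=
    Nat.ceil_lt_add_one (by rw [h1]; positivity)
  have h7 : 2 * (⌈c * ℓ / √(η * γ)⌉₊ : ℝ) + 4 ≤ 3 * (c * ℓ * (√ℓ * √(L₁ / γ)) / a) := by
    have e1 : c * ℓ / √(η * γ) = c * ℓ * (√ℓ * √(L₁ / γ) / √a) := by rw [h1]; ring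
    have e2 : c * ℓ * (√ℓ * √(L₁ / γ) / √a) ≤ c * ℓ * (√ℓ * √(L₁ / γ)) / a := by
      rw [← mul_div_assoc]
      gcongr
      nlinarith
    rw [e1] at h6 ⊢
    linarith
  push_cast
  calc (m : ℝ) * (2 * ⌈c * ℓ / √(η * γ)⌉₊ + 4)
      ≤ 64 * 144 ^ 2 * c ^ 4 * ℓ ^ 3 * (L₁ / γ) ^ 2 * (3 * (c * ℓ * (√ℓ * √(L₁ / γ)) / a)) := by
        gcongr
    _ = 192 * (144 ^ 2 * c ^ 5 / a * ℓ ^ 4 * √ℓ * ((L₁ / γ) ^ 2 * √(L₁ / γ))) := by ring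
    _ ≤ 200 * (144 ^ 2 * c ^ 5 / a * ℓ ^ 4 * √ℓ * ((L₁ / γ) ^ 2 * √(L₁ / γ))) := by
        gcongr; norm_num
    _ = _ := by rw [hpow1, hpow2]; ring

end parameters

end

/-! ### Assembly -/

theorem mainTheorem3 :
    ∃ C : ℝ, 0 < C ∧ ∀ chat : ℝ, 43 ≤ chat →
    ∃ cmax δ₀ : ℝ, 0 < cmax ∧ 0 < δ₀ ∧ δ₀ < 1 ∧
    ∀ a : ℝ, 0 < a → a ≤ cmax →
    ∃ K : ℝ, 0 < K ∧
    ∀ (d : ℕ) (_hd : 0 < d) (Ξ : Type*) [MeasurableSpace Ξ]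
      (D : Measure Ξ) [IsProbabilityMeasure D] (f : Vec d → Ξ → ℝ) (L₁ L₂ : ℝ)
      (_hL₁ : 0 < L₁) (_hL₂ : 0 < L₂)
      (_hint : ∀ z, Integrable (f z) D)
      (_hf : ∀ e, SmoothFun L₁ L₂ (fun z => f z e))
      (x : Vec d) (γ δ : ℝ) (_hγ : 0 < γ) (_hγL : γ ≤ L₁) (_hδ : 0 < δ) (_hδ₀ : δ ≤ δ₀)
      (F : Vec d → ℝ) (_hF : F = fun z => ∫ e, f z e ∂D)
      (ℓ s c M : ℝ) (_hℓ : ℓ = logFactor d L₁ γ δ) (_hs : s = ncConst chat ℓ)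
      (_hc : c = ncConst chat ℓ) (_hM : M = batchSize d L₁ γ δ s)
      (m : ℕ) (_hm : M ≤ m),
      -- NEON with step size `η = a / L₁`
      (∀ η r : ℝ, η = a / L₁ → r = noiseRadius η L₁ L₂ γ ℓ →
        (lambdaMin (hessian F x) ≤ -γ →
          runLaw D m d r
            {ω | ¬ IsNC (hessian F x) (c * γ) (neonRun f x chat η L₁ L₂ γ ℓ ω.1 ω.2).1}
            ≤ ENNReal.ofReal δ) ∧
        runLaw D m d r
            {ω | ¬ ((neonRun f x chat η L₁ L₂ γ ℓ ω.1 ω.2).1 = 0 →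
              -(2 * γ) ≤ lambdaMin (hessian F x))}
            ≤ ENNReal.ofReal (C * δ) ∧
        (m = ⌈M⌉₊ → ∀ (ξ : Fin m → Ξ) (u₀ : Vec d),
          ((neonRun f x chat η L₁ L₂ γ ℓ ξ u₀).2 : ℝ)
            ≤ K * ℓ ^ 4 * (L₁ / γ) ^ 3)) ∧
      -- NEON⁺ with step size `η = a / (L₁ ℓ)`
      (∀ η r : ℝ, η = a / (L₁ * ℓ) → r = noiseRadius η L₁ L₂ γ ℓ →
        (lambdaMin (hessian F x) ≤ -γ →
          runLaw D m d r
            {ω | ¬ IsNC (hessian F x) (c * γ) (neonPlusRun f x chat η L₁ L₂ γ ℓ ω.1 ω.2).1}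
            ≤ ENNReal.ofReal δ) ∧
        runLaw D m d r
            {ω | ¬ ((neonPlusRun f x chat η L₁ L₂ γ ℓ ω.1 ω.2).1 = 0 →
              -(2 * γ) ≤ lambdaMin (hessian F x))}
            ≤ ENNReal.ofReal (C * δ) ∧
        (m = ⌈M⌉₊ → ∀ (ξ : Fin m → Ξ) (u₀ : Vec d),
          ((neonPlusRun f x chat η L₁ L₂ γ ℓ ξ u₀).2 : ℝ)
            ≤ K * ℓ ^ (9 / 2 : ℝ) * (L₁ / γ) ^ (5 / 2 : ℝ))) := by
  refine ⟨1, one_pos, fun c hc => ?_⟩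
  have hc0 : 0 < c := by linarith
  have hc3 : 1 ≤ 10 ^ 4 * c ^ 3 := by
    have : 1 ≤ c ^ 3 := one_le_pow₀ (by linarith)
    linarith
  -- The first constant makes `10 ^ 4 * c ^ 3 * √a ≤ 1`, the smallness of `A` required in `Scaling`.
  -- The second makes `exp ℓ ≥ 15000 * c`.
  refine ⟨((10 ^ 4 * c ^ 3) ^ 2)⁻¹, (10 ^ 4 * c)⁻¹, by positivity, by positivity,
    inv_lt_one_of_one_lt₀ (by linarith), fun a ha ha1 => ?_⟩
  have hsa : 10 ^ 4 * c ^ 3 * √a ≤ 1 := by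
    rw [mul_comm, ← le_div_iff₀ (by positivity), one_div]
    refine Real.sqrt_le_iff.2 ⟨by positivity, ?_⟩
    rwa [inv_pow]
  have hsa0 : 0 < √a := Real.sqrt_pos.2 ha
  have ha2 : a ≤ 1 := ha1.trans (inv_le_one_of_one_le₀ (one_le_pow₀ hc3))
  refine ⟨200 * 144 ^ 2 * c ^ 5 / a, by positivity, ?_⟩
  intro d hd Ξ _ D _ f L₁ L₂ hL₁ hL₂ hint hf x γ δ hγ hγL hδ hδ₀ F hF ℓ s c' M hℓ hs hc' hM m hm
  subst hF
  have hδc : δ * (10 ^ 4 * c) ≤ 1 := by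
    rw [← le_div_iff₀ (by positivity), one_div]; exact hδ₀
  have hδ1 : δ ≤ 1 / 100 := by nlinarith
  obtain ⟨h6, h15000, hdL, hlog⟩ := logFactor_spec hc hd hγ hγL hδ hδc hℓ
  have hℓ0 : 0 < ℓ := by linarith
  have hgap := gap_of_logFactor hc hδ (by linarith) h6 h15000 hdL
  have hn : 0 < ⌈9 / δ⌉₊ := Nat.ceil_pos.2 (by positivity)
  have hs0 : 0 < s := by rw [hs, ncConst]; positivity
  have hκ : c' * γ = 2 * (ncConst c ℓ * γ) / 2 := by rw [hc']; ring
  have hbatch := log_le_of_batchSize_le hs0 hγ hM hm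
  rw [hs] at hbatch
  have hcost : m = ⌈M⌉₊ → (m : ℝ) ≤ 64 * 144 ^ 2 * c ^ 4 * ℓ ^ 3 * (L₁ / γ) ^ 2 := fun h => by
    rw [h]; exact ceil_batchSize_le hc hd hγ hγL hδ (by linarith) h6 hlog hs hM
  have hcℓ : 20 ≤ c * ℓ := by nlinarith
  rw [one_mul]
  constructor
  · intro η r hη hr
    subst hr
    have S := scaling_of_parameters hc hsa0 hsa hL₁ hL₂ hγ hγL h6
      (show η = √a ^ 2 / L₁ by rw [hη, Real.sq_sqrt ha.le])
    have hsteps := ceil_add_one_mul (mul_pos S.η_pos hγ) (S.η_mul_γ_le.trans (by norm_num)) hcℓ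
    rw [← mul_assoc (1.1 : ℝ) c ℓ] at hsteps
    have hmain := fun h => (S.runLaw_neon_le D hd hint hf x h hδ hδ1 hbatch hn hgap hsteps.1
      hsteps.2).trans (ofReal_add_three_div_le hδ)
    rw [hκ]
    refine ⟨hmain, runLaw_certificate_le D hγ.le hmain, fun h ξ u₀ => ?_⟩
    rw [neonRun, run_neon]
    exact neon_cost_le hc ha ha2 hγ hγL h6 hη (hcost h)
  · intro η r hη hr
    subst hr
    have hsℓ : 1 ≤ √ℓ := by rw [Real.one_le_sqrt]; linarith
    -- For NEON⁺, `A = √a / √ℓ`, so that both `A` and `A * √ℓ = √a` satisfy the smallness condition.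
    have hA1 : 10 ^ 4 * c ^ 3 * (√a / √ℓ) ≤ 1 := by
      refine le_trans ?_ hsa
      gcongr
      exact div_le_self hsa0.le hsℓ
    have hA2 : 10 ^ 4 * c ^ 3 * (√a / √ℓ * √ℓ) ≤ 1 := by
      rwa [div_mul_cancel₀ _ (by linarith)]
    have S := scaling_of_parameters hc (show 0 < √a / √ℓ by positivity) hA1 hL₁ hL₂ hγ hγL h6
      (show η = (√a / √ℓ) ^ 2 / L₁ by
        rw [hη, div_pow, Real.sq_sqrt ha.le, Real.sq_sqrt hℓ0.le, div_div, mul_comm])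
    have hsteps := ceil_add_one_mul (Real.sqrt_pos.2 (mul_pos S.η_pos hγ))
      (Real.sqrt_le_one.2 (S.η_mul_γ_le.trans (by norm_num))) hcℓ
    rw [← mul_assoc (1.1 : ℝ) c ℓ] at hsteps
    have hmain := fun h => (S.runLaw_neonPlus_le hA2 D hd hint hf x h hδ hδ1 hbatch hn hgap
      hsteps.1 hsteps.2).trans (ofReal_add_three_div_le hδ)
    rw [hκ]
    refine ⟨hmain, runLaw_certificate_le D hγ.le hmain, fun h ξ u₀ => ?_⟩
    refine le_trans ?_ (neonPlus_cost_le hc ha ha2 hγ hγL h6 hη (hcost h))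
    exact_mod_cast (run_neonPlus (ifo f ξ) x η γ _ _ _ _ u₀).1
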